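/- Let $\mathfrak h$ be a complex Hilbert space and $\{T_t\}_{t\ge 0}$ a $C_0$ (strongly continuous) contraction semigroup on $\mathfrak h$ with infinitesimal generator $G$ and cogenerator $T=(G+I)(G-I)^{-1}$. Let $$\mathfrak h_u=\{x\in\mathfrak h:\ \|T_tx\|=\|x\|=\|T_t^*x\|\ \text{ for all } t\ge 0\}$$ be its unitary subspace, a closed subspace that reduces every $T_t$ and $T$, with orthogonal projection $P_u$. On $\mathfrak h_u$ let $\mathcal U=\{U_t\}_{t\in\mathbb R}$ be the unitary group with $U_t=T_t|_{\mathfrak h_u}$ and $U_{-t}=U_t^*$ for $t\ge 0$, let $A$ be its self-adjoint generator, $U_t=e^{itA}$, and let $\mathcal C=\{U^n\}_{n\in\mathbb Z}$ be the group of powers of the unitary operator $U=T|_{\mathfrak h_u}$ (where $U^{-n}=(U^*)^n$). A spectral family is a nondecreasing, strongly right-continuous family of orthogonal projections on $\mathfrak h_u$ indexed by $\mathbb R$, tending strongly to $0$ at $-\infty$ and to $I$ at $+\infty$. There is exactly one spectral family $\mathcal E=\{E_\lambda\}_{\lambda\in\mathbb R}$ with $A=\int_{-\infty}^{\infty}\lambda\,dE_\lambda$,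 and exactly one spectral family $\{F_\theta\}$, carried by $[0,1)$ ($F_\theta=0$ for $\theta<0$ and $F_\theta\to I$ strongly as $\theta\uparrow 1$), with $U=\int_0^1 e^{2\pi i\theta}\,dF_\theta$; write $\mathcal F=\{F_\theta:0\le\theta<1\}$. The two families agree up to reparametrization: $$E_\lambda=F_{\theta(\lambda)},\qquad \theta(\lambda)=\tfrac12+\tfrac1\pi\arctan\lambda,\qquad \lambda\in\mathbb R .$$ For a set $\mathcal A$ of bounded operators on $\mathfrak h_u$ let $\mathcal M^{\mathcal A}$ be the least $*$-closed, weakly closed (weak operator topology) subalgebra of $\mathcal L(\mathfrak h_u)$ containing $\mathcal A$ (it is not required in advance to contain the identity). Put $$\mathcal L_{\mathcal E}=\Big\{\int_{-\infty}^{\infty} u(\lambda)\,dE_\lambda\Big\},\qquad \mathcal L_{\mathcal F}=\Big\{\int_0^1 w(e^{2\pi i\theta})\,dF_\theta\Big\},$$ where $u$ and $w$ range over the complex Borel functions that are essentially bounded with respect to $\mathcal E$ and $\mathcal F$ respectively, and let a bar denote closure in the strong operator topology. Then $$\mathcal M^{\mathcal U}=\overline{\mathcal L_{\mathcal E}}=\mathcal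 M^{\mathcal E}=\mathcal M^{\mathcal F}=\overline{\mathcal L_{\mathcal F}}=\mathcal M^{\mathcal C},$$ and this algebra is a $W^*$-subalgebra (a weakly closed $*$-subalgebra with a unit) of $\mathcal L(\mathfrak h_u)$ whose unit is $P_u$, the identity of $\mathcal L(\mathfrak h_u)$. -/

import Mathlib

open Filter Topology MeasureTheory Set
open scoped NNReal InnerProductSpace

noncomputable section

/-! ### Contraction semigroups, generators, cogenerators -/

/-- A strongly continuous (`C₀`) one-parameter semigroup of contractions on `H`. -/
structure C0ContractionSemigroup (H : Type*) [NormedAddCommGroup H] [InnerProductSpace ℂ H] where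
  op : ℝ≥0 → H →L[ℂ] H
  op_zero : op 0 = 1
  op_add : ∀ s t, op (s + t) = op s * op t
  norm_op_le : ∀ t, ‖op t‖ ≤ 1
  continuous_op : ∀ x, Continuous fun t => op t x

/-- The operator `x ↦ lim_{t → 0} (W t x - x) / t`, the limit being taken along the filter `l`,
with domain the set of all `x` for which the limit exists. -/
def derivAtZero {E : Type*} [NormedAddCommGroup E] [InnerProductSpace ℂ E]
    (W : ℝ → E →L[ℂ] E) (l : Filter ℝ) [l.NeBot] : E →ₗ.[ℂ] E where
  domain :=
    { carrier := {x | ∃ y, Tendsto (fun t : ℝ => t⁻¹ • (W t x - x)) l (𝓝 y)}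
      zero_mem' := ⟨0, by simp⟩
      add_mem' := by
        rintro a b ⟨y, hy⟩ ⟨z, hz⟩
        refine ⟨y + z, (hy.add hz).congr fun t => ?_⟩
        rw [← smul_add, map_add]; congr 1; abel
      smul_mem' := by
        rintro c a ⟨y, hy⟩
        refine ⟨c • y, (hy.const_smul c).congr fun t => ?_⟩
        rw [map_smul, ← smul_sub, smul_comm] }
  toFun :=
    { toFun := fun x => limUnder l fun t : ℝ => t⁻¹ • (W t (x : E) - x)
      map_add' := by
        rintro ⟨a, y, hy⟩ ⟨b, z, hz⟩
        have h : Tendsto (fun t : ℝ => t⁻¹ • (W t (a + b) - (a + b))) l (𝓝 (y + z)) := by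
          refine (hy.add hz).congr fun t => ?_
          rw [← smul_add, map_add]; congr 1; abel
        simp only [Submodule.coe_add]
        rw [h.limUnder_eq, hy.limUnder_eq, hz.limUnder_eq]
      map_smul' := by
        rintro c ⟨a, y, hy⟩
        have h : Tendsto (fun t : ℝ => t⁻¹ • (W t (c • a) - c • a)) l (𝓝 (c • y)) := by
          refine (hy.const_smul c).congr fun t => ?_
          rw [map_smul, ← smul_sub, smul_comm]
        simp only [Submodule.coe_smul, RingHom.id_apply]
        rw [h.limUnder_eq, hy.limUnder_eq] }

theorem derivAtZero_tendsto {E : Type*} [NormedAddCommGroup E] [InnerProductSpace ℂ E]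
    (W : ℝ → E →L[ℂ] E) (l : Filter ℝ) [l.NeBot] (x : (derivAtZero W l).domain) :
    Tendsto (fun t : ℝ => t⁻¹ • (W t (x : E) - x)) l (𝓝 (derivAtZero W l x)) := by
  obtain ⟨x, y, hy⟩ := x
  exact tendsto_nhds_limUnder ⟨y, hy⟩

namespace C0ContractionSemigroup

variable {H : Type*} [NormedAddCommGroup H] [InnerProductSpace ℂ H]

/-- The infinitesimal generator `G` of the semigroup, `G x = lim_{t → 0+} (T t x - x) / t`. -/
def generator (T : C0ContractionSemigroup H) : H →ₗ.[ℂ] H :=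
  derivAtZero (fun t => T.op t.toNNReal) (𝓝[>] 0)

theorem norm_op_apply_le (T : C0ContractionSemigroup H) (t : ℝ≥0) (x : H) :
    ‖T.op t x‖ ≤ ‖x‖ := by
  simpa using (T.op t).le_of_opNorm_le (T.norm_op_le t) x

theorem continuous_laplace (T : C0ContractionSemigroup H) (x : H) :
    Continuous fun t : ℝ => Real.exp (-t) • T.op t.toNNReal x :=
  (Real.continuous_exp.comp continuous_neg).smul
    ((T.continuous_op x).comp continuous_real_toNNReal)

theorem integrable_laplace (T : C0ContractionSemigroup H) (x : H) :
    IntegrableOn (fun t : ℝ => Real.exp (-t) • T.op t.toNNReal x) (Ioi 0) := by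
  have h : IntegrableOn (fun t : ℝ => Real.exp (-t) * ‖x‖) (Ioi 0) :=
    (integrableOn_exp_neg_Ioi 0).mul_const _
  refine Integrable.mono' h (T.continuous_laplace x).aestronglyMeasurable ?_
  refine Eventually.of_forall fun t => ?_
  rw [norm_smul, Real.norm_eq_abs, abs_of_pos (Real.exp_pos _)]
  exact mul_le_mul_of_nonneg_left (T.norm_op_apply_le _ x) (Real.exp_pos _).le

/-- The resolvent `(1 - G)⁻¹` as the Laplace transform of the semigroup at `1`. -/
def laplace [CompleteSpace H] (T : C0ContractionSemigroup H) : H →L[ℂ] H :=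
  LinearMap.mkContinuous
    { toFun := fun x => ∫ t in Ioi (0 : ℝ), Real.exp (-t) • T.op t.toNNReal x
      map_add' := fun x y => by
        rw [← integral_add (T.integrable_laplace x) (T.integrable_laplace y)]
        simp only [map_add, smul_add]
      map_smul' := fun c x => by
        rw [RingHom.id_apply, ← integral_smul]
        congr 1; ext t
        rw [map_smul, smul_comm] }
    1 (fun x => by
      have h : IntegrableOn (fun t : ℝ => Real.exp (-t) * ‖x‖) (Ioi 0) :=
        (integrableOn_exp_neg_Ioi 0).mul_const _
      refine (norm_integral_le_of_norm_le h (Eventually.of_forall fun t => ?_)).trans ?_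
      · rw [norm_smul, Real.norm_eq_abs, abs_of_pos (Real.exp_pos _)]
        exact mul_le_mul_of_nonneg_left (T.norm_op_apply_le _ x) (Real.exp_pos _).le
      · rw [integral_mul_const, integral_exp_neg_Ioi_zero])

theorem laplace_apply [CompleteSpace H] (T : C0ContractionSemigroup H) (x : H) :
    T.laplace x = ∫ t in Ioi (0 : ℝ), Real.exp (-t) • T.op t.toNNReal x := rfl

theorem op_laplace [CompleteSpace H] (T : C0ContractionSemigroup H) (x : H) {h : ℝ} (hh : 0 < h) :
    T.op h.toNNReal (T.laplace x) =
      Real.exp h • (T.laplace x - ∫ t in (0 : ℝ)..h, Real.exp (-t) • T.op t.toNNReal x) := by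
  have e1 : T.laplace x - ∫ t in (0 : ℝ)..h, Real.exp (-t) • T.op t.toNNReal x
      = ∫ t in Ioi h, Real.exp (-t) • T.op t.toNNReal x := by
    rw [laplace_apply, sub_eq_iff_eq_add', intervalIntegral.integral_of_le hh.le,
      ← setIntegral_union (Set.Ioc_disjoint_Ioi le_rfl) measurableSet_Ioi
        ((T.integrable_laplace x).mono_set Ioc_subset_Ioi_self)
        ((T.integrable_laplace x).mono_set (Ioi_subset_Ioi hh.le)), Ioc_union_Ioi_eq_Ioi hh.le]
  have e2 : ∫ t in Ioi h, Real.exp (-t) • T.op t.toNNReal x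
      = ∫ t in Ioi (0 : ℝ), Real.exp (-(t + h)) • T.op (t + h).toNNReal x := by
    have := (measurePreserving_add_right volume h).setIntegral_preimage_emb
      (measurableEmbedding_addRight h) (fun t : ℝ => Real.exp (-t) • T.op t.toNNReal x) (Ioi h)
    rw [← this]
    simp
  rw [e1, e2, laplace_apply, ← ContinuousLinearMap.integral_comp_comm _ (T.integrable_laplace x),
    ← integral_smul]
  refine setIntegral_congr_fun measurableSet_Ioi fun t ht => ?_
  have ht' : (0 : ℝ) ≤ t := le_of_lt ht
  simp only [Real.toNNReal_add ht' hh.le, add_comm t.toNNReal, T.op_add, smul_smul,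
    mul_apply_eq_comp]
  rw [← Real.exp_add, show h + -(t + h) = -t by ring]
  exact LinearMap.map_smul_of_tower (T.op h.toNNReal).toLinearMap _ _

theorem tendsto_laplace [CompleteSpace H] (T : C0ContractionSemigroup H) (x : H) :
    Tendsto (fun t : ℝ => t⁻¹ • (T.op t.toNNReal (T.laplace x) - T.laplace x)) (𝓝[>] 0)
      (𝓝 (T.laplace x - x)) := by
  set F : ℝ → H := fun h => ∫ t in (0 : ℝ)..h, Real.exp (-t) • T.op t.toNNReal x with hF
  have hF' : HasDerivAt F x 0 := by
    have := intervalIntegral.integral_hasDerivAt_right (a := 0) (b := 0)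
      ((T.continuous_laplace x).intervalIntegrable 0 0)
      ((T.continuous_laplace x).stronglyMeasurableAtFilter _ _) (T.continuous_laplace x).continuousAt
    simpa [T.op_zero] using this
  have hF0 : F 0 = 0 := by simp [hF]
  have hg : HasDerivAt (fun h : ℝ => Real.exp h • (T.laplace x - F h)) (T.laplace x - x) 0 := by
    have := (Real.hasDerivAt_exp 0).smul (hF'.const_sub (T.laplace x))
    simp [hF0] at this
    rw [sub_eq_neg_add]; exact this
  have := (hasDerivAt_iff_tendsto_slope.1 hg).mono_left
    (nhdsWithin_mono 0 (fun t (ht : 0 < t) => ht.ne') : 𝓝[>] (0 : ℝ) ≤ 𝓝[≠] 0)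
  refine this.congr' ?_
  filter_upwards [self_mem_nhdsWithin] with t ht
  rw [T.op_laplace x ht, slope_def_module]
  simp [hF]

theorem laplace_mem_domain [CompleteSpace H] (T : C0ContractionSemigroup H) (x : H) :
    T.laplace x ∈ T.generator.domain := ⟨_, T.tendsto_laplace x⟩

theorem generator_laplace [CompleteSpace H] (T : C0ContractionSemigroup H) (x : H) :
    T.generator ⟨T.laplace x, T.laplace_mem_domain x⟩ = T.laplace x - x :=
  tendsto_nhds_unique (derivAtZero_tendsto _ _ _) (T.tendsto_laplace x)

theorem generator_eq_self (T : C0ContractionSemigroup H) (x : T.generator.domain)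
    (hx : T.generator x = x) : (x : H) = 0 := by
  have h1 := (derivAtZero_tendsto (fun t => T.op t.toNNReal) (𝓝[>] 0) x)
  have h2 : Tendsto (fun t : ℝ => RCLike.re ⟪(x : H), t⁻¹ • (T.op t.toNNReal x - x)⟫_ℂ) (𝓝[>] 0)
      (𝓝 (RCLike.re ⟪(x : H), T.generator x⟫_ℂ)) :=
    (RCLike.continuous_re.tendsto _).comp (tendsto_const_nhds.inner h1)
  have h3 : RCLike.re ⟪(x : H), T.generator x⟫_ℂ ≤ 0 := by
    refine le_of_tendsto h2 ?_
    filter_upwards [self_mem_nhdsWithin] with t ht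
    have ht' : (0 : ℝ) < t := ht
    have a : RCLike.re ⟪(x : H), T.op t.toNNReal x⟫_ℂ ≤ ‖(x : H)‖ ^ 2 := by
      refine (re_inner_le_norm _ _).trans ?_
      rw [sq]
      exact mul_le_mul_of_nonneg_left (T.norm_op_apply_le _ _) (norm_nonneg _)
    have b : RCLike.re ⟪(x : H), (x : H)⟫_ℂ = ‖(x : H)‖ ^ 2 := inner_self_eq_norm_sq (𝕜 := ℂ) _
    have c : RCLike.re ⟪(x : H), t⁻¹ • (T.op t.toNNReal x - x)⟫_ℂ
        = t⁻¹ * RCLike.re ⟪(x : H), T.op t.toNNReal x - x⟫_ℂ := by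
      rw [← Complex.coe_smul, inner_smul_right]
      exact Complex.re_ofReal_mul _ _
    rw [c, inner_sub_right, map_sub, b]
    exact mul_nonpos_of_nonneg_of_nonpos (inv_nonneg.2 ht'.le) (by linarith)
  rw [hx, inner_self_eq_norm_sq (𝕜 := ℂ)] at h3
  exact norm_eq_zero.1 (pow_eq_zero_iff two_ne_zero |>.1 (le_antisymm h3 (sq_nonneg _)))

theorem laplace_sub_generator [CompleteSpace H] (T : C0ContractionSemigroup H)
    (x : T.generator.domain) : T.laplace (x - T.generator x) = x := by
  set y : H := x - T.generator x with hy
  have h := T.generator_eq_self (⟨T.laplace y, T.laplace_mem_domain y⟩ - x) (by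
    rw [LinearPMap.map_sub, generator_laplace, hy, Submodule.coe_sub]; abel)
  exact sub_eq_zero.1 (by simpa using h)

/-- There is exactly one bounded operator `V` with `V (G - 1) x = (G + 1) x` on the domain of the
generator `G`; the operator `G - 1` maps this domain onto `H`. -/
theorem existsUnique_cogenerator [CompleteSpace H] (T : C0ContractionSemigroup H) :
    ∃! V : H →L[ℂ] H, ∀ x : T.generator.domain,
      V (T.generator x - x) = T.generator x + x := by
  refine ⟨1 - (2 : ℂ) • T.laplace, fun x => ?_, fun V hV => ?_⟩
  · have := T.laplace_sub_generator x
    have h : T.laplace (T.generator x - x) = -x := by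
      rw [← neg_sub, map_neg, this]
    change T.generator x - x - (2 : ℂ) • T.laplace (T.generator x - x) = _
    rw [h, two_smul]
    abel
  · ext y
    have := hV ⟨T.laplace y, T.laplace_mem_domain y⟩
    rw [generator_laplace] at this
    simp only [sub_sub_cancel_left, map_neg] at this
    rw [← neg_neg (V y), this]
    simp [two_smul]
    abel

/-- The cogenerator `(G + 1)(G - 1)⁻¹` of the semigroup with generator `G`. -/
def cogenerator [CompleteSpace H] (T : C0ContractionSemigroup H) : H →L[ℂ] H :=
  T.existsUnique_cogenerator.choose

theorem cogenerator_spec [CompleteSpace H] (T : C0ContractionSemigroup H)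
    (x : T.generator.domain) : T.cogenerator (T.generator x - x) = T.generator x + x :=
  T.existsUnique_cogenerator.choose_spec.1 x

theorem cogenerator_eq [CompleteSpace H] (T : C0ContractionSemigroup H) :
    T.cogenerator = 1 - (2 : ℂ) • T.laplace := by
  refine T.existsUnique_cogenerator.unique T.cogenerator_spec fun x => ?_
  have h : T.laplace (T.generator x - x) = -x := by
    rw [← neg_sub, map_neg, T.laplace_sub_generator x]
  change T.generator x - x - (2 : ℂ) • T.laplace (T.generator x - x) = _
  rw [h, two_smul]
  abel

/-! ### The unitary subspace and the two groups on it -/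

theorem norm_eq_iff_adjoint_apply [CompleteSpace H] {B : H →L[ℂ] H} (hB : ‖B‖ ≤ 1) (x : H) :
    ‖B x‖ = ‖x‖ ↔ (star B) (B x) = x := by
  constructor
  · intro h
    have h1 : ‖(star B) (B x)‖ ≤ ‖x‖ := by
      have := (star B).le_of_opNorm_le ((norm_star B).le.trans hB) (B x)
      rwa [one_mul, h] at this
    have h2 : RCLike.re ⟪(star B) (B x), x⟫_ℂ = ‖x‖ ^ 2 := by
      rw [ContinuousLinearMap.star_eq_adjoint, ContinuousLinearMap.adjoint_inner_left,
        inner_self_eq_norm_sq, h]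
    have h3 := norm_sub_sq (𝕜 := ℂ) ((star B) (B x)) x
    rw [h2] at h3
    have h4 : ‖(star B) (B x)‖ ^ 2 ≤ ‖x‖ ^ 2 := by gcongr
    have h5 : ‖(star B) (B x) - x‖ ^ 2 = 0 := le_antisymm (by linarith) (sq_nonneg _)
    exact sub_eq_zero.1 (norm_eq_zero.1 (pow_eq_zero_iff two_ne_zero |>.1 h5))
  · intro h
    have : ‖B x‖ ^ 2 = ‖x‖ ^ 2 := by
      rw [← inner_self_eq_norm_sq (𝕜 := ℂ) (B x), ← inner_self_eq_norm_sq (𝕜 := ℂ) x,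
        ← ContinuousLinearMap.adjoint_inner_left, ← ContinuousLinearMap.star_eq_adjoint, h]
    exact (sq_eq_sq₀ (norm_nonneg _) (norm_nonneg _)).1 this

/-- The unitary subspace of the semigroup: all `x` with `‖T t x‖ = ‖x‖ = ‖(T t)* x‖` for every
`t ≥ 0`. It is the largest reducing subspace on which every `T t` is unitary. -/
def unitarySubspace [CompleteSpace H] (T : C0ContractionSemigroup H) : Submodule ℂ H where
  carrier := {x | ∀ t, ‖T.op t x‖ = ‖x‖ ∧ ‖(star (T.op t)) x‖ = ‖x‖}
  zero_mem' := fun t => by simp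
  add_mem' := fun {a b} ha hb t => by
    have hs : ‖star (T.op t)‖ ≤ 1 := by rw [norm_star]; exact T.norm_op_le t
    constructor
    · rw [norm_eq_iff_adjoint_apply (T.norm_op_le t), map_add, map_add,
        (norm_eq_iff_adjoint_apply (T.norm_op_le t) a).1 (ha t).1,
        (norm_eq_iff_adjoint_apply (T.norm_op_le t) b).1 (hb t).1]
    · rw [norm_eq_iff_adjoint_apply hs, map_add, map_add,
        (norm_eq_iff_adjoint_apply hs a).1 (ha t).2, (norm_eq_iff_adjoint_apply hs b).1 (hb t).2]
  smul_mem' := fun c x hx t => by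
    simp only [map_smul, norm_smul, (hx t).1, (hx t).2, and_self]

theorem isClosed_unitarySubspace [CompleteSpace H] (T : C0ContractionSemigroup H) :
    IsClosed (T.unitarySubspace : Set H) := by
  have : (T.unitarySubspace : Set H)
      = ⋂ t, {x | ‖T.op t x‖ = ‖x‖ ∧ ‖(star (T.op t)) x‖ = ‖x‖} := by
    ext x; simp [unitarySubspace]
  rw [this]
  refine isClosed_iInter fun t => ?_
  exact (isClosed_eq (by fun_prop) (by fun_prop)).inter (isClosed_eq (by fun_prop) (by fun_prop))

instance [CompleteSpace H] (T : C0ContractionSemigroup H) : CompleteSpace T.unitarySubspace :=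
  T.isClosed_unitarySubspace.completeSpace_coe

theorem op_mem_unitarySubspace [CompleteSpace H] (T : C0ContractionSemigroup H) (s : ℝ≥0) {x : H}
    (hx : x ∈ T.unitarySubspace) : T.op s x ∈ T.unitarySubspace := by
  intro t
  have hn : ∀ r, ‖T.op r x‖ = ‖x‖ := fun r => (hx r).1
  have hl : ∀ r, (star (T.op r)) (T.op r x) = x := fun r =>
    (norm_eq_iff_adjoint_apply (T.norm_op_le r) x).1 (hn r)
  constructor
  · rw [← mul_apply_eq_comp, ← T.op_add, hn, hn]
  · rw [hn]
    rcases le_total t s with h | h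
    · obtain ⟨r, rfl⟩ := exists_add_of_le h
      have e : T.op (t + r) x = T.op t (T.op r x) := by rw [T.op_add]; rfl
      have : (star (T.op t)) (T.op t (T.op r x)) = T.op r x := by
        refine (norm_eq_iff_adjoint_apply (T.norm_op_le t) _).1 ?_
        rw [← e, hn, hn]
      rw [e, this, hn]
    · obtain ⟨r, rfl⟩ := exists_add_of_le h
      have e : star (T.op (s + r)) = star (T.op r) * star (T.op s) := by rw [T.op_add, star_mul]
      rw [e, mul_apply_eq_comp, hl, (hx r).2]

theorem cogenerator_mem_unitarySubspace [CompleteSpace H] (T : C0ContractionSemigroup H) {x : H}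
    (hx : x ∈ T.unitarySubspace) : T.cogenerator x ∈ T.unitarySubspace := by
  have h : T.laplace x ∈ T.unitarySubspace := by
    rw [← Submodule.orthogonal_orthogonal T.unitarySubspace]
    intro z hz
    rw [laplace_apply, ← integral_inner (T.integrable_laplace x)]
    refine integral_eq_zero_of_ae (Eventually.of_forall fun t => ?_)
    have := (Submodule.mem_orthogonal' _ z).1 hz _ (T.op_mem_unitarySubspace t.toNNReal hx)
    simp only [Pi.zero_apply]
    rw [← Complex.coe_smul, inner_smul_right, this, mul_zero]
  rw [cogenerator_eq]
  exact Submodule.sub_mem _ hx (Submodule.smul_mem _ _ h)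

/-- The restriction of `T t` to the unitary subspace. -/
def unitaryPart [CompleteSpace H] (T : C0ContractionSemigroup H) (t : ℝ≥0) :
    T.unitarySubspace →L[ℂ] T.unitarySubspace :=
  (T.op t ∘L T.unitarySubspace.subtypeL).codRestrict T.unitarySubspace
    fun x => T.op_mem_unitarySubspace t x.2

/-- The unitary group on the unitary subspace: `U t = T t` for `t ≥ 0` and `U (-t) = (T t)*`. -/
def unitaryGroup [CompleteSpace H] (T : C0ContractionSemigroup H) (t : ℝ) :
    T.unitarySubspace →L[ℂ] T.unitarySubspace :=
  if 0 ≤ t then T.unitaryPart t.toNNReal else star (T.unitaryPart (-t).toNNReal)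

/-- The operator `A` with `U t = exp (i t A)`, that is
`A x = -i lim_{t → 0} (U t x - x) / t` with its natural domain. -/
def selfAdjointGenerator [CompleteSpace H] (T : C0ContractionSemigroup H) :
    T.unitarySubspace →ₗ.[ℂ] T.unitarySubspace :=
  (-Complex.I) • derivAtZero T.unitaryGroup (𝓝[≠] 0)

/-- The restriction `U` of the cogenerator to the unitary subspace. -/
def unitaryCogenerator [CompleteSpace H] (T : C0ContractionSemigroup H) :
    T.unitarySubspace →L[ℂ] T.unitarySubspace :=
  (T.cogenerator ∘L T.unitarySubspace.subtypeL).codRestrict T.unitarySubspace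
    fun x => T.cogenerator_mem_unitarySubspace x.2

/-- The group of integer powers of `U`, with `U ^ (-n) = (U*) ^ n`. -/
def cogeneratorGroup [CompleteSpace H] (T : C0ContractionSemigroup H) :
    ℤ → (T.unitarySubspace →L[ℂ] T.unitarySubspace)
  | Int.ofNat n => T.unitaryCogenerator ^ n
  | Int.negSucc n => star T.unitaryCogenerator ^ (n + 1)

/-- The orthogonal projection onto the unitary subspace, as an operator on that subspace. -/
def unitaryProjection [CompleteSpace H] (T : C0ContractionSemigroup H) :
    T.unitarySubspace →L[ℂ] T.unitarySubspace :=
  T.unitarySubspace.orthogonalProjectionOnto ∘L T.unitarySubspace.subtypeL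

end C0ContractionSemigroup

/-! ### Spectral families -/

/-- A spectral family (resolution of the identity) on `K`: a nondecreasing, strongly
right-continuous family of orthogonal projections, tending strongly to `0` at `-∞` and to the
identity at `+∞`. -/
structure SpectralFamily (K : Type*) [NormedAddCommGroup K] [InnerProductSpace ℂ K]
    [CompleteSpace K] where
  proj : ℝ → K →L[ℂ] K
  isStarProjection : ∀ a, IsStarProjection (proj a)
  mono : ∀ a b, a ≤ b → proj a * proj b = proj a
  right_continuous : ∀ a x, Tendsto (fun b => proj b x) (𝓝[>] a) (𝓝 (proj a x))
  tendsto_atBot : ∀ x, Tendsto (fun b => proj b x) atBot (𝓝 0)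
  tendsto_atTop : ∀ x, Tendsto (fun b => proj b x) atTop (𝓝 x)

namespace SpectralFamily

variable {K : Type*} [NormedAddCommGroup K] [InnerProductSpace ℂ K] [CompleteSpace K]

/-- The distribution function `a ↦ ‖E a x‖² = ⟪E a x, x⟫`. -/
def distribution (E : SpectralFamily K) (x : K) : StieltjesFunction ℝ where
  toFun a := ‖E.proj a x‖ ^ 2
  mono' := fun a b hab => by
    have h : ‖E.proj a x‖ ≤ ‖E.proj b x‖ := by
      rw [← E.mono a b hab, mul_apply_eq_comp]
      simpa using (E.proj a).le_of_opNorm_le (E.isStarProjection a).norm_le (E.proj b x)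
    exact pow_le_pow_left₀ (norm_nonneg _) h 2
  right_continuous' := fun a =>
    continuousWithinAt_Ioi_iff_Ici.1 ((E.right_continuous a x).norm.pow 2)

/-- The Borel measure `d⟪E x, x⟫` on the line. -/
def measure (E : SpectralFamily K) (x : K) : Measure ℝ := (E.distribution x).measure

/-- `B = ∫ u dE`, for a bounded function `u`: the equality `⟪x, B x⟫ = ∫ u d⟪E x, x⟫` for every
`x`, which determines `B` by polarization. -/
def IsOperatorIntegral (E : SpectralFamily K) (u : ℝ → ℂ) (B : K →L[ℂ] K) : Prop :=
  ∀ x, ⟪x, B x⟫_ℂ = ∫ a, u a ∂(E.measure x)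

/-- `u` is essentially bounded almost everywhere with respect to the spectral family. -/
def EssBounded (E : SpectralFamily K) (u : ℝ → ℂ) : Prop :=
  ∃ c : ℝ, ∀ x, ∀ᵐ a ∂(E.measure x), ‖u a‖ ≤ c

/-- `E` is the spectral family of the (unbounded) self-adjoint operator `A`, `A = ∫ a dE`: the
domain of `A` consists of the `x` with `∫ a² d⟪E x, x⟫ < ∞`, and `⟪x, A x⟫ = ∫ a d⟪E x, x⟫` there. -/
def IsSpectralFamilyOfSelfAdjoint (E : SpectralFamily K) (A : K →ₗ.[ℂ] K) : Prop :=
  (∀ x, x ∈ A.domain ↔ Integrable (fun a : ℝ => a ^ 2) (E.measure x)) ∧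
    ∀ x : A.domain, ⟪(x : K), A x⟫_ℂ = ((∫ a, a ∂(E.measure x) : ℝ) : ℂ)

/-- The point of the unit circle with parameter `θ`. -/
def circlePoint (θ : ℝ) : ℂ := Complex.exp (2 * Real.pi * Complex.I * θ)

/-- `F` is the spectral family `{F θ : 0 ≤ θ < 1}` of the unitary operator `U`,
`U = ∫ exp (2πiθ) dF`. The family is carried by `[0, 1)`: it vanishes for `θ < 0` and tends
strongly to the identity as `θ` increases to `1`. -/
def IsSpectralFamilyOfUnitary (F : SpectralFamily K) (U : K →L[ℂ] K) : Prop :=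
  (∀ θ < 0, F.proj θ = 0) ∧ (∀ x, Tendsto (fun θ => F.proj θ x) (𝓝[<] 1) (𝓝 x)) ∧
    F.IsOperatorIntegral circlePoint U

/-- The functional calculus `{∫ u dE : u Borel, E-essentially bounded}`. -/
def lineCalculus (E : SpectralFamily K) : Set (K →L[ℂ] K) :=
  {B | ∃ u : ℝ → ℂ, Measurable u ∧ E.EssBounded u ∧ E.IsOperatorIntegral u B}

/-- The functional calculus `{∫ w (exp (2πiθ)) dF : w Borel, F-essentially bounded}`. -/
def circleCalculus (F : SpectralFamily K) : Set (K →L[ℂ] K) :=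
  {B | ∃ w : ℂ → ℂ, Measurable w ∧ F.EssBounded (fun θ => w (circlePoint θ)) ∧
    F.IsOperatorIntegral (fun θ => w (circlePoint θ)) B}

end SpectralFamily

/-! ### Operator topologies and `W*`-subalgebras -/

section Algebras

variable {K : Type*} [NormedAddCommGroup K] [InnerProductSpace ℂ K]

/-- Closedness in the weak operator topology. -/
def IsWeaklyClosed (S : Set (K →L[ℂ] K)) : Prop :=
  IsClosed ((fun B : K →WOT[ℂ] K => ContinuousLinearMapWOT.equiv B) ⁻¹' S)

/-- Closure in the strong operator topology, the topology of pointwise convergence. -/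
def strongClosure (S : Set (K →L[ℂ] K)) : Set (K →L[ℂ] K) :=
  let e : (K →L[ℂ] K) ≃ (K →Lₚₜ[ℂ] K) := UniformConvergenceCLM.ofFun (RingHom.id ℂ) K _
  {B | e B ∈ closure (e '' S)}

/-- The least `*`-closed, weakly closed subalgebra (not assumed to contain the identity)
containing `S`. -/
def generatedAlgebra [CompleteSpace K] (S : Set (K →L[ℂ] K)) :
    NonUnitalStarSubalgebra ℂ (K →L[ℂ] K) :=
  sInf {M | S ⊆ M ∧ IsWeaklyClosed (M : Set (K →L[ℂ] K))}

/-- `M` is a `W*`-subalgebra of the bounded operators on `K` with unit `P`: a weakly closed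
`*`-subalgebra that contains `P`, for which `P` is a two-sided identity. -/
def IsWStarSubalgebraWithUnit [CompleteSpace K] (M : NonUnitalStarSubalgebra ℂ (K →L[ℂ] K))
    (P : K →L[ℂ] K) : Prop :=
  IsWeaklyClosed (M : Set (K →L[ℂ] K)) ∧ P ∈ M ∧ ∀ B ∈ M, P * B = B ∧ B * P = B

end Algebras

end

noncomputable section

/-! ### Weak limits of operators -/

section WeakLimits

variable {K : Type*} [NormedAddCommGroup K] [InnerProductSpace ℂ K]

/-! Everything passes through one bounded operator. On the unitary subspace let `R = (1 - G)⁻¹`, the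
Laplace transform of the group at `1`. The restricted cogenerator is `U = 1 - 2R`, the Cayley
transform of `G = iA`, and the scalar function behind it is `cayleyFun a = (a - i)/(a + i) = exp(2πi
θ(a))`. A spectral family `E` belongs to `A` exactly when `∫ cayleyFun dE = U`
(`isSpectralFamilyOfSelfAdjoint_iff`). The image of such an `E` under `θ` is then a spectral family
of `U` on `[0, 1)` (`toCircle`), which is the asserted reparametrization.

Uniqueness is proved on the circle: two families of the same `U` give the same integrals of
polynomials in `z` and `z̄`, hence the same measures; it passes to the line because `toCircle` is
injective. For existence, the continuous functional calculus of `U` and the Riesz-Markov theorem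
give measures on the spectrum, and projections of closed sets arise as weak limits. Since `R` is
injective, `1` is not an eigenvalue of `U`, so the point `1` is null and the inverse Cayley map
carries the measures to the line (`SpectralFamily.exists_of_unitary`).

As to the algebras, the density theorem shows that each of the six sets is a bicommutant. The
generating sets have the same commutant: `D` commutes with every `U t` iff it commutes with `U`
(`commute_cayley_iff`), iff it commutes with every projection of `E` (`commute_proj_iff`). The
density theorem requires the identity, which the algebras are not assumed to contain: it is `U 0`,
the zeroth power of `U`, or a strong limit of the projections. -/

theorem inner_map_right_polarization (B : K →L[ℂ] K) (x y : K) :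
    ⟪x, B y⟫_ℂ = (⟪x + y, B (x + y)⟫_ℂ - ⟪x - y, B (x - y)⟫_ℂ
      - Complex.I * ⟪x + Complex.I • y, B (x + Complex.I • y)⟫_ℂ
      + Complex.I * ⟪x - Complex.I • y, B (x - Complex.I • y)⟫_ℂ) / 4 := by
  simp only [map_add, map_sub, inner_add_left, inner_add_right, map_smul, inner_smul_left,
    inner_smul_right, Complex.conj_I, inner_sub_left, inner_sub_right]
  ring_nf
  simp only [Complex.I_sq]
  ring

theorem ContinuousLinearMap.ext_inner_self {B C : K →L[ℂ] K} (h : ∀ x, ⟪x, B x⟫_ℂ = ⟪x, C x⟫_ℂ) :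
    B = C := by
  ext y
  refine ext_inner_left ℂ fun x => ?_
  rw [inner_map_right_polarization, h, h, h, h, ← inner_map_right_polarization]

/-- The numerical radius controls the norm up to a factor of two: polarization writes `⟪x, B y⟫` as
four quadratic terms, and the parallelogram law adds up their bounds. -/
theorem ContinuousLinearMap.norm_le_of_norm_inner_self_le {B : K →L[ℂ] K} {M : ℝ} (hM : 0 ≤ M)
    (h : ∀ x, ‖⟪x, B x⟫_ℂ‖ ≤ M * ‖x‖ ^ 2) : ‖B‖ ≤ 2 * M := by
  have key : ∀ x y, ‖⟪x, B y⟫_ℂ‖ ≤ M * (‖x‖ ^ 2 + ‖y‖ ^ 2) := by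
    intro x y
    have p1 := parallelogram_law_with_norm ℂ x y
    have p2 := parallelogram_law_with_norm ℂ x (Complex.I • y)
    rw [norm_smul, Complex.norm_I, one_mul] at p2
    rw [inner_map_right_polarization, norm_div, Complex.norm_ofNat, div_le_iff₀ (by norm_num)]
    refine (norm_add_le _ _).trans ?_
    refine (add_le_add_left (norm_sub_le _ _) _).trans ?_
    refine (add_le_add_left (add_le_add_left (norm_sub_le _ _) _) _).trans ?_
    rw [norm_mul, norm_mul, Complex.norm_I, one_mul, one_mul]
    have h1 := h (x + y)
    have h2 := h (x - y)
    have h3 := h (x + Complex.I • y)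
    have h4 := h (x - Complex.I • y)
    have : M * ‖x + y‖ ^ 2 + M * ‖x - y‖ ^ 2 + M * ‖x + Complex.I • y‖ ^ 2
        + M * ‖x - Complex.I • y‖ ^ 2 = M * (‖x‖ ^ 2 + ‖y‖ ^ 2) * 4 := by
      linear_combination M * p1 + M * p2
    linarith
  refine B.opNorm_le_bound (by positivity) fun y => ?_
  by_cases hB : B y = 0
  · rw [hB, norm_zero]; positivity
  have hB' : 0 < ‖B y‖ := norm_pos_iff.2 hB
  have hy : 0 < ‖y‖ := norm_pos_iff.2 fun h0 => hB (by rw [h0, map_zero])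
  -- `B y` is rescaled to the length of `y`, so that both squares in `key` equal `‖y‖²`.
  have hk := key (((‖y‖ / ‖B y‖ : ℝ) : ℂ) • B y) y
  rw [inner_smul_left, inner_self_eq_norm_sq_to_K, norm_smul, Complex.conj_ofReal] at hk
  simp only [norm_mul, Complex.norm_real, norm_div, norm_norm, norm_pow,
    Complex.coe_algebraMap] at hk
  have e1 : ‖y‖ / ‖B y‖ * ‖B y‖ ^ 2 = ‖y‖ * ‖B y‖ := by field_simp
  have e2 : ‖y‖ / ‖B y‖ * ‖B y‖ = ‖y‖ := by field_simp
  rw [e1, e2] at hk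
  have : ‖y‖ * ‖B y‖ ≤ ‖y‖ * (2 * M * ‖y‖) := by linarith
  exact le_of_mul_le_mul_left this hy

theorem tendsto_inner_of_tendsto_inner_self {ι : Type*} {l : Filter ι} {B : ι → K →L[ℂ] K}
    {C : K →L[ℂ] K} (h : ∀ x, Tendsto (fun i => ⟪x, B i x⟫_ℂ) l (𝓝 ⟪x, C x⟫_ℂ)) (x y : K) :
    Tendsto (fun i => ⟪x, B i y⟫_ℂ) l (𝓝 ⟪x, C y⟫_ℂ) := by
  simp only [inner_map_right_polarization _ x y]
  exact ((((h _).sub (h _)).sub ((h _).const_mul _)).add ((h _).const_mul _)).div_const _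

/-- A sequence of operators whose quadratic forms are uniformly bounded and converge pointwise has
a weak limit. -/
theorem exists_weak_limit [CompleteSpace K] {B : ℕ → K →L[ℂ] K} {M : ℝ} (hM : 0 ≤ M)
    (hB : ∀ n x, ‖⟪x, B n x⟫_ℂ‖ ≤ M * ‖x‖ ^ 2) {q : K → ℂ}
    (hq : ∀ x, Tendsto (fun n => ⟪x, B n x⟫_ℂ) atTop (𝓝 (q x))) :
    ∃ C : K →L[ℂ] K, ∀ x, ⟪x, C x⟫_ℂ = q x := by
  have hconv : ∀ x y, ∃ z, Tendsto (fun n => ⟪x, B n y⟫_ℂ) atTop (𝓝 z) := by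
    intro x y
    simp only [inner_map_right_polarization _ x y]
    exact ⟨_, ((((hq _).sub (hq _)).sub ((hq _).const_mul _)).add ((hq _).const_mul _)).div_const _⟩
  choose L hL using hconv
  have hbound : ∀ x y, ‖L x y‖ ≤ 2 * M * ‖x‖ * ‖y‖ := by
    intro x y
    refine le_of_tendsto (hL x y).norm (Eventually.of_forall fun n => ?_)
    refine (norm_inner_le_norm _ _).trans ?_
    have h1 := (B n).le_of_opNorm_le
      (ContinuousLinearMap.norm_le_of_norm_inner_self_le hM (hB n)) y
    nlinarith [norm_nonneg x]
  -- The limit form inherits sesquilinearity by uniqueness of limits; the uniform norm bound makes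
  -- it continuous, so it is represented by an operator.
  let L₀ : K →ₗ⋆[ℂ] K →ₗ[ℂ] ℂ := LinearMap.mk₂'ₛₗ (starRingEnd ℂ) (RingHom.id ℂ) L
    (fun x x' y => tendsto_nhds_unique (hL _ _) (by
      simpa only [inner_add_left] using (hL x y).add (hL x' y)))
    (fun c x y => tendsto_nhds_unique (hL _ _) (by
      simpa only [inner_smul_left, smul_eq_mul] using (hL x y).const_mul _))
    (fun x y y' => tendsto_nhds_unique (hL _ _) (by
      simpa only [map_add, inner_add_right] using (hL x y).add (hL x y')))
    (fun c x y => tendsto_nhds_unique (hL _ _) (by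
      simpa only [map_smul, inner_smul_right, smul_eq_mul, RingHom.id_apply]
        using (hL x y).const_mul _))
  let S := InnerProductSpace.continuousLinearMapOfBilin (L₀.mkContinuous₂ (2 * M) hbound)
  refine ⟨ContinuousLinearMap.adjoint S, fun x => ?_⟩
  rw [ContinuousLinearMap.adjoint_inner_right,
    InnerProductSpace.continuousLinearMapOfBilin_apply]
  exact tendsto_nhds_unique (hL x x) (hq x)

end WeakLimits

/-! ### Bounded Borel functions -/

/-- A bounded Borel function on the line. -/
structure IsBoundedBorel (u : ℝ → ℂ) : Prop where
  measurable : Measurable u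
  bounded : ∃ C, ∀ a, ‖u a‖ ≤ C

namespace IsBoundedBorel

variable {u v : ℝ → ℂ}

theorem add (hu : IsBoundedBorel u) (hv : IsBoundedBorel v) : IsBoundedBorel (u + v) := by
  obtain ⟨C, hC⟩ := hu.bounded
  obtain ⟨D, hD⟩ := hv.bounded
  exact ⟨hu.measurable.add hv.measurable, C + D, fun a =>
    (norm_add_le _ _).trans (add_le_add (hC a) (hD a))⟩

theorem mul (hu : IsBoundedBorel u) (hv : IsBoundedBorel v) : IsBoundedBorel (u * v) := by
  obtain ⟨C, hC⟩ := hu.bounded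
  obtain ⟨D, hD⟩ := hv.bounded
  refine ⟨hu.measurable.mul hv.measurable, C * D, fun a => ?_⟩
  rw [Pi.mul_apply, norm_mul]
  exact mul_le_mul (hC a) (hD a) (norm_nonneg _) ((norm_nonneg _).trans (hC a))

theorem const (c : ℂ) : IsBoundedBorel fun _ => c := ⟨measurable_const, ‖c‖, fun _ => le_rfl⟩

theorem one : IsBoundedBorel 1 := const 1

theorem smul (c : ℂ) (hu : IsBoundedBorel u) : IsBoundedBorel (c • u) := (const c).mul hu

theorem star (hu : IsBoundedBorel u) : IsBoundedBorel (star u) := by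
  obtain ⟨C, hC⟩ := hu.bounded
  exact ⟨(Complex.continuous_conj.measurable.comp hu.measurable :), C, fun a => by simpa using hC a⟩

theorem indicator (hu : IsBoundedBorel u) {s : Set ℝ} (hs : MeasurableSet s) :
    IsBoundedBorel (s.indicator u) := by
  obtain ⟨C, hC⟩ := hu.bounded
  exact ⟨hu.measurable.indicator hs, C, fun a => (norm_indicator_le_norm_self _ _).trans (hC a)⟩

theorem indicator_one {s : Set ℝ} (hs : MeasurableSet s) :
    IsBoundedBorel (s.indicator (1 : ℝ → ℂ)) := one.indicator hs

theorem integrable (hu : IsBoundedBorel u) (m : Measure ℝ) [IsFiniteMeasure m] :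
    Integrable u m := by
  obtain ⟨C, hC⟩ := hu.bounded
  exact .of_bound hu.measurable.aestronglyMeasurable C (.of_forall hC)

/-- A property of bounded Borel functions that holds for the indicators of half-lines and is stable
under linear combinations and bounded pointwise limits of sequences holds for all of them. -/
theorem induction {P : (ℝ → ℂ) → Prop} (ind : ∀ a, P ((Iic a).indicator 1))
    (add : ∀ u v, IsBoundedBorel u → IsBoundedBorel v → P u → P v → P (u + v))
    (smul : ∀ (c : ℂ) u, IsBoundedBorel u → P u → P (c • u))
    (lim : ∀ (w : ℕ → ℝ → ℂ) (u : ℝ → ℂ) (C : ℝ), 0 ≤ C → (∀ n, IsBoundedBorel (w n)) →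
      IsBoundedBorel u → (∀ n a, ‖w n a‖ ≤ C) →
      (∀ a, Tendsto (fun n => w n a) atTop (𝓝 (u a))) → (∀ n, P (w n)) → P u)
    {u : ℝ → ℂ} (hu : IsBoundedBorel u) : P u := by
  have le_one : ∀ (s : Set ℝ) a, ‖s.indicator (1 : ℝ → ℂ) a‖ ≤ 1 := fun s a =>
    (norm_indicator_le_norm_self _ _).trans (by simp)
  have zero : P 0 := by simpa using smul 0 _ (indicator_one measurableSet_Iic) (ind 0)
  have huniv : P 1 := by
    refine lim (fun n => (Iic (n : ℝ)).indicator 1) 1 1 zero_le_one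
      (fun n => indicator_one measurableSet_Iic) (const 1) (fun n a => le_one _ a) (fun a => ?_)
      fun n => ind _
    refine tendsto_const_nhds.congr' ?_
    filter_upwards [eventually_ge_atTop ⌈a⌉₊] with n hn
    rw [indicator_of_mem (show a ∈ Iic (n : ℝ) from (Nat.le_ceil a).trans (by exact_mod_cast hn))]
  -- Dynkin's π-λ theorem: half-lines form a π-system generating the Borel sets, complements use `P
  -- 1`, and disjoint unions are bounded limits of partial sums.
  have set : ∀ s : Set ℝ, MeasurableSet s → P (s.indicator 1) := by
    refine MeasurableSpace.induction_on_inter (borel_eq_generateFrom_Iic ℝ ▸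
      BorelSpace.measurable_eq) isPiSystem_Iic (by rw [indicator_empty]; exact zero) ?_ ?_ ?_
    · rintro _ ⟨a, rfl⟩; exact ind a
    · intro s hs h
      have e : sᶜ.indicator (1 : ℝ → ℂ) = 1 + (-1 : ℂ) • s.indicator 1 := by
        rw [Set.indicator_compl]; simp [sub_eq_add_neg]
      rw [e]
      exact add _ _ (const 1) ((indicator_one hs).smul _) huniv (smul _ _ (indicator_one hs) h)
    · intro f hd hm h
      have hsum : ∀ n, IsBoundedBorel (∑ i ∈ Finset.range n, (f i).indicator (1 : ℝ → ℂ)) ∧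
          P (∑ i ∈ Finset.range n, (f i).indicator (1 : ℝ → ℂ)) := by
        intro n
        induction n with
        | zero => rw [Finset.range_zero, Finset.sum_empty]; exact ⟨const 0, zero⟩
        | succ n ih =>
          rw [Finset.sum_range_succ]
          exact ⟨ih.1.add (indicator_one (hm n)), add _ _ ih.1 (indicator_one (hm n)) ih.2 (h n)⟩
      have hfin : ∀ n, ∑ i ∈ Finset.range n, (f i).indicator (1 : ℝ → ℂ)
          = (⋃ i ∈ Finset.range n, f i).indicator 1 := fun n => by
        ext a
        rw [Finset.indicator_biUnion (Finset.range n) f (fun i _ j _ hij => hd hij),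
          Finset.sum_apply]
      refine lim _ _ 1 zero_le_one (fun n => (hsum n).1) (indicator_one (.iUnion hm))
        (fun n a => ?_)
        (fun a => ?_) fun n => (hsum n).2
      · rw [hfin]; exact le_one _ _
      · simp only [hfin]
        by_cases ha : a ∈ ⋃ i, f i
        · obtain ⟨i, hi⟩ := mem_iUnion.1 ha
          rw [indicator_of_mem ha]
          refine tendsto_const_nhds.congr' ?_
          filter_upwards [eventually_gt_atTop i] with n hn
          rw [indicator_of_mem (mem_iUnion₂.2 ⟨i, Finset.mem_range.2 hn, hi⟩ :
            a ∈ ⋃ i ∈ Finset.range n, f i)]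
        · rw [indicator_of_notMem ha]
          refine tendsto_const_nhds.congr fun n => ?_
          rw [indicator_of_notMem fun hh => ha ?_]
          obtain ⟨i, -, hi⟩ := mem_iUnion₂.1 hh
          exact mem_iUnion.2 ⟨i, hi⟩
  have simple : ∀ g : SimpleFunc ℝ ℂ, IsBoundedBorel g ∧ P g := by
    intro g
    induction g using SimpleFunc.induction with
    | const c hs =>
      rename_i s
      have e : (SimpleFunc.piecewise s hs (SimpleFunc.const ℝ c) (SimpleFunc.const ℝ 0) : ℝ → ℂ)
          = c • s.indicator (1 : ℝ → ℂ) := by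
        ext a
        by_cases ha : a ∈ s <;> simp [ha]
      rw [e]
      exact ⟨(indicator_one hs).smul c, smul c _ (indicator_one hs) (set s hs)⟩
    | add hd hf hg => exact ⟨hf.1.add hg.1, add _ _ hf.1 hg.1 hf.2 hg.2⟩
  obtain ⟨C, hC⟩ := hu.bounded
  have hC0 : 0 ≤ C := (norm_nonneg _).trans (hC 0)
  -- The simple approximations are bounded by `2‖u a‖` only, whence the constant `C + C`.
  refine lim (fun n => SimpleFunc.approxOn u hu.measurable univ 0 (mem_univ 0) n) u (C + C)
    (by positivity) (fun n => (simple _).1) hu (fun n a => ?_) (fun a => ?_) fun n => (simple _).2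
  · exact (SimpleFunc.norm_approxOn_zero_le hu.measurable (mem_univ 0) a n).trans
      (add_le_add (hC a) (hC a))
  · exact SimpleFunc.tendsto_approxOn hu.measurable (mem_univ 0) (by simp)

end IsBoundedBorel

/-! ### Orthogonal projections. -/

section StarProjection

variable {K : Type*} [NormedAddCommGroup K] [InnerProductSpace ℂ K] [CompleteSpace K]

theorem IsStarProjection.inner_self_eq {P : K →L[ℂ] K} (hP : IsStarProjection P) (x : K) :
    ⟪x, P x⟫_ℂ = ((‖P x‖ ^ 2 : ℝ) : ℂ) := by
  have h1 : P (P x) = P x := by rw [← mul_apply_eq_comp, hP.isIdempotentElem.eq]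
  have h2 : ContinuousLinearMap.adjoint P = P := hP.isSelfAdjoint.star_eq
  conv_lhs => rw [← h1]
  rw [← ContinuousLinearMap.adjoint_inner_left, h2, inner_self_eq_norm_sq_to_K]
  push_cast; rfl

/-- Pythagoras for nested projections. It upgrades convergence of the norms `‖P a x‖` to strong
convergence in `ofMeasure`. -/
theorem IsStarProjection.norm_sub_sq {P Q : K →L[ℂ] K} (hP : IsStarProjection P)
    (hQ : IsStarProjection Q) (hPQ : P * Q = P) (x : K) :
    ‖Q x - P x‖ ^ 2 = ‖Q x‖ ^ 2 - ‖P x‖ ^ 2 := by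
  have h : ⟪Q x, P x⟫_ℂ = ((‖P x‖ ^ 2 : ℝ) : ℂ) := by
    have e : ContinuousLinearMap.adjoint Q = Q := hQ.isSelfAdjoint.star_eq
    have e2 : Q * P = P := by
      rw [← hP.isSelfAdjoint.star_eq, ← hQ.isSelfAdjoint.star_eq, ← star_mul, hPQ]
    rw [← e, ContinuousLinearMap.adjoint_inner_left, ← mul_apply_eq_comp, e2, hP.inner_self_eq]
  rw [_root_.norm_sub_sq (𝕜 := ℂ), h, RCLike.re_eq_complex_re, Complex.ofReal_re]
  ring

end StarProjection

namespace SpectralFamily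

variable {K : Type*} [NormedAddCommGroup K] [InnerProductSpace ℂ K] [CompleteSpace K]

/-! ### The measures of a spectral family -/

theorem inner_proj_self (E : SpectralFamily K) (a : ℝ) (x : K) :
    ⟪x, E.proj a x⟫_ℂ = ((‖E.proj a x‖ ^ 2 : ℝ) : ℂ) := (E.isStarProjection a).inner_self_eq x

theorem distribution_tendsto_atBot (E : SpectralFamily K) (x : K) :
    Tendsto (E.distribution x) atBot (𝓝 0) := by
  have := (E.tendsto_atBot x).norm.pow 2
  rwa [norm_zero, zero_pow two_ne_zero] at this

theorem distribution_tendsto_atTop (E : SpectralFamily K) (x : K) :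
    Tendsto (E.distribution x) atTop (𝓝 (‖x‖ ^ 2)) := (E.tendsto_atTop x).norm.pow 2

theorem measure_Iic (E : SpectralFamily K) (x : K) (a : ℝ) :
    E.measure x (Iic a) = ENNReal.ofReal (‖E.proj a x‖ ^ 2) := by
  rw [measure, StieltjesFunction.measure_Iic _ (E.distribution_tendsto_atBot x), sub_zero]
  rfl

theorem measure_univ (E : SpectralFamily K) (x : K) :
    E.measure x univ = ENNReal.ofReal (‖x‖ ^ 2) := by
  rw [measure, StieltjesFunction.measure_univ _ (E.distribution_tendsto_atBot x)
    (E.distribution_tendsto_atTop x), sub_zero]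

instance (E : SpectralFamily K) (x : K) : IsFiniteMeasure (E.measure x) :=
  ⟨by rw [measure_univ]; exact ENNReal.ofReal_lt_top⟩

theorem measureReal_univ (E : SpectralFamily K) (x : K) : (E.measure x).real univ = ‖x‖ ^ 2 := by
  rw [measureReal_def, measure_univ, ENNReal.toReal_ofReal (sq_nonneg _)]

theorem measureReal_Iic (E : SpectralFamily K) (x : K) (a : ℝ) :
    (E.measure x).real (Iic a) = ‖E.proj a x‖ ^ 2 := by
  rw [measureReal_def, measure_Iic, ENNReal.toReal_ofReal (sq_nonneg _)]

/-- A finite measure with the right distribution function is the measure of the spectral family. -/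
theorem measure_eq (E : SpectralFamily K) (x : K) {m : Measure ℝ} [IsFiniteMeasure m]
    (h : ∀ a, m.real (Iic a) = ‖E.proj a x‖ ^ 2) : E.measure x = m := by
  refine Measure.ext_of_Iic _ _ fun a => ?_
  rw [measure_Iic, ← h, ofReal_measureReal]

theorem proj_mul_proj (E : SpectralFamily K) (a b : ℝ) :
    E.proj a * E.proj b = E.proj (min a b) := by
  rcases le_total a b with h | h
  · rw [E.mono a b h, min_eq_left h]
  · rw [min_eq_right h, ← (E.isStarProjection a).isSelfAdjoint.star_eq,
      ← (E.isStarProjection b).isSelfAdjoint.star_eq, ← star_mul, E.mono b a h]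

theorem ext_of_norm {E F : SpectralFamily K} (h : ∀ a x, ‖E.proj a x‖ = ‖F.proj a x‖) :
    E = F := by
  have : E.proj = F.proj := funext fun a => ContinuousLinearMap.ext_inner_self fun x => by
    rw [inner_proj_self, inner_proj_self, h]
  cases E; cases F; simpa using this

theorem ext_of_measure {E F : SpectralFamily K} (h : ∀ x, E.measure x = F.measure x) : E = F :=
  ext_of_norm fun a x => by
    rw [← sq_eq_sq₀ (norm_nonneg _) (norm_nonneg _), ← measureReal_Iic, h, measureReal_Iic]

/-! ### The bounded functional calculus -/

theorem isOperatorIntegral_proj (E : SpectralFamily K) (a : ℝ) :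
    E.IsOperatorIntegral ((Iic a).indicator 1) (E.proj a) := fun x => by
  rw [integral_indicator measurableSet_Iic, inner_proj_self]
  simp [measureReal_Iic]

theorem isOperatorIntegral_one (E : SpectralFamily K) : E.IsOperatorIntegral 1 1 := fun x => by
  simp [measureReal_univ, inner_self_eq_norm_sq_to_K]

namespace IsOperatorIntegral

variable {E : SpectralFamily K} {u v : ℝ → ℂ} {B C : K →L[ℂ] K}

theorem unique (hB : E.IsOperatorIntegral u B) (hC : E.IsOperatorIntegral u C) : B = C :=
  ContinuousLinearMap.ext_inner_self fun x => (hB x).trans (hC x).symm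

theorem congr (hB : E.IsOperatorIntegral u B) (h : ∀ x, u =ᵐ[E.measure x] v) :
    E.IsOperatorIntegral v B := fun x => (hB x).trans (integral_congr_ae (h x))

theorem add (hB : E.IsOperatorIntegral u B) (hC : E.IsOperatorIntegral v C)
    (hu : IsBoundedBorel u) (hv : IsBoundedBorel v) : E.IsOperatorIntegral (u + v) (B + C) :=
  fun x => by
    rw [add_apply, inner_add_right, hB x, hC x]
    exact (integral_add (hu.integrable _) (hv.integrable _)).symm

theorem smul (hB : E.IsOperatorIntegral u B) (c : ℂ) : E.IsOperatorIntegral (c • u) (c • B) :=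
  fun x => by
    rw [smul_apply, inner_smul_right, hB x]
    exact (integral_const_mul c u).symm

theorem star (hB : E.IsOperatorIntegral u B) : E.IsOperatorIntegral (star u) (star B) :=
  fun x => by
    rw [ContinuousLinearMap.star_eq_adjoint, ContinuousLinearMap.adjoint_inner_right,
      ← inner_conj_symm, hB x]
    exact integral_conj.symm

theorem norm_inner_le {M : ℝ} (hB : E.IsOperatorIntegral u B) (hM : ∀ a, ‖u a‖ ≤ M) (x : K) :
    ‖⟪x, B x⟫_ℂ‖ ≤ M * ‖x‖ ^ 2 := by
  rw [hB x, ← E.measureReal_univ]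
  exact norm_integral_le_of_norm_le_const (.of_forall hM)

end IsOperatorIntegral

theorem tendsto_integral (E : SpectralFamily K) {w : ℕ → ℝ → ℂ} {u : ℝ → ℂ} {M : ℝ}
    (hw : ∀ n, IsBoundedBorel (w n)) (hM : ∀ n a, ‖w n a‖ ≤ M)
    (h : ∀ a, Tendsto (fun n => w n a) atTop (𝓝 (u a))) (x : K) :
    Tendsto (fun n => ∫ a, w n a ∂(E.measure x)) atTop (𝓝 (∫ a, u a ∂(E.measure x))) :=
  tendsto_integral_of_dominated_convergence (fun _ => M)
    (fun n => (hw n).measurable.aestronglyMeasurable) (integrable_const M)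
    (fun n => .of_forall (hM n)) (.of_forall h)

/-- The projections of `E` settle half-lines. At a bounded pointwise limit the quadratic forms
converge by dominated convergence, and `exists_weak_limit` supplies the operator. -/
theorem exists_isOperatorIntegral (E : SpectralFamily K) {u : ℝ → ℂ} (hu : IsBoundedBorel u) :
    ∃ B, E.IsOperatorIntegral u B := by
  refine IsBoundedBorel.induction (P := fun u => ∃ B, E.IsOperatorIntegral u B) ?_ ?_ ?_ ?_ hu
  · intro a
    exact ⟨_, E.isOperatorIntegral_proj a⟩
  · intro u v hu hv hB hC
    obtain ⟨⟨B, hB⟩, C, hC⟩ := And.intro hB hC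
    exact ⟨_, hB.add hC hu hv⟩
  · intro c u hu hB
    obtain ⟨B, hB⟩ := hB
    exact ⟨_, hB.smul c⟩
  · intro w u M hM hw hu hwM h hB
    choose B hB using hB
    refine exists_weak_limit hM (fun n => (hB n).norm_inner_le (hwM n)) fun x => ?_
    simp only [fun n => hB n x]
    exact E.tendsto_integral hw hwM h x

/-- The operator `∫ u dE`, for a bounded Borel function `u`. -/
def calculus (E : SpectralFamily K) (u : ℝ → ℂ) : K →L[ℂ] K :=
  -- The default value `0` never occurs for bounded Borel functions.
  open scoped Classical in if h : ∃ B, E.IsOperatorIntegral u B then h.choose else 0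

theorem isOperatorIntegral_calculus (E : SpectralFamily K) {u : ℝ → ℂ} (hu : IsBoundedBorel u) :
    E.IsOperatorIntegral u (E.calculus u) := by
  have h := E.exists_isOperatorIntegral hu
  rw [calculus, dif_pos h]
  exact h.choose_spec

theorem IsOperatorIntegral.calculus_eq {E : SpectralFamily K} {u : ℝ → ℂ} {B : K →L[ℂ] K}
    (hB : E.IsOperatorIntegral u B) : E.calculus u = B := by
  have h : ∃ B, E.IsOperatorIntegral u B := ⟨B, hB⟩
  rw [calculus, dif_pos h]
  exact h.choose_spec.unique hB

/-- Bounded pointwise convergence of functions becomes weak convergence of operators. This drives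
the limit step of the inductions below. -/
theorem tendsto_inner_calculus (E : SpectralFamily K) {w : ℕ → ℝ → ℂ} {u : ℝ → ℂ} {M : ℝ}
    (hw : ∀ n, IsBoundedBorel (w n)) (hu : IsBoundedBorel u) (hM : ∀ n a, ‖w n a‖ ≤ M)
    (h : ∀ a, Tendsto (fun n => w n a) atTop (𝓝 (u a))) (x y : K) :
    Tendsto (fun n => ⟪x, E.calculus (w n) y⟫_ℂ) atTop (𝓝 ⟪x, E.calculus u y⟫_ℂ) := by
  refine tendsto_inner_of_tendsto_inner_self (fun z => ?_) x y
  simp only [fun n => E.isOperatorIntegral_calculus (hw n) z, E.isOperatorIntegral_calculus hu z]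
  exact E.tendsto_integral hw hM h z

theorem calculus_add (E : SpectralFamily K) {u v : ℝ → ℂ} (hu : IsBoundedBorel u)
    (hv : IsBoundedBorel v) : E.calculus (u + v) = E.calculus u + E.calculus v :=
  ((E.isOperatorIntegral_calculus hu).add (E.isOperatorIntegral_calculus hv) hu hv).calculus_eq

theorem calculus_smul (E : SpectralFamily K) {u : ℝ → ℂ} (hu : IsBoundedBorel u) (c : ℂ) :
    E.calculus (c • u) = c • E.calculus u :=
  ((E.isOperatorIntegral_calculus hu).smul c).calculus_eq

theorem calculus_star (E : SpectralFamily K) {u : ℝ → ℂ} (hu : IsBoundedBorel u) :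
    E.calculus (star u) = star (E.calculus u) :=
  (E.isOperatorIntegral_calculus hu).star.calculus_eq

theorem calculus_indicator_one (E : SpectralFamily K) (a : ℝ) :
    E.calculus ((Iic a).indicator 1) = E.proj a := (E.isOperatorIntegral_proj a).calculus_eq

theorem calculus_one (E : SpectralFamily K) : E.calculus 1 = 1 :=
  E.isOperatorIntegral_one.calculus_eq

/-- An operator that commutes with a spectral family commutes with its functional calculus. -/
theorem commute_calculus (E : SpectralFamily K) {D : K →L[ℂ] K}
    (hD : ∀ a, Commute D (E.proj a)) {u : ℝ → ℂ} (hu : IsBoundedBorel u) :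
    Commute D (E.calculus u) := by
  refine IsBoundedBorel.induction (P := fun u => Commute D (E.calculus u)) ?_ ?_ ?_ ?_ hu
  · intro a
    rw [calculus_indicator_one]; exact hD a
  · intro u v hu hv hB hC
    rw [E.calculus_add hu hv]; exact hB.add_right hC
  · intro c u hu hB
    rw [E.calculus_smul hu]; exact hB.smul_right c
  · intro w u M hM hw hu hwM h hB
    ext y
    refine ext_inner_left ℂ fun x => ?_
    -- Only weak convergence is available, so `D` is moved to the other side of the inner product as
    -- its adjoint.
    have h1 := E.tendsto_inner_calculus hw hu hwM h (star D x) y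
    have h2 := E.tendsto_inner_calculus hw hu hwM h x (D y)
    simp only [ContinuousLinearMap.star_eq_adjoint, ContinuousLinearMap.adjoint_inner_left] at h1
    refine tendsto_nhds_unique h1 (h2.congr fun n => ?_)
    rw [← mul_apply_eq_comp, ← mul_apply_eq_comp, (hB n).eq]

/-- The first of two inductions proving multiplicativity: here the second factor is a half-line
indicator and `u` varies, starting from `proj_mul_proj`. In `calculus_mul` the second factor varies.
-/
theorem calculus_mul_proj (E : SpectralFamily K) {u : ℝ → ℂ} (hu : IsBoundedBorel u) (a : ℝ) :
    E.calculus ((Iic a).indicator u) = E.calculus u * E.proj a := by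
  refine IsBoundedBorel.induction
    (P := fun u => E.calculus ((Iic a).indicator u) = E.calculus u * E.proj a) ?_ ?_ ?_ ?_ hu
  · intro b
    rw [calculus_indicator_one, proj_mul_proj, indicator_indicator, Iic_inter_Iic,
      calculus_indicator_one, inf_comm]
  · intro u v hu hv hB hC
    rw [indicator_add', E.calculus_add (hu.indicator measurableSet_Iic)
      (hv.indicator measurableSet_Iic), hB, hC, E.calculus_add hu hv, add_mul]
  · intro c u hu hB
    have : (Iic a).indicator (c • u) = c • (Iic a).indicator u := by
      ext b; by_cases hb : b ≤ a <;> simp [hb]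
    rw [this, E.calculus_smul (hu.indicator measurableSet_Iic), hB, E.calculus_smul hu,
      smul_mul_assoc]
  · intro w u M hM hw hu hwM h hB
    ext y
    refine ext_inner_left ℂ fun x => ?_
    refine tendsto_nhds_unique (E.tendsto_inner_calculus
      (fun n => (hw n).indicator (measurableSet_Iic (a := a))) (hu.indicator measurableSet_Iic)
      (fun n b => (norm_indicator_le_norm_self _ _).trans (hwM n b)) (fun b => ?_) x y)
      ((E.tendsto_inner_calculus hw hu hwM h x (E.proj a y)).congr fun n => ?_)
    · by_cases hb : b ≤ a
      · simpa [hb] using h b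
      · simp [hb]
    · rw [hB n, mul_apply_eq_comp]

theorem calculus_mul (E : SpectralFamily K) {u v : ℝ → ℂ} (hu : IsBoundedBorel u)
    (hv : IsBoundedBorel v) : E.calculus (u * v) = E.calculus u * E.calculus v := by
  refine IsBoundedBorel.induction
    (P := fun v => E.calculus (u * v) = E.calculus u * E.calculus v) ?_ ?_ ?_ ?_ hv
  · intro b
    rw [calculus_indicator_one, ← E.calculus_mul_proj hu]
    congr 1; ext a; by_cases ha : a ≤ b <;> simp [ha]
  · intro v w hv hw hB hC
    rw [mul_add, E.calculus_add (hu.mul hv) (hu.mul hw), hB, hC, E.calculus_add hv hw, mul_add]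
  · intro c v hv hB
    rw [mul_smul_comm, E.calculus_smul (hu.mul hv), hB, E.calculus_smul hv, mul_smul_comm]
  · intro w v M hM hw hv hwM h hB
    obtain ⟨D, hD⟩ := hu.bounded
    ext y
    refine ext_inner_left ℂ fun x => ?_
    have h1 := E.tendsto_inner_calculus hw hv hwM h (star (E.calculus u) x) y
    simp only [ContinuousLinearMap.star_eq_adjoint, ContinuousLinearMap.adjoint_inner_left] at h1
    refine tendsto_nhds_unique (E.tendsto_inner_calculus (fun n => hu.mul (hw n)) (hu.mul hv)
      (M := D * M) (fun n a => ?_) (fun a => ?_) x y) (h1.congr fun n => ?_)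
    · rw [Pi.mul_apply, norm_mul]
      exact mul_le_mul (hD a) (hwM n a) (norm_nonneg _) ((norm_nonneg _).trans (hD a))
    · exact (h a).const_mul _
    · rw [hB n, mul_apply_eq_comp]

theorem IsOperatorIntegral.mul {E : SpectralFamily K} {u v : ℝ → ℂ} {B C : K →L[ℂ] K}
    (hB : E.IsOperatorIntegral u B) (hC : E.IsOperatorIntegral v C) (hu : IsBoundedBorel u)
    (hv : IsBoundedBorel v) : E.IsOperatorIntegral (u * v) (B * C) := by
  rw [← hB.calculus_eq, ← hC.calculus_eq, ← E.calculus_mul hu hv]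
  exact E.isOperatorIntegral_calculus (hu.mul hv)

theorem inner_calculus_calculus (E : SpectralFamily K) {u v : ℝ → ℂ} (hu : IsBoundedBorel u)
    (hv : IsBoundedBorel v) (x : K) :
    ⟪E.calculus u x, E.calculus v x⟫_ℂ = ∫ a, star (u a) * v a ∂(E.measure x) := by
  rw [← ContinuousLinearMap.adjoint_inner_right, ← ContinuousLinearMap.star_eq_adjoint,
    ← E.calculus_star hu, ← mul_apply_eq_comp, ← E.calculus_mul hu.star hv]
  exact E.isOperatorIntegral_calculus (hu.star.mul hv) x

theorem norm_calculus_sq (E : SpectralFamily K) {u : ℝ → ℂ} (hu : IsBoundedBorel u) (x : K) :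
    ‖E.calculus u x‖ ^ 2 = ∫ a, ‖u a‖ ^ 2 ∂(E.measure x) := by
  have h := E.inner_calculus_calculus hu hu x
  rw [inner_self_eq_norm_sq_to_K] at h
  have h2 : ∫ a, star (u a) * u a ∂(E.measure x)
      = ((∫ a, ‖u a‖ ^ 2 ∂(E.measure x) : ℝ) : ℂ) := by
    rw [← integral_complex_ofReal]
    congr 1; ext a
    rw [Complex.star_def, Complex.conj_mul']; push_cast; rfl
  rw [h2] at h
  refine Complex.ofReal_injective (Eq.trans ?_ h)
  push_cast; rfl

/-- `E.proj a` commutes with the calculus, so both distribution functions equal `‖∫ 1_{(-∞,a]} u dE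
x‖²`. With `u = resolventFun` the density is `1/(1 + a²)`, which reduces questions about the
unbounded `A` to bounded functions. -/
theorem measure_calculus (E : SpectralFamily K) {u : ℝ → ℂ} (hu : IsBoundedBorel u) (x : K) :
    E.measure (E.calculus u x)
      = (E.measure x).withDensity fun a => ENNReal.ofReal (‖u a‖ ^ 2) := by
  have hi : Integrable (fun a => ‖u a‖ ^ 2) (E.measure x) := by
    have := (hu.star.mul hu).integrable (E.measure x)
    refine this.norm.congr (.of_forall fun a => ?_)
    simp [sq]
  have := isFiniteMeasure_withDensity_ofReal hi.2
  refine E.measure_eq _ fun a => ?_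
  rw [measureReal_def, withDensity_apply _ measurableSet_Iic,
    ← ofReal_integral_eq_lintegral_ofReal hi.integrableOn (.of_forall fun a => sq_nonneg _),
    ENNReal.toReal_ofReal (integral_nonneg fun a => sq_nonneg _)]
  have : E.proj a (E.calculus u x) = E.calculus ((Iic a).indicator u) x := by
    have hc : Commute (E.proj a) (E.calculus u) :=
      E.commute_calculus (fun b => by
        rw [commute_iff_eq, proj_mul_proj, proj_mul_proj, min_comm]) hu
    rw [E.calculus_mul_proj hu, ← hc.eq]; rfl
  rw [this, E.norm_calculus_sq (hu.indicator measurableSet_Iic),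
    ← integral_indicator measurableSet_Iic]
  congr 1; ext b; by_cases hb : b ≤ a <;> simp [hb]

end SpectralFamily

/-! ### The density theorem for operator algebras with unit -/

section Density

variable {K : Type*} [NormedAddCommGroup K] [InnerProductSpace ℂ K]

/-- The diagonal operator with entries `B` on a finite Hilbert sum of copies of `K`. -/
def amplification (n : ℕ) (B : K →L[ℂ] K) :
    PiLp 2 (fun _ : Fin n => K) →L[ℂ] PiLp 2 (fun _ : Fin n => K) :=
  (PiLp.continuousLinearEquiv 2 ℂ (fun _ : Fin n => K)).symm.toContinuousLinearMap ∘L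
    ContinuousLinearMap.pi fun i => B ∘L PiLp.proj 2 (fun _ : Fin n => K) i

@[simp]
theorem amplification_apply {n : ℕ} (B : K →L[ℂ] K) (z : PiLp 2 (fun _ : Fin n => K)) (i : Fin n) :
    amplification n B z i = B (z i) := rfl

theorem inner_amplification [CompleteSpace K] {n : ℕ} (B : K →L[ℂ] K)
    (w z : PiLp 2 (fun _ : Fin n => K)) :
    ⟪w, amplification n B z⟫_ℂ = ⟪amplification n (star B) w, z⟫_ℂ := by
  simp only [PiLp.inner_apply, amplification_apply, ContinuousLinearMap.star_eq_adjoint,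
    ContinuousLinearMap.adjoint_inner_left]

/-- A subspace invariant under an operator and its adjoint is reducing, so its projection commutes
with the operator. -/
theorem commute_starProjection_amplification [CompleteSpace K] {n : ℕ}
    {N : Submodule ℂ (PiLp 2 (fun _ : Fin n => K))} [N.HasOrthogonalProjection]
    {B : K →L[ℂ] K} (h : ∀ z ∈ N, amplification n B z ∈ N)
    (h' : ∀ z ∈ N, amplification n (star B) z ∈ N) (z : PiLp 2 (fun _ : Fin n => K)) :
    N.starProjection (amplification n B z) = amplification n B (N.starProjection z) := by
  refine Submodule.eq_starProjection_of_mem_orthogonal (h _ (N.starProjection_apply_mem z)) ?_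
  rw [← map_sub]
  intro w hw
  rw [inner_amplification]
  exact (Submodule.mem_orthogonal _ _).1 (N.sub_starProjection_mem_orthogonal z) _ (h' w hw)

/-- Every operator in the bicommutant of a `*`-closed multiplicative subspace with unit is, on any
finite set of vectors, close to an operator of the subspace. -/
theorem exists_norm_sub_lt_of_mem_centralizer [CompleteSpace K] {S : Submodule ℂ (K →L[ℂ] K)}
    (one : 1 ∈ S) (mul : ∀ B ∈ S, ∀ C ∈ S, B * C ∈ S) (hstar : ∀ B ∈ S, star B ∈ S)
    {B : K →L[ℂ] K} (hB : B ∈ Set.centralizer (Set.centralizer (S : Set (K →L[ℂ] K))))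
    {n : ℕ} (x : Fin n → K) {ε : ℝ} (hε : 0 < ε) : ∃ C ∈ S, ∀ i, ‖C (x i) - B (x i)‖ < ε := by
  set X : PiLp 2 (fun _ : Fin n => K) := WithLp.toLp 2 x
  let ev : (K →L[ℂ] K) →ₗ[ℂ] PiLp 2 (fun _ : Fin n => K) :=
    { toFun := fun C => amplification n C X
      map_add' := fun C D => by ext i; simp
      map_smul' := fun c C => by ext i; simp }
  -- `N` is the closure of the tuples `(C (x i))ᵢ` with `C ∈ S`. The goal amounts to `amplification
  -- n B X ∈ N`, and `X ∈ N` because `1 ∈ S`.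
  set N := (S.map ev).topologicalClosure with hN
  have : CompleteSpace N := (Submodule.isClosed_topologicalClosure _).completeSpace_coe
  have inv : ∀ C ∈ S, ∀ z ∈ N, amplification n C z ∈ N := by
    intro C hC z hz
    have hm : MapsTo (amplification n C) (S.map ev : Set _) (S.map ev : Set _) := by
      rintro _ ⟨D, hD, rfl⟩
      exact ⟨C * D, mul C hC D hD, by ext i; rfl⟩
    exact hm.closure (amplification n C).continuous hz
  have comm : ∀ C ∈ S, ∀ z, N.starProjection (amplification n C z)
      = amplification n C (N.starProjection z) := fun C hC z =>
    commute_starProjection_amplification (inv C hC) (inv _ (hstar C hC)) z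
  let e : Fin n → K →L[ℂ] PiLp 2 (fun _ : Fin n => K) := fun j =>
    (PiLp.continuousLinearEquiv 2 ℂ (fun _ : Fin n => K)).symm.toContinuousLinearMap ∘L
      ContinuousLinearMap.single ℂ (fun _ : Fin n => K) j
  have he : ∀ j y i, e j y i = if i = j then y else 0 := fun j y i => by
    change (Pi.single j y : Fin n → K) i = _
    rw [Pi.single_apply]
  have hamp : ∀ (C : K →L[ℂ] K) j y, amplification n C (e j y) = e j (C y) := fun C j y => by
    ext i
    rw [amplification_apply, he, he]
    split_ifs <;> simp
  have hsum : ∀ z, z = ∑ j, e j (z j) := fun z => by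
    ext i
    rw [WithLp.ofLp_sum, Finset.sum_apply]
    simp [he]
  -- The matrix entries of the projection onto `N` lie in the commutant of `S`, so `B` commutes with
  -- each of them and its amplification commutes with the projection.
  let p : Fin n → Fin n → K →L[ℂ] K := fun i j =>
    PiLp.proj 2 (fun _ : Fin n => K) i ∘L N.starProjection ∘L e j
  have hp : ∀ i j y, p i j y = N.starProjection (e j y) i := fun i j y => rfl
  have hpB : ∀ i j y, p i j (B y) = B (p i j y) := by
    intro i j y
    have hmem : p i j ∈ Set.centralizer (S : Set (K →L[ℂ] K)) := by
      intro C hC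
      ext y
      rw [mul_apply_eq_comp, mul_apply_eq_comp, hp, hp, ← hamp, comm C hC, amplification_apply]
    have := congr($(hB _ hmem) y)
    simpa using this
  have hcommB : N.starProjection (amplification n B X)
      = amplification n B (N.starProjection X) := by
    ext i
    rw [amplification_apply]
    conv_lhs => rw [hsum X]
    conv_rhs => rw [hsum X]
    simp only [map_sum, WithLp.ofLp_sum, Finset.sum_apply, hamp, ← hp, hpB]
  have hX : N.starProjection X = X := by
    refine Submodule.starProjection_eq_self_iff.2 (Submodule.le_topologicalClosure _ ⟨1, one, ?_⟩)
    ext i; rfl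
  have hmem : amplification n B X ∈ N := by
    rw [hX] at hcommB
    rw [← hcommB]
    exact N.starProjection_apply_mem _
  obtain ⟨_, ⟨C, hC, rfl⟩, hd⟩ := Metric.mem_closure_iff.1 hmem ε hε
  refine ⟨C, hC, fun i => ?_⟩
  rw [dist_comm, dist_eq_norm] at hd
  exact (PiLp.norm_apply_le (ev C - amplification n B X) i).trans_lt hd

theorem mem_strongClosure_of_forall {S : Set (K →L[ℂ] K)} {B : K →L[ℂ] K}
    (h : ∀ (n : ℕ) (x : Fin n → K) (ε : ℝ), 0 < ε → ∃ C ∈ S, ∀ i, ‖C (x i) - B (x i)‖ < ε) :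
    B ∈ strongClosure S := by
  refine (mem_closure_iff_nhds (X := K →Lₚₜ[ℂ] K)).2 fun U hU => ?_
  obtain ⟨s, r, hr, hs⟩ := ((PointwiseConvergenceCLM.withSeminorms (σ := RingHom.id ℂ)
    (E := K) (F := K)).mem_nhds_iff _ U).1 hU
  obtain ⟨C, hC, hCB⟩ := h _ (fun i => (s.equivFin.symm i : K)) r hr
  refine ⟨_, hs ?_, mem_image_of_mem _ hC⟩
  refine (Seminorm.mem_ball _).2 (Seminorm.finset_sup_apply_lt hr fun x hx => ?_)
  change ‖C x - B x‖ < r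
  simpa using hCB (s.equivFin ⟨x, hx⟩)

theorem strongClosure_mono {S S' : Set (K →L[ℂ] K)} (h : S ⊆ S') :
    strongClosure S ⊆ strongClosure S' := fun _ hB =>
  closure_mono (X := K →Lₚₜ[ℂ] K) (image_mono h) hB

/-- The strong operator topology is finer than the weak one, so weakly closed sets are strongly
closed. -/
theorem IsWeaklyClosed.strongClosure_eq {S : Set (K →L[ℂ] K)} (h : IsWeaklyClosed S) :
    strongClosure S = S := by
  let g : (K →Lₚₜ[ℂ] K) → (K →WOT[ℂ] K) := fun B => ContinuousLinearMapWOT.equiv.symm B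
  have hg : Continuous g := ContinuousLinearMapWOT.continuous_of_dual_apply_continuous fun x y =>
    y.continuous.comp (continuous_eval_const (F := K →Lₚₜ[ℂ] K) x)
  refine Subset.antisymm (fun B hB => ?_) fun B hB =>
    subset_closure (X := K →Lₚₜ[ℂ] K) (mem_image_of_mem _ hB)
  have hc := h.preimage hg
  have : closure (X := K →Lₚₜ[ℂ] K) ((UniformConvergenceCLM.ofFun (RingHom.id ℂ) K _) '' S) ⊆ _ :=
    closure_minimal (by rintro _ ⟨C, hC, rfl⟩; exact hC) hc
  exact this hB

variable [CompleteSpace K]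

/-- Commutation with `C` is tested on matrix coefficients: both `⟪C* y, B x⟫` and `⟪y, B (C x)⟫` are
weakly continuous in `B`. -/
theorem isWeaklyClosed_centralizer (S : Set (K →L[ℂ] K)) : IsWeaklyClosed (Set.centralizer S) := by
  have : ((fun B : K →WOT[ℂ] K => ContinuousLinearMapWOT.equiv B) ⁻¹' Set.centralizer S)
      = ⋂ C ∈ S, ⋂ x : K, ⋂ y : K, {B : K →WOT[ℂ] K | ⟪star C y, B x⟫_ℂ = ⟪y, B (C x)⟫_ℂ} := by
    ext B
    simp only [mem_preimage, Set.mem_centralizer_iff, mem_iInter, mem_ofPred_eq,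
      ContinuousLinearMap.star_eq_adjoint, ContinuousLinearMap.adjoint_inner_left]
    refine forall₂_congr fun C _ => ?_
    rw [ContinuousLinearMap.ext_iff]
    exact forall_congr' fun x => ⟨fun h y => congrArg _ h, fun h => ext_inner_left ℂ h⟩
  rw [IsWeaklyClosed, this]
  have hc : ∀ x y : K, Continuous fun B : K →WOT[ℂ] K => ⟪y, B x⟫_ℂ := fun x y =>
    ContinuousLinearMapWOT.continuous_iff.1 continuous_id x y
  exact isClosed_biInter fun C _ => isClosed_iInter fun x => isClosed_iInter fun y =>
    isClosed_eq (hc _ _) (hc _ _)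

theorem isWeaklyClosed_generatedAlgebra (S : Set (K →L[ℂ] K)) :
    IsWeaklyClosed (generatedAlgebra S : Set (K →L[ℂ] K)) := by
  rw [generatedAlgebra, NonUnitalStarAlgebra.coe_sInf, IsWeaklyClosed, preimage_iInter₂]
  exact isClosed_biInter fun M hM => hM.2

theorem subset_generatedAlgebra (S : Set (K →L[ℂ] K)) : S ⊆ generatedAlgebra S := by
  rw [generatedAlgebra, NonUnitalStarAlgebra.coe_sInf]
  exact subset_iInter₂ fun M hM => hM.1

theorem generatedAlgebra_le {S : Set (K →L[ℂ] K)} {M : NonUnitalStarSubalgebra ℂ (K →L[ℂ] K)}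
    (h : S ⊆ M) (hM : IsWeaklyClosed (M : Set (K →L[ℂ] K))) : generatedAlgebra S ≤ M :=
  sInf_le ⟨h, hM⟩

/-- The density theorem places the bicommutant inside the strong closure of `S`; the reverse
inclusion holds because a commutant is weakly, hence strongly, closed. -/
theorem strongClosure_eq_centralizer {S : Submodule ℂ (K →L[ℂ] K)}
    (one : 1 ∈ S) (mul : ∀ B ∈ S, ∀ C ∈ S, B * C ∈ S) (hstar : ∀ B ∈ S, star B ∈ S)
    {L : Set (K →L[ℂ] K)} (hSL : (S : Set (K →L[ℂ] K)) ⊆ L)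
    (hL : L ⊆ Set.centralizer (Set.centralizer (S : Set (K →L[ℂ] K)))) :
    strongClosure L = Set.centralizer (Set.centralizer (S : Set (K →L[ℂ] K))) := by
  refine Subset.antisymm ?_ fun B hB => strongClosure_mono hSL (mem_strongClosure_of_forall
    fun n x ε hε => exists_norm_sub_lt_of_mem_centralizer one mul hstar hB x hε)
  exact (strongClosure_mono hL).trans (isWeaklyClosed_centralizer _).strongClosure_eq.subset

/-- The bicommutant theorem. -/
theorem coe_generatedAlgebra {S : Set (K →L[ℂ] K)} (hS : ∀ B ∈ S, star B ∈ S)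
    (one : 1 ∈ generatedAlgebra S) :
    (generatedAlgebra S : Set (K →L[ℂ] K)) = Set.centralizer (Set.centralizer S) := by
  refine Subset.antisymm ?_ ?_
  · let M : NonUnitalStarSubalgebra ℂ (K →L[ℂ] K) :=
      { carrier := Set.centralizer (Set.centralizer S)
        add_mem' := fun h h' => Set.add_mem_centralizer h h'
        zero_mem' := Set.zero_mem_centralizer
        mul_mem' := fun h h' => Set.mul_mem_centralizer h h'
        smul_mem' := fun c B hB C hC => by rw [mul_smul_comm, smul_mul_assoc, hB C hC]
        star_mem' := fun h => Set.star_mem_centralizer' (fun _ => Set.star_mem_centralizer' hS) h }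
    exact generatedAlgebra_le (M := M) Set.subset_centralizer_centralizer
      (isWeaklyClosed_centralizer _)
  · set M := generatedAlgebra S with hM
    -- The density theorem applied to the algebra itself shows that it equals its own bicommutant,
    -- which contains that of `S`.
    have := strongClosure_eq_centralizer (S := M.toSubmodule) one
      (fun B hB C hC => M.mul_mem' hB hC)
      (fun B hB => M.star_mem' hB) Subset.rfl Set.subset_centralizer_centralizer
    have h2 := (isWeaklyClosed_generatedAlgebra S).strongClosure_eq
    refine (Set.centralizer_subset (Set.centralizer_subset (subset_generatedAlgebra S))).trans ?_
    exact (this.symm.trans h2).subset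

end Density

/-! ### Strongly continuous unitary groups -/

/-- A strongly continuous one-parameter group of unitary operators on `K`. -/
structure StronglyContinuousUnitaryGroup (K : Type*) [NormedAddCommGroup K]
    [InnerProductSpace ℂ K] [CompleteSpace K] where
  op : ℝ → K →L[ℂ] K
  op_zero : op 0 = 1
  op_add : ∀ s t, op (s + t) = op s * op t
  star_op : ∀ t, star (op t) = op (-t)
  continuous_op : ∀ x, Continuous fun t => op t x

namespace StronglyContinuousUnitaryGroup

variable {K : Type*} [NormedAddCommGroup K] [InnerProductSpace ℂ K] [CompleteSpace K]

variable (W : StronglyContinuousUnitaryGroup K)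

theorem op_neg_op (t : ℝ) (x : K) : W.op (-t) (W.op t x) = x := by
  rw [← mul_apply_eq_comp, ← W.op_add, neg_add_cancel, W.op_zero]; rfl

theorem inner_op_left (t : ℝ) (x y : K) : ⟪W.op t x, y⟫_ℂ = ⟪x, W.op (-t) y⟫_ℂ := by
  rw [← W.star_op, ContinuousLinearMap.star_eq_adjoint, ContinuousLinearMap.adjoint_inner_right]

theorem norm_op_apply (t : ℝ) (x : K) : ‖W.op t x‖ = ‖x‖ := by
  have h : ‖W.op t x‖ ^ 2 = ‖x‖ ^ 2 := by
    rw [← inner_self_eq_norm_sq (𝕜 := ℂ), ← inner_self_eq_norm_sq (𝕜 := ℂ), inner_op_left,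
      op_neg_op]
  exact (sq_eq_sq₀ (norm_nonneg _) (norm_nonneg _)).1 h

/-- The group run backwards. -/
def reverse : StronglyContinuousUnitaryGroup K where
  op t := W.op (-t)
  op_zero := by rw [neg_zero, W.op_zero]
  op_add s t := by rw [neg_add, W.op_add]
  star_op t := W.star_op _
  continuous_op x := (W.continuous_op x).comp continuous_neg

@[simp]
theorem reverse_op (t : ℝ) : W.reverse.op t = W.op (-t) := rfl

theorem reverse_reverse : W.reverse.reverse = W := by
  simp [reverse]

/-- The contraction semigroup of the operators with nonnegative parameter. -/
def forward : C0ContractionSemigroup K where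
  op t := W.op t
  op_zero := by rw [NNReal.coe_zero, W.op_zero]
  op_add s t := by rw [NNReal.coe_add, W.op_add]
  norm_op_le t := (W.op t).opNorm_le_bound zero_le_one fun x => by rw [norm_op_apply, one_mul]
  continuous_op x := (W.continuous_op x).comp NNReal.continuous_coe

/-- The resolvent `(1 - G)⁻¹` of the generator `G`. -/
def resolvent : K →L[ℂ] K := W.forward.laplace

theorem resolvent_apply (x : K) :
    W.resolvent x = ∫ t in Ioi (0 : ℝ), Real.exp (-t) • W.op t x := by
  rw [resolvent, C0ContractionSemigroup.laplace_apply]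
  refine setIntegral_congr_fun measurableSet_Ioi fun t ht => ?_
  simp only [forward, Real.coe_toNNReal t (le_of_lt ht)]

theorem integrable_exp_smul_op (x : K) :
    IntegrableOn (fun t : ℝ => Real.exp (-t) • W.op t x) (Ioi 0) := by
  refine (W.forward.integrable_laplace x).congr_fun (fun t ht => ?_) measurableSet_Ioi
  simp only [forward, Real.coe_toNNReal t (le_of_lt ht)]

theorem commute_resolvent {D : K →L[ℂ] K} (hD : ∀ t, Commute D (W.op t)) :
    Commute D W.resolvent := by
  ext x
  rw [mul_apply_eq_comp, mul_apply_eq_comp, resolvent_apply, resolvent_apply,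
    ← D.integral_comp_comm (W.integrable_exp_smul_op x)]
  congr 1; ext t
  rw [D.map_smul_of_tower, ← mul_apply_eq_comp, (hD t).eq]; rfl

/-- Since `(W t)* = W (-t)`, taking adjoints under the integral reverses time: the adjoint of `(1 -
G)⁻¹` is `(1 + G)⁻¹`. -/
theorem star_resolvent : star W.resolvent = W.reverse.resolvent := by
  ext y
  refine ext_inner_right ℂ fun x => ?_
  rw [ContinuousLinearMap.star_eq_adjoint, ContinuousLinearMap.adjoint_inner_left,
    ← inner_conj_symm _ x, resolvent_apply, resolvent_apply,
    ← integral_inner (W.integrable_exp_smul_op x),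
    ← integral_inner (W.reverse.integrable_exp_smul_op y), ← integral_conj]
  congr 1; ext t
  rw [inner_conj_symm, ← Complex.coe_smul, ← Complex.coe_smul, inner_smul_left, inner_smul_right,
    reverse_op, Complex.conj_ofReal, inner_op_left, neg_neg]

/-- A right derivative at `0` of an orbit is a two-sided derivative. -/
theorem hasDerivAt_of_tendsto {x y : K}
    (h : Tendsto (fun t : ℝ => t⁻¹ • (W.op t x - x)) (𝓝[>] 0) (𝓝 y)) :
    HasDerivAt (fun t => W.op t x) y 0 := by
  rw [hasDerivAt_iff_tendsto_slope]
  have e : slope (fun t => W.op t x) 0 = fun t : ℝ => t⁻¹ • (W.op t x - x) := by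
    ext t
    rw [slope_def_module, sub_zero, W.op_zero]; rfl
  rw [e, ← Set.Iio_union_Ioi, nhdsWithin_union, tendsto_sup]
  refine ⟨?_, h⟩
  have h2 : Tendsto (fun t : ℝ => (-t)⁻¹ • (W.op (-t) x - x)) (𝓝[<] 0) (𝓝 y) := by
    refine h.comp (tendsto_nhdsWithin_iff.2 ⟨?_, ?_⟩)
    · have : Tendsto (fun t : ℝ => -t) (𝓝 0) (𝓝 (-0)) := continuous_neg.tendsto 0
      rw [neg_zero] at this
      exact this.mono_left nhdsWithin_le_nhds
    · filter_upwards [self_mem_nhdsWithin] with t ht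
      exact neg_pos.2 (show t < 0 from ht)
  have h3 : Tendsto (fun t : ℝ => W.op t y) (𝓝[<] 0) (𝓝 y) := by
    have := (W.continuous_op y).tendsto 0
    rw [W.op_zero] at this
    exact this.mono_left nhdsWithin_le_nhds
  -- For `t < 0` the difference quotient is `W t` applied to the quotient at `-t > 0`. As `W t` is
  -- isometric and strongly continuous, the limit is `W 0 y = y`.
  have h4 : Tendsto (fun t : ℝ => W.op t ((-t)⁻¹ • (W.op (-t) x - x) - y) + W.op t y) (𝓝[<] 0)
      (𝓝 (0 + y)) := by
    refine Tendsto.add ?_ h3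
    rw [tendsto_zero_iff_norm_tendsto_zero]
    simp only [norm_op_apply]
    exact tendsto_iff_norm_sub_tendsto_zero.1 h2
  rw [zero_add] at h4
  refine h4.congr fun t => ?_
  rw [← map_add, sub_add_cancel, (W.op t).map_smul_of_tower, map_sub]
  have := W.op_neg_op (-t) x
  rw [neg_neg] at this
  rw [this, inv_neg, neg_smul, ← smul_neg, neg_sub]

theorem hasDerivAt_op_resolvent_zero (x : K) :
    HasDerivAt (fun t => W.op t (W.resolvent x)) (W.resolvent x - x) 0 := by
  refine W.hasDerivAt_of_tendsto ((W.forward.tendsto_laplace x).congr' ?_)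
  filter_upwards [self_mem_nhdsWithin] with t ht
  simp only [forward, Real.coe_toNNReal t (le_of_lt ht)]
  rfl

theorem commute_op (s t : ℝ) : Commute (W.op s) (W.op t) := by
  rw [commute_iff_eq, ← W.op_add, ← W.op_add, add_comm]

/-- `R` commutes with the group, so the orbit of `R x` near `s` is the orbit of `R (W s x)` near
`0`. -/
theorem hasDerivAt_op_resolvent (x : K) (s : ℝ) :
    HasDerivAt (fun t => W.op t (W.resolvent x)) (W.resolvent (W.op s x) - W.op s x) s := by
  have h := W.hasDerivAt_op_resolvent_zero (W.op s x)
  rw [← sub_self s] at h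
  have h2 := HasDerivAt.scomp (h := fun t => t - s) s h ((hasDerivAt_id s).sub_const s)
  rw [one_smul] at h2
  refine h2.congr_of_eventuallyEq (.of_forall fun t => ?_)
  have hc := (W.commute_resolvent fun t => W.commute_op s t).eq
  change W.op t (W.resolvent x) = W.op (t - s) (W.resolvent (W.op s x))
  rw [← mul_apply_eq_comp W.resolvent, ← hc, mul_apply_eq_comp,
    ← mul_apply_eq_comp (W.op (t - s)), ← W.op_add, sub_add_cancel]

/-- If `R x = 0`, the orbit of `R x` vanishes identically, while its derivative at `0` is `R x - x =
-x`. -/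
theorem resolvent_injective : Function.Injective W.resolvent := by
  refine (injective_iff_map_eq_zero _).2 fun x hx => ?_
  have h := W.hasDerivAt_op_resolvent_zero x
  rw [hx, zero_sub] at h
  simp only [map_zero] at h
  exact neg_eq_zero.1 (h.unique (hasDerivAt_const 0 0))

theorem star_resolvent_injective : Function.Injective ⇑(star W.resolvent : K →L[ℂ] K) := by
  rw [star_resolvent]; exact W.reverse.resolvent_injective

/-- Every vector with a differentiable orbit is in the range of the resolvent. -/
theorem resolvent_sub_of_tendsto {x y : K}
    (h : Tendsto (fun t : ℝ => t⁻¹ • (W.op t x - x)) (𝓝[>] 0) (𝓝 y)) :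
    W.resolvent (x - y) = x := by
  have h' : Tendsto (fun t : ℝ => t⁻¹ • (W.forward.op t.toNNReal x - x)) (𝓝[>] 0) (𝓝 y) := by
    refine h.congr' ?_
    filter_upwards [self_mem_nhdsWithin] with t ht
    simp only [forward, Real.coe_toNNReal t (le_of_lt ht)]
  have e := W.forward.laplace_sub_generator ⟨x, y, h'⟩
  have e2 : W.forward.generator ⟨x, y, h'⟩ = y :=
    tendsto_nhds_unique (derivAtZero_tendsto _ _ _) h'
  rwa [e2] at e

/-- This is `(1 + G)⁻¹ (1 + G) R = R`, because `(1 + G) R = 2R - 1`. It is equivalent to the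
skew-symmetry of `G` on the range of `R` and makes the Cayley transform unitary. -/
theorem star_resolvent_mul : star W.resolvent * (2 * W.resolvent - 1) = W.resolvent := by
  ext x
  have h := W.hasDerivAt_op_resolvent_zero x
  rw [← neg_zero] at h
  have h2 := h.scomp 0 (hasDerivAt_neg (0 : ℝ))
  have h3 : Tendsto (fun t : ℝ => t⁻¹ • (W.reverse.op t (W.resolvent x) - W.resolvent x)) (𝓝[>] 0)
      (𝓝 (x - W.resolvent x)) := by
    have := (hasDerivAt_iff_tendsto_slope.1 h2).mono_left
      (nhdsWithin_mono 0 (fun t (ht : 0 < t) => ht.ne') : 𝓝[>] (0 : ℝ) ≤ 𝓝[≠] 0)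
    rw [neg_one_smul, neg_sub] at this
    refine this.congr fun t => ?_
    rw [slope_def_module]
    simp [reverse, W.op_zero]
  have := W.reverse.resolvent_sub_of_tendsto h3
  rw [← star_resolvent] at this
  rw [mul_apply_eq_comp]
  convert this using 2
  rw [two_mul]
  simp
  abel

/-- The Cayley transform `(G + 1)(G - 1)⁻¹` of the generator `G`. -/
def cayley : K →L[ℂ] K := 1 - 2 * W.resolvent

theorem star_cayley : star W.cayley = W.reverse.cayley := by
  rw [cayley, cayley, ← star_resolvent, two_mul, two_mul]
  simp

theorem star_cayley_mul_cayley : star W.cayley * W.cayley = 1 := by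
  have h := W.star_resolvent_mul
  rw [mul_sub, mul_one, two_mul, mul_add] at h
  rw [cayley]
  simp only [star_sub, star_one, two_mul, star_add, sub_mul, mul_sub, add_mul, mul_add, one_mul,
    mul_one]
  rw [sub_eq_iff_eq_add] at h
  rw [h]
  abel

theorem cayley_mul_star_cayley : W.cayley * star W.cayley = 1 := by
  have := W.reverse.star_cayley_mul_cayley
  rwa [star_cayley, reverse_reverse, ← star_cayley] at this

/-- An operator that commutes with the resolvent commutes with the group. -/
theorem commute_op_of_commute_resolvent {D : K →L[ℂ] K} (hD : Commute D W.resolvent) (s : ℝ) :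
    Commute D (W.op s) := by
  set R := W.resolvent with hR
  -- Skew-symmetry of `G`, with `G R q = R q - q`.
  have hR2 : ∀ p q, ⟪R p, R q - q⟫_ℂ + ⟪R p - p, R q⟫_ℂ = 0 := by
    intro p q
    have := congr(⟪p, $(W.star_resolvent_mul) q⟫_ℂ)
    rw [mul_apply_eq_comp, ContinuousLinearMap.star_eq_adjoint,
      ContinuousLinearMap.adjoint_inner_right, two_mul] at this
    simp only [sub_apply, add_apply, one_apply_eq_self, inner_sub_right, inner_add_right,
      inner_sub_left] at this ⊢
    linear_combination this
  -- Since `D` commutes with `R`, differentiating in `t` yields the skew-symmetry expression `hR2`,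
  -- so the function is constant in `t`.
  have hconst : ∀ a b t, ⟪W.op t (R b), D (W.op t (R a))⟫_ℂ = ⟪R b, D (R a)⟫_ℂ := by
    intro a b t
    have hd : ∀ t, HasDerivAt (fun t => ⟪W.op t (R b), D (W.op t (R a))⟫_ℂ) 0 t := by
      intro t
      have h1 := W.hasDerivAt_op_resolvent b t
      have h2 := D.hasFDerivAt.restrictScalars ℝ |>.comp_hasDerivAt t
        (W.hasDerivAt_op_resolvent a t)
      refine (h1.inner ℂ h2).congr_deriv ?_
      have hc := fun t x => congr($((W.commute_resolvent fun r => W.commute_op t r).eq) x)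
      have hDR := fun x => congr($(hD.eq) x)
      simp only [mul_apply_eq_comp, ← hR] at hc hDR
      simp only [Function.comp_apply, hc, hDR, ContinuousLinearMap.coe_restrictScalars', map_sub,
        ← hR]
      exact hR2 _ _
    have := is_const_of_deriv_eq_zero (fun t => (hd t).differentiableAt) (fun t => (hd t).deriv)
      t 0
    simpa [W.op_zero] using this
  -- By `hconst`, `R* X R = 0`. Injectivity of `R*`, used once for `X R` and once for the adjoint of
  -- `X`, gives `X = 0`.
  set X := star (W.op s) * D * W.op s - D with hX
  have h0 : ∀ a, X (R a) = 0 := by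
    intro a
    refine (injective_iff_map_eq_zero _).1 W.star_resolvent_injective _
      (ext_inner_left ℂ fun b => ?_)
    rw [inner_zero_right, ContinuousLinearMap.star_eq_adjoint,
      ContinuousLinearMap.adjoint_inner_right, hX, sub_apply, inner_sub_right, mul_apply_eq_comp,
      mul_apply_eq_comp, ContinuousLinearMap.star_eq_adjoint,
      ContinuousLinearMap.adjoint_inner_right, ← hR, hconst, sub_self]
  have hX0 : X = 0 := by
    have h1 : star X = 0 := by
      ext b
      refine (injective_iff_map_eq_zero _).1 W.star_resolvent_injective _
        (ext_inner_right ℂ fun a => ?_)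
      rw [inner_zero_left, ContinuousLinearMap.star_eq_adjoint,
        ContinuousLinearMap.adjoint_inner_left, ContinuousLinearMap.star_eq_adjoint,
        ContinuousLinearMap.adjoint_inner_left, ← hR, h0, inner_zero_right]
    rw [← star_star X, h1, star_zero]
  have h1 : star (W.op s) * D * W.op s = D := sub_eq_zero.1 hX0
  have h2 : W.op s * star (W.op s) = 1 := by
    rw [W.star_op, ← W.op_add, add_neg_cancel, W.op_zero]
  calc D * W.op s = W.op s * star (W.op s) * D * W.op s := by rw [h2, one_mul]
    _ = W.op s * D := by rw [mul_assoc, mul_assoc, ← mul_assoc (star _), h1]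

/-- `1 - 2R` and `R` have the same commutant, and that of `R` is the commutant of the group. This
links the algebra of the group to that of the powers of `U`. -/
theorem commute_cayley_iff {D : K →L[ℂ] K} : Commute D W.cayley ↔ ∀ t, Commute D (W.op t) := by
  have : Commute D W.cayley ↔ Commute D W.resolvent := by
    rw [cayley]
    constructor
    · intro h
      have h2 : Commute D ((2⁻¹ : ℂ) • (1 - (1 - 2 * W.resolvent))) :=
        ((Commute.one_right D).sub_right h).smul_right _
      rwa [sub_sub_cancel, two_mul, ← two_smul ℂ, smul_smul, inv_mul_cancel₀ two_ne_zero,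
        one_smul] at h2
    · intro h
      rw [two_mul]
      exact (Commute.one_right D).sub_right (h.add_right h)
  rw [this]
  exact ⟨W.commute_op_of_commute_resolvent, W.commute_resolvent⟩

/-- The domain of the generator is the range of `R`, so the unbounded operator can be studied
through a bounded one. -/
theorem mem_domain_iff {x : K} :
    x ∈ (derivAtZero W.op (𝓝[≠] 0)).domain ↔ ∃ y, W.resolvent y = x := by
  constructor
  · rintro ⟨y, hy⟩
    exact ⟨x - y, W.resolvent_sub_of_tendsto
      (hy.mono_left (nhdsWithin_mono 0 fun t (ht : 0 < t) => ht.ne'))⟩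
  · rintro ⟨y, rfl⟩
    refine ⟨W.resolvent y - y, ?_⟩
    refine (hasDerivAt_iff_tendsto_slope.1 (W.hasDerivAt_op_resolvent_zero y)).congr fun t => ?_
    rw [slope_def_module, sub_zero, W.op_zero]; rfl

theorem derivAtZero_resolvent (x : (derivAtZero W.op (𝓝[≠] 0)).domain) {y : K}
    (h : W.resolvent y = x) : derivAtZero W.op (𝓝[≠] 0) x = W.resolvent y - y := by
  refine tendsto_nhds_unique (derivAtZero_tendsto _ _ _) ?_
  rw [← h]
  refine (hasDerivAt_iff_tendsto_slope.1 (W.hasDerivAt_op_resolvent_zero y)).congr fun t => ?_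
  rw [slope_def_module, sub_zero, W.op_zero]; rfl

end StronglyContinuousUnitaryGroup

theorem ContinuousLinearMap.star_mul_eq {K : Type*} [NormedAddCommGroup K] [InnerProductSpace ℂ K]
    [CompleteSpace K] (A B : K →L[ℂ] K) : star (A * B) = star B * star A := star_mul A B

/-! ### The unitary part of a contraction semigroup -/

namespace C0ContractionSemigroup

variable {H : Type*} [NormedAddCommGroup H] [InnerProductSpace ℂ H] [CompleteSpace H]
  (T : C0ContractionSemigroup H)

/-- The roles of `T t` and its adjoint are symmetric in the unitary subspace. Invariance under
adjoints makes the adjoint of the restriction the restriction of the adjoint. -/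
theorem star_op_mem_unitarySubspace (s : ℝ≥0) {x : H} (hx : x ∈ T.unitarySubspace) :
    (star (T.op s)) x ∈ T.unitarySubspace := by
  intro t
  have hs : ∀ r, ‖star (T.op r)‖ ≤ 1 := fun r => by rw [norm_star]; exact T.norm_op_le r
  have hn : ∀ r, ‖(star (T.op r)) x‖ = ‖x‖ := fun r => (hx r).2
  have hl : ∀ r, T.op r ((star (T.op r)) x) = x := fun r => by
    simpa using (norm_eq_iff_adjoint_apply (hs r) x).1 (hn r)
  constructor
  · rw [hn]
    rcases le_total t s with h | h
    · obtain ⟨r, rfl⟩ := exists_add_of_le h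
      have e : (star (T.op (t + r))) x = (star (T.op t)) ((star (T.op r)) x) := by
        rw [add_comm, T.op_add, star_mul]; rfl
      have : T.op t ((star (T.op t)) ((star (T.op r)) x)) = (star (T.op r)) x := by
        have := (norm_eq_iff_adjoint_apply (hs t) ((star (T.op r)) x)).1 (by rw [← e, hn, hn])
        simpa using this
      rw [e, this, hn]
    · obtain ⟨r, rfl⟩ := exists_add_of_le h
      rw [add_comm, T.op_add, mul_apply_eq_comp, hl, (hx r).1]
  · rw [← mul_apply_eq_comp, ← star_mul, ← T.op_add, hn, hn]

@[simp]
theorem coe_unitaryPart (t : ℝ≥0) (x : T.unitarySubspace) :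
    (T.unitaryPart t x : H) = T.op t x := rfl

theorem coe_star_unitaryPart (t : ℝ≥0) (x : T.unitarySubspace) :
    (star (T.unitaryPart t) x : H) = star (T.op t) x := by
  have : star (T.unitaryPart t) x = ⟨star (T.op t) x, T.star_op_mem_unitarySubspace t x.2⟩ := by
    refine ext_inner_right ℂ fun y => ?_
    rw [ContinuousLinearMap.star_eq_adjoint, ContinuousLinearMap.adjoint_inner_left,
      Submodule.coe_inner, Submodule.coe_inner, coe_unitaryPart]
    exact (ContinuousLinearMap.adjoint_inner_left _ _ _).symm
  rw [this]

theorem unitaryPart_zero : T.unitaryPart 0 = 1 := by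
  ext x; simp [T.op_zero]

theorem unitaryPart_add (s t : ℝ≥0) :
    T.unitaryPart (s + t) = T.unitaryPart s * T.unitaryPart t := by
  ext x; simp [T.op_add]

theorem star_unitaryPart_mul_self (t : ℝ≥0) : star (T.unitaryPart t) * T.unitaryPart t = 1 := by
  ext x
  rw [mul_apply_eq_comp, coe_star_unitaryPart, coe_unitaryPart]
  exact (norm_eq_iff_adjoint_apply (T.norm_op_le t) _).1 (x.2 t).1

theorem unitaryPart_mul_star_self (t : ℝ≥0) : T.unitaryPart t * star (T.unitaryPart t) = 1 := by
  ext x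
  rw [mul_apply_eq_comp, coe_unitaryPart, coe_star_unitaryPart]
  have hs : ‖star (T.op t)‖ ≤ 1 := by rw [norm_star]; exact T.norm_op_le t
  simpa using (norm_eq_iff_adjoint_apply hs _).1 (x.2 t).2

theorem unitaryPart_commute (s t : ℝ≥0) :
    T.unitaryPart s * T.unitaryPart t = T.unitaryPart t * T.unitaryPart s := by
  rw [← unitaryPart_add, add_comm, unitaryPart_add]

theorem star_unitaryPart_commute (s t : ℝ≥0) :
    star (T.unitaryPart s) * T.unitaryPart t = T.unitaryPart t * star (T.unitaryPart s) := by
  calc star (T.unitaryPart s) * T.unitaryPart t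
      = star (T.unitaryPart s) * T.unitaryPart t
          * (T.unitaryPart s * star (T.unitaryPart s)) := by
        rw [unitaryPart_mul_star_self, mul_one]
    _ = star (T.unitaryPart s) * (T.unitaryPart t * T.unitaryPart s)
          * star (T.unitaryPart s) := by simp only [mul_assoc]
    _ = _ := by rw [unitaryPart_commute, ← mul_assoc, star_unitaryPart_mul_self, one_mul]

/-- A formula free of the sign of the parameter: the group law and the adjoints follow from it and
from the commutation of `T t` with `(T s)*`. -/
theorem unitaryGroup_sub (a b : ℝ≥0) :
    T.unitaryGroup (a - b) = T.unitaryPart a * star (T.unitaryPart b) := by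
  rw [unitaryGroup]
  rcases le_or_gt b a with h | h
  · obtain ⟨r, rfl⟩ := exists_add_of_le h
    rw [if_pos (by simp), add_comm b r, unitaryPart_add, mul_assoc, unitaryPart_mul_star_self,
      mul_one]
    simp
  · obtain ⟨r, rfl⟩ := exists_add_of_le h.le
    rw [if_neg (by push Not; exact sub_neg.2 (by exact_mod_cast h)), add_comm a r,
      unitaryPart_add, ContinuousLinearMap.star_mul_eq, ← mul_assoc,
      unitaryPart_mul_star_self, one_mul]
    simp

theorem exists_eq_sub (t : ℝ) : ∃ a b : ℝ≥0, t = a - b :=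
  ⟨t.toNNReal, (-t).toNNReal, by
    rw [Real.coe_toNNReal', Real.coe_toNNReal']
    exact (max_zero_sub_max_neg_zero_eq_self t).symm⟩

theorem unitaryGroup_coe (t : ℝ≥0) : T.unitaryGroup t = T.unitaryPart t := by
  rw [unitaryGroup, if_pos t.coe_nonneg, Real.toNNReal_coe]

/-- The unitary group on the unitary subspace. -/
def toUnitaryGroup : StronglyContinuousUnitaryGroup T.unitarySubspace where
  op := T.unitaryGroup
  op_zero := by simpa [unitaryPart_zero] using T.unitaryGroup_coe 0
  op_add s t := by
    obtain ⟨a, b, rfl⟩ := exists_eq_sub s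
    obtain ⟨c, d, rfl⟩ := exists_eq_sub t
    have : ((a : ℝ) - b + (c - d)) = ((a + c : ℝ≥0) : ℝ) - ((d + b : ℝ≥0) : ℝ) := by
      push_cast; ring
    rw [this, unitaryGroup_sub, unitaryGroup_sub, unitaryGroup_sub, unitaryPart_add,
      unitaryPart_add, ContinuousLinearMap.star_mul_eq, mul_assoc, mul_assoc,
      ← mul_assoc (T.unitaryPart c),
      ← star_unitaryPart_commute, mul_assoc]
  star_op t := by
    obtain ⟨a, b, rfl⟩ := exists_eq_sub t
    rw [neg_sub, unitaryGroup_sub, unitaryGroup_sub, ContinuousLinearMap.star_mul_eq, star_star]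
  continuous_op x := by
    -- To the right of `-n` the group is `T (t + n) (T n)*`, whose continuity is that of the
    -- semigroup at nonnegative times.
    have key : ∀ n : ℝ≥0, ∀ t : ℝ, -(n : ℝ) < t →
        T.unitaryGroup t x = T.unitaryPart (t + n).toNNReal (star (T.unitaryPart n) x) := by
      intro n t ht
      have : t = ((t + n).toNNReal : ℝ) - n := by
        rw [Real.coe_toNNReal _ (by linarith), add_sub_cancel_right]
      conv_lhs => rw [this, unitaryGroup_sub]
      rfl
    have hcont : ∀ n : ℝ≥0, Continuous fun t : ℝ =>
        T.unitaryPart (t + n).toNNReal (star (T.unitaryPart n) x) := fun n =>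
      Continuous.subtype_mk ((T.continuous_op _).comp
        (continuous_real_toNNReal.comp (continuous_id.add_const _))) _
    refine continuous_iff_continuousAt.2 fun t => ?_
    have hlt : -((1 + (-t).toNNReal : ℝ≥0) : ℝ) < t := by
      push_cast
      have := Real.le_coe_toNNReal (-t)
      linarith
    refine (hcont (1 + (-t).toNNReal)).continuousAt.congr ?_
    filter_upwards [isOpen_Ioi.mem_nhds hlt] with s hs
    exact (key _ s hs).symm

@[simp]
theorem toUnitaryGroup_op (t : ℝ) : T.toUnitaryGroup.op t = T.unitaryGroup t := rfl

/-- The inclusion of the unitary subspace passes through the Laplace integral, so the two resolvents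
agree there, and each transform is `1 - 2R`. -/
theorem unitaryCogenerator_eq_cayley : T.unitaryCogenerator = T.toUnitaryGroup.cayley := by
  ext x
  change T.cogenerator x = _
  have : (T.toUnitaryGroup.resolvent x : H) = T.laplace x := by
    rw [StronglyContinuousUnitaryGroup.resolvent, laplace_apply, laplace_apply,
      ← T.unitarySubspace.subtypeL_apply,
      ← ContinuousLinearMap.integral_comp_comm _ (T.toUnitaryGroup.forward.integrable_laplace x)]
    congr 1; ext t
    rw [ContinuousLinearMap.map_smul_of_tower]
    simp only [StronglyContinuousUnitaryGroup.forward, toUnitaryGroup_op, unitaryGroup_coe]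
    rfl
  rw [cogenerator_eq, StronglyContinuousUnitaryGroup.cayley, two_mul]
  simp [this, two_smul]

theorem unitaryProjection_eq_one : T.unitaryProjection = 1 := by
  ext x
  simp [unitaryProjection]

end C0ContractionSemigroup

/-! ### Spectral families of generators of unitary groups -/

/-- The function `a ↦ (1 - i a)⁻¹`, which takes the generator `A` to the resolvent `(1 - iA)⁻¹`. -/
def resolventFun (a : ℝ) : ℂ := (1 - a * Complex.I)⁻¹

theorem one_sub_mul_I_ne_zero (a : ℝ) : (1 - a * Complex.I : ℂ) ≠ 0 := fun h => by
  simpa using congrArg Complex.re h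

theorem norm_one_sub_mul_I_sq (a : ℝ) : ‖(1 - a * Complex.I : ℂ)‖ ^ 2 = 1 + a ^ 2 := by
  rw [← Complex.normSq_eq_norm_sq, Complex.normSq_apply]
  simp [sq]

theorem norm_resolventFun_sq (a : ℝ) : ‖resolventFun a‖ ^ 2 = (1 + a ^ 2)⁻¹ := by
  rw [resolventFun, norm_inv, inv_pow, norm_one_sub_mul_I_sq]

theorem continuous_resolventFun : Continuous resolventFun :=
  Continuous.inv₀ (by fun_prop) one_sub_mul_I_ne_zero

theorem isBoundedBorel_resolventFun : IsBoundedBorel resolventFun := by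
  refine ⟨continuous_resolventFun.measurable, 1, fun a => ?_⟩
  rw [← sq_le_one_iff₀ (norm_nonneg _), norm_resolventFun_sq]
  exact inv_le_one_of_one_le₀ (by nlinarith)

theorem mul_resolventFun (a : ℝ) : a * resolventFun a = -Complex.I * (resolventFun a - 1) := by
  rw [resolventFun]
  have := one_sub_mul_I_ne_zero a
  field_simp
  ring_nf
  simp

theorem isBoundedBorel_mul_resolventFun : IsBoundedBorel fun a => a * resolventFun a := by
  simp only [mul_resolventFun, sub_eq_add_neg]
  exact (IsBoundedBorel.const _).mul (isBoundedBorel_resolventFun.add (IsBoundedBorel.const _))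

/-- The function `a ↦ (a - i) / (a + i)`, which takes the generator to its Cayley transform. -/
def cayleyFun (a : ℝ) : ℂ := 1 - 2 * resolventFun a

theorem isBoundedBorel_cayleyFun : IsBoundedBorel cayleyFun := by
  have : cayleyFun = (fun _ => 1) + (-2 : ℂ) • resolventFun := by
    ext a; simp [cayleyFun, sub_eq_add_neg]
  rw [this]
  exact (IsBoundedBorel.const 1).add (isBoundedBorel_resolventFun.smul _)

namespace SpectralFamily

variable {K : Type*} [NormedAddCommGroup K] [InnerProductSpace ℂ K] [CompleteSpace K]
  (E : SpectralFamily K)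

/-- The measure of `∫ resolventFun dE y` has density `1/(1 + a²)`, so the integrand becomes `a²/(1 +
a²) ≤ 1`. -/
theorem integrable_sq_measure_resolventFun (y : K) :
    Integrable (fun a : ℝ => a ^ 2) (E.measure (E.calculus resolventFun y)) := by
  rw [E.measure_calculus isBoundedBorel_resolventFun,
    integrable_withDensity_iff_integrable_smul' (by
      exact (continuous_resolventFun.norm.pow 2).measurable.ennreal_ofReal) (by simp)]
  refine Integrable.of_bound ?_ 1 (.of_forall fun a => ?_)
  · exact ((continuous_resolventFun.norm.pow 2).measurable.ennreal_ofReal.ennreal_toReal.smul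
      (measurable_id.pow_const 2)).aestronglyMeasurable
  · rw [ENNReal.toReal_ofReal (sq_nonneg _), norm_resolventFun_sq, smul_eq_mul,
      Real.norm_of_nonneg (by positivity), inv_mul_le_one₀ (by positivity)]
    linarith

theorem integral_measure_resolventFun (y : K) :
    ((∫ a, a ∂(E.measure (E.calculus resolventFun y)) : ℝ) : ℂ)
      = ⟪E.calculus resolventFun y, E.calculus (fun a => a * resolventFun a) y⟫_ℂ := by
  rw [E.inner_calculus_calculus isBoundedBorel_resolventFun isBoundedBorel_mul_resolventFun,
    E.measure_calculus isBoundedBorel_resolventFun, integral_withDensity_eq_integral_toReal_smul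
      (by exact (continuous_resolventFun.norm.pow 2).measurable.ennreal_ofReal) (by simp),
    ← integral_complex_ofReal]
  congr 1; ext a
  rw [ENNReal.toReal_ofReal (sq_nonneg _), Complex.star_def, mul_left_comm, Complex.conj_mul',
    smul_eq_mul]
  push_cast
  ring

theorem calculus_eq_zero_of_ne_zero {u : ℝ → ℂ} (hu : IsBoundedBorel u) (h : ∀ a, u a ≠ 0) {y : K}
    (hy : E.calculus u y = 0) : y = 0 := by
  have h1 := E.measure_univ (E.calculus u y)
  rw [hy, norm_zero, zero_pow two_ne_zero, ENNReal.ofReal_zero, ← hy, E.measure_calculus hu,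
    withDensity_apply _ .univ, Measure.restrict_univ,
    lintegral_eq_zero_iff (hu.measurable.norm.pow_const 2).ennreal_ofReal] at h1
  have h2 : E.measure y univ = 0 := by
    rw [Filter.EventuallyEq, ae_iff] at h1
    convert h1
    symm
    rw [eq_univ_iff_forall]
    intro a
    simpa using h a
  rw [measure_univ, ENNReal.ofReal_eq_zero] at h2
  exact norm_eq_zero.1 (pow_eq_zero_iff two_ne_zero |>.1 (le_antisymm h2 (sq_nonneg _)))

theorem calculus_mul_resolventFun :
    E.calculus (fun a => a * resolventFun a)
      = (-Complex.I) • (E.calculus resolventFun - 1) := by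
  have : (fun a : ℝ => a * resolventFun a)
      = (-Complex.I) • (resolventFun + (-1 : ℂ) • 1) := by
    ext a
    rw [mul_resolventFun]
    simp [sub_eq_add_neg]
  have h1 : IsBoundedBorel (1 : ℝ → ℂ) := IsBoundedBorel.const 1
  rw [this, E.calculus_smul (isBoundedBorel_resolventFun.add (h1.smul _)),
    E.calculus_add isBoundedBorel_resolventFun (h1.smul _), E.calculus_smul h1, calculus_one,
    neg_one_smul, sub_eq_add_neg]

theorem calculus_cayleyFun : E.calculus cayleyFun = 1 - 2 * E.calculus resolventFun := by
  have : cayleyFun = 1 + (-2 : ℂ) • resolventFun := by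
    ext a; simp [cayleyFun, sub_eq_add_neg]
  have h1 : IsBoundedBorel (1 : ℝ → ℂ) := IsBoundedBorel.const 1
  rw [this, E.calculus_add h1 (isBoundedBorel_resolventFun.smul _),
    E.calculus_smul isBoundedBorel_resolventFun, calculus_one, neg_smul, two_smul, two_mul,
    sub_eq_add_neg]

/-- If `a²` is integrable for the measure of `x`, then `x` is in the range of `∫ (1 - ia)⁻¹ dE`. -/
theorem exists_calculus_resolventFun_eq {x : K}
    (hx : Integrable (fun a : ℝ => a ^ 2) (E.measure x)) :
    ∃ y, E.calculus resolventFun y = x := by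
  -- Truncations of `1 - ia`, the reciprocal of `resolventFun`. The preimage `y` is the limit of `∫
  -- v n dE x`.
  let v : ℕ → ℝ → ℂ := fun n => (Icc (-n : ℝ) n).indicator fun a => 1 - a * Complex.I
  have hv : ∀ n, IsBoundedBorel (v n) := by
    intro n
    have hc : Continuous fun a : ℝ => (1 - a * Complex.I : ℂ) := by fun_prop
    obtain ⟨C, hC⟩ := isCompact_Icc.exists_bound_of_continuousOn
      (hc.continuousOn (s := Icc (-n : ℝ) n))
    refine ⟨hc.measurable.indicator measurableSet_Icc, max C 0, fun a => ?_⟩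
    by_cases ha : a ∈ Icc (-n : ℝ) n
    · simp only [v, indicator_of_mem ha]
      exact (hC a ha).trans (le_max_left _ _)
    · simp [v, indicator_of_notMem ha]
  -- The tail of `∫ |1 - ia|²` bounds both the Cauchy differences and the error of the approximate
  -- inverse.
  let ε : ℕ → ℝ := fun n => ∫ a, (Icc (-n : ℝ) n)ᶜ.indicator (fun a => 1 + a ^ 2) a ∂(E.measure x)
  have hi : Integrable (fun a : ℝ => 1 + a ^ 2) (E.measure x) := (integrable_const 1).add hx
  have hε : Tendsto ε atTop (𝓝 0) := by
    rw [← integral_zero ℝ ℝ (μ := E.measure x)]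
    refine tendsto_integral_of_dominated_convergence (fun a => 1 + a ^ 2)
      (fun n => (hi.indicator measurableSet_Icc.compl).aestronglyMeasurable) hi
      (fun n => .of_forall fun a => ?_) (.of_forall fun a => ?_)
    · refine (norm_indicator_le_norm_self _ _).trans (le_of_eq ?_)
      exact Real.norm_of_nonneg (by positivity)
    · refine tendsto_const_nhds.congr' ?_
      filter_upwards [eventually_ge_atTop ⌈|a|⌉₊] with n hn
      have : |a| ≤ n := (Nat.le_ceil _).trans (by exact_mod_cast hn)
      rw [indicator_of_notMem]
      simpa using abs_le.1 this
  have hdiff : ∀ n m, n ≤ m →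
      ‖E.calculus (v n) x - E.calculus (v m) x‖ ^ 2 ≤ ε n := by
    intro n m hnm
    have e : E.calculus (v n) x - E.calculus (v m) x = E.calculus (v n + (-1 : ℂ) • v m) x := by
      rw [E.calculus_add (hv n) ((hv m).smul _), E.calculus_smul (hv m)]
      simp [sub_eq_add_neg]
    rw [e, E.norm_calculus_sq ((hv n).add ((hv m).smul _))]
    refine integral_mono_of_nonneg (.of_forall fun a => sq_nonneg _)
      (hi.indicator measurableSet_Icc.compl) (.of_forall fun a => ?_)
    have hnm' : (n : ℝ) ≤ m := by exact_mod_cast hnm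
    simp only [v, Pi.add_apply, neg_smul, one_smul, Pi.neg_apply, ← sub_eq_add_neg]
    by_cases ha : a ∈ Icc (-n : ℝ) n
    · have ha' : a ∈ Icc (-m : ℝ) m := ⟨by linarith [ha.1], by linarith [ha.2]⟩
      rw [indicator_of_mem ha, indicator_of_mem ha', indicator_of_notMem (by simpa using ha)]
      simp
    · rw [indicator_of_notMem ha, indicator_of_mem (show a ∈ (Icc (-n : ℝ) n)ᶜ from ha), zero_sub,
        norm_neg, ← norm_one_sub_mul_I_sq]
      exact pow_le_pow_left₀ (norm_nonneg _) (norm_indicator_le_norm_self _ _) 2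
  have hsq : Tendsto (fun n => √(ε n)) atTop (𝓝 0) := by
    have := (Real.continuous_sqrt.tendsto 0).comp hε
    rwa [Real.sqrt_zero] at this
  have hcau : CauchySeq fun n => E.calculus (v n) x := by
    refine cauchySeq_of_le_tendsto_0' (fun n => √(ε n)) (fun n m hnm => ?_) hsq
    rw [dist_eq_norm]
    exact Real.le_sqrt_of_sq_le (hdiff n m hnm)
  obtain ⟨y, hy⟩ := cauchySeq_tendsto_of_complete hcau
  refine ⟨y, tendsto_nhds_unique ((E.calculus resolventFun).continuous.tendsto y |>.comp hy) ?_⟩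
  rw [tendsto_iff_norm_sub_tendsto_zero]
  refine squeeze_zero (fun n => norm_nonneg _) (fun n => Real.le_sqrt_of_sq_le ?_) hsq
  have h1 : IsBoundedBorel (1 : ℝ → ℂ) := IsBoundedBorel.const 1
  have e : E.calculus resolventFun (E.calculus (v n) x) - x
      = E.calculus (resolventFun * v n + (-1 : ℂ) • 1) x := by
    rw [E.calculus_add (isBoundedBorel_resolventFun.mul (hv n)) (h1.smul _),
      E.calculus_mul isBoundedBorel_resolventFun (hv n), E.calculus_smul h1, calculus_one]
    simp [sub_eq_add_neg]
  rw [Function.comp_apply, e,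
    E.norm_calculus_sq ((isBoundedBorel_resolventFun.mul (hv n)).add (h1.smul _))]
  refine integral_mono_of_nonneg (.of_forall fun a => sq_nonneg _)
    (hi.indicator measurableSet_Icc.compl) (.of_forall fun a => ?_)
  simp only [v, Pi.add_apply, Pi.mul_apply, neg_smul, one_smul]
  by_cases ha : a ∈ Icc (-n : ℝ) n
  · rw [indicator_of_mem ha, indicator_of_notMem (by simpa using ha), resolventFun,
      inv_mul_cancel₀ (one_sub_mul_I_ne_zero a)]
    simp
  · rw [indicator_of_notMem ha, indicator_of_mem (show a ∈ (Icc (-n : ℝ) n)ᶜ from ha)]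
    simp
    positivity

/-- A spectral family belongs to the self-adjoint generator of a unitary group if and only if it
represents the Cayley transform. -/
theorem isSpectralFamilyOfSelfAdjoint_iff (W : StronglyContinuousUnitaryGroup K) :
    E.IsSpectralFamilyOfSelfAdjoint ((-Complex.I) • derivAtZero W.op (𝓝[≠] 0)) ↔
      E.IsOperatorIntegral cayleyFun W.cayley := by
  set A := (-Complex.I) • derivAtZero W.op (𝓝[≠] 0) with hA
  have hdom : ∀ {x}, x ∈ A.domain ↔ ∃ y, W.resolvent y = x := W.mem_domain_iff
  have hval : ∀ (x : A.domain) {y}, W.resolvent y = x → A x = (-Complex.I) • ((x : K) - y) := by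
    intro x y h
    rw [← h]
    exact congrArg (fun z => (-Complex.I) • z) (W.derivAtZero_resolvent x h)
  have hcay : E.IsOperatorIntegral cayleyFun W.cayley ↔ E.calculus resolventFun = W.resolvent := by
    constructor
    · intro h
      have := h.calculus_eq
      rw [calculus_cayleyFun, StronglyContinuousUnitaryGroup.cayley, sub_right_inj, two_mul,
        two_mul, ← two_smul ℂ, ← two_smul ℂ] at this
      exact smul_right_injective _ (two_ne_zero (α := ℂ)) this
    · intro h
      rw [StronglyContinuousUnitaryGroup.cayley, ← h, ← calculus_cayleyFun]
      exact E.isOperatorIntegral_calculus isBoundedBorel_cayleyFun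
  rw [hcay]
  set S := E.calculus resolventFun with hS
  constructor
  · rintro ⟨h1, h2⟩
    have hmem : ∀ y, S y ∈ A.domain := fun y =>
      (h1 _).2 (E.integrable_sq_measure_resolventFun y)
    -- `L = A S` is not known to be bounded; it is to be compared with `∫ a (1 - ia)⁻¹ dE`.
    let L : K →ₗ[ℂ] K := A.toFun ∘ₗ S.toLinearMap.codRestrict A.domain hmem
    have hL : ∀ y, L y = A ⟨S y, hmem y⟩ := fun y => rfl
    have hLQ : ∀ y, L y = E.calculus (fun a => a * resolventFun a) y := by
      -- The hypothesis on `A` yields only the quadratic form at vectors `S y`, that is, the form of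
      -- `S* L`. Over `ℂ` a vanishing form forces `X = 0`, and `S*` is injective because its symbol
      -- has no zero.
      let X : K →ₗ[ℂ] K :=
        (star S).toLinearMap ∘ₗ (L - (E.calculus fun a => a * resolventFun a).toLinearMap)
      have hXa : ∀ y, X y = star S (L y - E.calculus (fun a => a * resolventFun a) y) :=
        fun y => rfl
      have hX : X = 0 := by
        refine (inner_map_self_eq_zero X).1 fun y => ?_
        rw [hXa, ContinuousLinearMap.star_eq_adjoint, ContinuousLinearMap.adjoint_inner_left,
          inner_sub_left, ← inner_conj_symm, ← inner_conj_symm _ (S y), hL, h2 ⟨S y, hmem y⟩,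
          E.integral_measure_resolventFun, sub_self]
      intro y
      have hy := congr($hX y)
      rw [hXa, hS, ← E.calculus_star isBoundedBorel_resolventFun, LinearMap.zero_apply] at hy
      refine sub_eq_zero.1 (E.calculus_eq_zero_of_ne_zero isBoundedBorel_resolventFun.star
        (fun a => ?_) hy)
      exact star_ne_zero.2 (inv_ne_zero (one_sub_mul_I_ne_zero a))
    ext y
    -- Writing `S y = R z`, the two expressions for `A (S y)` are `-i (S y - z)` and `-i (S y - y)`;
    -- hence `z = y`.
    obtain ⟨z, hz⟩ := hdom.1 (hmem y)
    have e := hLQ y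
    rw [hL, hval ⟨S y, hmem y⟩ hz, calculus_mul_resolventFun, smul_apply] at e
    have e2 := smul_right_injective _ (neg_ne_zero.2 Complex.I_ne_zero) e
    rw [sub_apply, ← hS, one_apply_eq_self, sub_right_inj] at e2
    rw [← hz, e2]
  · intro h
    refine ⟨fun x => ?_, fun x => ?_⟩
    · rw [hdom, ← h]
      refine ⟨?_, E.exists_calculus_resolventFun_eq⟩
      rintro ⟨y, rfl⟩
      exact E.integrable_sq_measure_resolventFun y
    · obtain ⟨y, hy⟩ := hdom.1 x.2
      rw [hval x hy, ← hy, ← h, hS, E.integral_measure_resolventFun, calculus_mul_resolventFun]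
      rfl

end SpectralFamily

namespace SpectralFamily

variable {K : Type*} [NormedAddCommGroup K] [InnerProductSpace ℂ K] [CompleteSpace K]

/-! ### Spectral families from families of measures, and their images -/

/-- The spectral family formed by an increasing family of projections whose quadratic forms are the
distribution functions of finite measures. -/
def ofMeasure (P : ℝ → K →L[ℂ] K) (hP : ∀ a, IsStarProjection (P a))
    (mono : ∀ a b, a ≤ b → P a * P b = P a) (m : K → Measure ℝ) [∀ x, IsFiniteMeasure (m x)]
    (hm : ∀ a x, ‖P a x‖ ^ 2 = (m x).real (Iic a)) (huniv : ∀ x, (m x).real univ = ‖x‖ ^ 2) :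
    SpectralFamily K where
  proj := P
  isStarProjection := hP
  mono := mono
  right_continuous a x := by
    rw [tendsto_iff_norm_sub_tendsto_zero]
    have h := tendsto_measure_biInter_gt (μ := m x) (s := fun b : ℝ => Iic b) (a := a)
      (fun r _ => measurableSet_Iic.nullMeasurableSet) (fun i j _ hij => Iic_subset_Iic.2 hij)
      ⟨a + 1, by simp, measure_ne_top _ _⟩
    have e : ⋂ r, ⋂ (_ : r > a), Iic r = Iic a := by
      ext b
      simp only [mem_iInter, mem_Iic]
      exact ⟨fun h => le_of_forall_gt_imp_ge_of_dense h, fun h r hr => h.trans hr.le⟩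
    rw [e] at h
    have h2 : Tendsto (fun b => ‖P b x‖ ^ 2 - ‖P a x‖ ^ 2) (𝓝[>] a) (𝓝 0) := by
      have := ((ENNReal.tendsto_toReal (measure_ne_top _ _)).comp h).sub_const (‖P a x‖ ^ 2)
      rw [hm a x, measureReal_def, sub_self] at this
      refine this.congr fun b => ?_
      rw [hm b x, hm a x]; rfl
    have h3 := (Real.continuous_sqrt.tendsto 0).comp h2
    rw [Real.sqrt_zero] at h3
    refine h3.congr' ?_
    filter_upwards [self_mem_nhdsWithin] with b hb
    rw [Function.comp_apply, ← (hP a).norm_sub_sq (hP b) (mono a b (le_of_lt hb)),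
      Real.sqrt_sq (norm_nonneg _)]
  tendsto_atBot x := by
    rw [tendsto_zero_iff_norm_tendsto_zero]
    have h0 : Tendsto (fun b : ℝ => m x (Iic b)) atBot (𝓝 0) := by
      have := tendsto_measure_iInter_atBot (μ := m x) (s := fun b : ℝ => Iic b)
        (fun r => measurableSet_Iic.nullMeasurableSet) monotone_Iic ⟨0, measure_ne_top _ _⟩
      rwa [iInter_Iic_eq_empty_iff.2 (by simp [not_bddBelow_univ]), measure_empty] at this
    have h := (ENNReal.tendsto_toReal ENNReal.zero_ne_top).comp h0
    have h3 := (Real.continuous_sqrt.tendsto _).comp h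
    rw [ENNReal.toReal_zero, Real.sqrt_zero] at h3
    refine h3.congr fun b => ?_
    change √((m x).real (Iic b)) = _
    rw [← hm, Real.sqrt_sq (norm_nonneg _)]
  tendsto_atTop x := by
    rw [tendsto_iff_norm_sub_tendsto_zero]
    have h := (ENNReal.tendsto_toReal (measure_ne_top _ _)).comp (tendsto_measure_Iic_atTop (m x))
    have h2 : Tendsto (fun b => ‖x‖ ^ 2 - ‖P b x‖ ^ 2) atTop (𝓝 0) := by
      have := h.const_sub (‖x‖ ^ 2)
      rw [← measureReal_def, huniv, sub_self] at this
      refine this.congr fun b => ?_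
      rw [hm b x]; rfl
    have h3 := (Real.continuous_sqrt.tendsto 0).comp h2
    rw [Real.sqrt_zero] at h3
    refine h3.congr fun b => ?_
    have := (hP b).norm_sub_sq (.one _) (mul_one _) x
    rw [one_apply_eq_self] at this
    rw [Function.comp_apply, ← this, Real.sqrt_sq (norm_nonneg _), norm_sub_rev]

variable (E : SpectralFamily K)

theorem isStarProjection_calculus_indicator {s : Set ℝ} (hs : MeasurableSet s) :
    IsStarProjection (E.calculus (s.indicator 1)) := by
  have hb : IsBoundedBorel (s.indicator (1 : ℝ → ℂ)) := IsBoundedBorel.indicator_one hs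
  constructor
  · rw [IsIdempotentElem, ← E.calculus_mul hb hb]
    congr 1; ext a; by_cases ha : a ∈ s <;> simp [ha]
  · rw [IsSelfAdjoint, ← E.calculus_star hb]
    congr 1; ext a; by_cases ha : a ∈ s <;> simp [ha]

theorem norm_calculus_indicator_sq {s : Set ℝ} (hs : MeasurableSet s) (x : K) :
    ‖E.calculus (s.indicator 1) x‖ ^ 2 = (E.measure x).real s := by
  rw [E.norm_calculus_sq (IsBoundedBorel.indicator_one hs), ← integral_indicator_one hs]
  congr 1; ext a; by_cases ha : a ∈ s <;> simp [ha]

/-- The image of a spectral family under a Borel function. -/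
def map (g : ℝ → ℝ) (hg : Measurable g) : SpectralFamily K :=
  ofMeasure (fun t => E.calculus ((g ⁻¹' Iic t).indicator 1))
    (fun t => E.isStarProjection_calculus_indicator (hg measurableSet_Iic))
    (fun s t hst => by
      rw [← E.calculus_mul (IsBoundedBorel.indicator_one (hg measurableSet_Iic))
        (IsBoundedBorel.indicator_one (hg measurableSet_Iic))]
      congr 1; ext a
      by_cases ha : g a ≤ s
      · simp [ha, ha.trans hst]
      · simp [ha])
    (fun x => (E.measure x).map g)
    (fun t x => by
      rw [E.norm_calculus_indicator_sq (hg measurableSet_Iic),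
        map_measureReal_apply hg measurableSet_Iic])
    (fun x => by rw [map_measureReal_apply hg .univ, preimage_univ, measureReal_univ])

variable {g : ℝ → ℝ} (hg : Measurable g)

theorem map_proj (t : ℝ) : (E.map g hg).proj t = E.calculus ((g ⁻¹' Iic t).indicator 1) := rfl

theorem measure_map (x : K) : (E.map g hg).measure x = (E.measure x).map g :=
  measure_eq _ _ fun t => by
    rw [map_proj, E.norm_calculus_indicator_sq (hg measurableSet_Iic),
      map_measureReal_apply hg measurableSet_Iic]

theorem isOperatorIntegral_map {u : ℝ → ℂ} (hu : Measurable u) {B : K →L[ℂ] K} :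
    (E.map g hg).IsOperatorIntegral u B ↔ E.IsOperatorIntegral (u ∘ g) B := by
  refine forall_congr' fun x => ?_
  rw [measure_map, integral_map hg.aemeasurable hu.aestronglyMeasurable]
  rfl

theorem essBounded_map {u : ℝ → ℂ} (hu : Measurable u) :
    (E.map g hg).EssBounded u ↔ E.EssBounded (u ∘ g) := by
  refine exists_congr fun c => forall_congr' fun x => ?_
  rw [measure_map, ae_map_iff hg.aemeasurable (measurableSet_le hu.norm measurable_const)]
  rfl

/-! ### From the line to the circle -/

/-- The parameter `1/2 + arctan a / π` in `(0, 1)` of a point of the line. -/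
def angle (a : ℝ) : ℝ := 1 / 2 + Real.arctan a / Real.pi

theorem strictMono_angle : StrictMono angle := fun a b hab => by
  unfold angle
  gcongr

theorem continuous_angle : Continuous angle := by
  unfold angle; fun_prop

theorem measurable_angle : Measurable angle := continuous_angle.measurable

theorem angle_pos (a : ℝ) : 0 < angle a := by
  have := Real.neg_pi_div_two_lt_arctan a
  have hp := Real.pi_pos
  have : -(1 / 2) < Real.arctan a / Real.pi := by
    rw [lt_div_iff₀ hp]; linarith
  unfold angle; linarith

theorem angle_lt_one (a : ℝ) : angle a < 1 := by
  have := Real.arctan_lt_pi_div_two a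
  have hp := Real.pi_pos
  have : Real.arctan a / Real.pi < 1 / 2 := by
    rw [div_lt_iff₀ hp]; linarith
  unfold angle; linarith

theorem angle_tan {θ : ℝ} (h0 : 0 < θ) (h1 : θ < 1) :
    angle (Real.tan (Real.pi * (θ - 1 / 2))) = θ := by
  have hp := Real.pi_pos
  rw [angle, Real.arctan_tan (by nlinarith) (by nlinarith), mul_div_cancel_left₀ _ hp.ne']
  ring

theorem continuous_circlePoint : Continuous circlePoint := by
  unfold circlePoint; fun_prop

/-- As `2π θ(a) = π + 2 arctan a`, the left side is `-(exp (i arctan a))² = -(1 + ia)²/(1 + a²) =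
-(1 + ia)/(1 - ia)`. -/
theorem circlePoint_angle (a : ℝ) : circlePoint (angle a) = cayleyFun a := by
  have hp : (Real.pi : ℂ) ≠ 0 := by exact_mod_cast Real.pi_ne_zero
  have h1 : circlePoint (angle a) = -(Complex.exp (Real.arctan a * Complex.I)) ^ 2 := by
    have e : 2 * Real.pi * Complex.I * (angle a : ℂ)
        = Real.pi * Complex.I + (2 : ℕ) * (Real.arctan a * Complex.I) := by
      rw [angle]; push_cast; field_simp
    rw [circlePoint, e, Complex.exp_add, Complex.exp_pi_mul_I, Complex.exp_nat_mul]
    ring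
  have hs : (√(1 + a ^ 2) : ℝ) ≠ 0 := (Real.sqrt_pos.2 (by positivity)).ne'
  have hs2 : (((√(1 + a ^ 2) : ℝ) : ℂ)) ^ 2 = 1 + (a : ℂ) ^ 2 := by
    rw [← Complex.ofReal_pow, Real.sq_sqrt (by positivity)]; push_cast; ring
  have h2 : Complex.exp (Real.arctan a * Complex.I)
      = (1 + a * Complex.I) / ((√(1 + a ^ 2) : ℝ) : ℂ) := by
    rw [Complex.exp_mul_I, ← Complex.ofReal_cos, ← Complex.ofReal_sin, Real.cos_arctan,
      Real.sin_arctan]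
    push_cast
    ring
  have hne := one_sub_mul_I_ne_zero a
  have hne2 : (1 + (a : ℂ) ^ 2) ≠ 0 := by
    rw [← hs2]; exact pow_ne_zero 2 (by exact_mod_cast hs)
  rw [h1, h2, div_pow, hs2, cayleyFun, resolventFun]
  field_simp
  ring_nf
  simp only [Complex.I_sq, Complex.I_pow_three]
  ring

/-- The spectral family on `[0, 1)` that corresponds to a spectral family on the line. -/
def toCircle : SpectralFamily K := E.map angle measurable_angle

theorem toCircle_proj_angle (a : ℝ) : E.toCircle.proj (angle a) = E.proj a := by
  have : angle ⁻¹' Iic (angle a) = Iic a := by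
    ext b; exact strictMono_angle.le_iff_le
  rw [toCircle, map_proj, this, calculus_indicator_one]

/-- Transfers uniqueness from the circle, where it is easier, to the line. -/
theorem toCircle_injective : Function.Injective (toCircle (K := K)) := fun E E' h =>
  ext_of_norm fun a x => by rw [← toCircle_proj_angle, h, toCircle_proj_angle]

theorem calculus_zero : E.calculus 0 = 0 :=
  IsOperatorIntegral.calculus_eq (fun x => by simp)

theorem toCircle_proj_of_nonpos {θ : ℝ} (h : θ ≤ 0) : E.toCircle.proj θ = 0 := by
  have : angle ⁻¹' Iic θ = ∅ := by
    ext a; simpa using h.trans_lt (angle_pos a)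
  rw [toCircle, map_proj, this, indicator_empty]
  exact E.calculus_zero

theorem toCircle_tendsto (x : K) : Tendsto (fun θ => E.toCircle.proj θ x) (𝓝[<] 1) (𝓝 x) := by
  have h : Tendsto (fun θ => Real.tan (Real.pi * (θ - 1 / 2))) (𝓝[<] (1 : ℝ)) atTop := by
    refine Real.tendsto_tan_pi_div_two.comp (tendsto_nhdsWithin_iff.2 ⟨?_, ?_⟩)
    · have hc : Continuous fun θ : ℝ => Real.pi * (θ - 1 / 2) := by fun_prop
      have := (hc.tendsto 1).mono_left (nhdsWithin_le_nhds (s := Iio 1))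
      convert this using 2
      ring
    · filter_upwards [self_mem_nhdsWithin] with θ hθ
      have : θ < 1 := hθ
      have hp := Real.pi_pos
      change Real.pi * (θ - 1 / 2) < Real.pi / 2
      nlinarith
  refine ((E.tendsto_atTop x).comp h).congr' ?_
  filter_upwards [Ioo_mem_nhdsLT (zero_lt_one' ℝ)] with θ hθ
  rw [Function.comp_apply, ← toCircle_proj_angle, angle_tan hθ.1 hθ.2]

theorem isSpectralFamilyOfUnitary_toCircle {U : K →L[ℂ] K} (h : E.IsOperatorIntegral cayleyFun U) :
    E.toCircle.IsSpectralFamilyOfUnitary U := by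
  refine ⟨fun θ hθ => E.toCircle_proj_of_nonpos hθ.le, E.toCircle_tendsto, ?_⟩
  rw [toCircle, isOperatorIntegral_map _ _ continuous_circlePoint.measurable]
  have : circlePoint ∘ angle = cayleyFun := funext circlePoint_angle
  rwa [this]

/-- The inverse of the Cayley transform of the line. -/
def cayleyInv (z : ℂ) : ℝ := (Complex.I * (1 + z) / (1 - z)).re

theorem measurable_cayleyInv : Measurable cayleyInv :=
  Complex.measurable_re.comp (by fun_prop)

theorem cayleyInv_cayleyFun (a : ℝ) : cayleyInv (cayleyFun a) = a := by
  have hr : resolventFun a * (1 - a * Complex.I) = 1 := inv_mul_cancel₀ (one_sub_mul_I_ne_zero a)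
  have this : Complex.I * (1 + cayleyFun a) / (1 - cayleyFun a) = a := by
    have h0 : (1 - cayleyFun a) ≠ 0 := by
      rw [cayleyFun, sub_sub_cancel]
      exact mul_ne_zero two_ne_zero (left_ne_zero_of_mul_eq_one hr)
    rw [div_eq_iff h0, cayleyFun]
    linear_combination (-2 * Complex.I) * hr - 2 * resolventFun a * a * Complex.I_sq
  rw [cayleyInv, this, Complex.ofReal_re]

/-- Symbols correspond by `w ↦ w ∘ cayleyFun` and `u ↦ u ∘ cayleyInv`. The default value of
`cayleyInv` at `1` is harmless, since `cayleyFun` omits that point. -/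
theorem circleCalculus_toCircle : E.toCircle.circleCalculus = E.lineCalculus := by
  have hc : ∀ w : ℂ → ℂ, (fun θ => w (circlePoint θ)) ∘ angle = w ∘ cayleyFun := fun w =>
    funext fun a => congrArg w (circlePoint_angle a)
  ext B
  constructor
  · rintro ⟨w, hw, hb, hB⟩
    have hm : Measurable fun θ => w (circlePoint θ) := hw.comp continuous_circlePoint.measurable
    refine ⟨w ∘ cayleyFun, hw.comp isBoundedBorel_cayleyFun.measurable, ?_, ?_⟩
    · rw [← hc]; exact (E.essBounded_map _ hm).1 hb
    · rw [← hc]; exact (E.isOperatorIntegral_map _ hm).1 hB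
  · rintro ⟨u, hu, hb, hB⟩
    have hw := hu.comp measurable_cayleyInv
    have hm : Measurable fun θ => (u ∘ cayleyInv) (circlePoint θ) :=
      hw.comp continuous_circlePoint.measurable
    have e : (u ∘ cayleyInv) ∘ cayleyFun = u := funext fun a => congrArg u (cayleyInv_cayleyFun a)
    refine ⟨u ∘ cayleyInv, hw, (E.essBounded_map _ hm).2 ?_, (E.isOperatorIntegral_map _ hm).2 ?_⟩
    · rwa [hc, e]
    · rwa [hc, e]

end SpectralFamily

namespace SpectralFamily

variable {K : Type*} [NormedAddCommGroup K] [InnerProductSpace ℂ K] [CompleteSpace K]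

/-! ### Uniqueness of the spectral family of a unitary operator -/

theorem norm_circlePoint (θ : ℝ) : ‖circlePoint θ‖ = 1 := by
  have : 2 * Real.pi * Complex.I * (θ : ℂ) = ((2 * Real.pi * θ : ℝ) : ℂ) * Complex.I := by
    push_cast; ring
  rw [circlePoint, this, Complex.norm_exp_ofReal_mul_I]

/-- The parametrization of the unit circle. -/
def sphereParam (θ : ℝ) : Metric.sphere (0 : ℂ) 1 :=
  ⟨circlePoint θ, by rw [mem_sphere_zero_iff_norm, norm_circlePoint]⟩

theorem continuous_sphereParam : Continuous sphereParam :=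
  continuous_circlePoint.subtype_mk _

/-- The parameter in `[0, 1)` of a point of the unit circle. -/
def circleParam (z : Metric.sphere (0 : ℂ) 1) : ℝ :=
  -- `arg` takes values in `(-π, π]`; conjugation and the change of sign turn this half-open
  -- interval into `[0, 1)` with the correct endpoint.
  (Real.pi - Complex.arg (-(starRingEnd ℂ) z)) / (2 * Real.pi)

theorem measurable_circleParam : Measurable circleParam := by
  have : Continuous fun z : Metric.sphere (0 : ℂ) 1 => -(starRingEnd ℂ) (z : ℂ) := by fun_prop
  exact ((Complex.measurable_arg.comp this.measurable).const_sub _).div_const _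

theorem circleParam_sphereParam {θ : ℝ} (h0 : 0 ≤ θ) (h1 : θ < 1) :
    circleParam (sphereParam θ) = θ := by
  have hp := Real.pi_pos
  have e : -(starRingEnd ℂ) (circlePoint θ)
      = Complex.exp (((Real.pi - 2 * Real.pi * θ : ℝ) : ℂ) * Complex.I) := by
    rw [circlePoint, ← Complex.exp_conj]
    have : ((Real.pi - 2 * Real.pi * θ : ℝ) : ℂ) * Complex.I
        = Real.pi * Complex.I + (starRingEnd ℂ) (2 * Real.pi * Complex.I * θ) := by
      simp only [map_mul, Complex.conj_I, Complex.conj_ofReal, map_ofNat]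
      push_cast; ring
    rw [this, Complex.exp_add, Complex.exp_pi_mul_I]
    ring
  rw [circleParam]
  change (Real.pi - Complex.arg (-(starRingEnd ℂ) (circlePoint θ))) / _ = θ
  rw [e, Complex.arg_exp_mul_I, (toIocMod_eq_self _).2 ⟨by nlinarith, by nlinarith⟩]
  field_simp
  ring

/-- The normalization that makes uniqueness possible: on `[0, 1)` the map `circlePoint` is
injective. -/
theorem IsSpectralFamilyOfUnitary.ae_mem_Ico {F : SpectralFamily K} {U : K →L[ℂ] K}
    (hF : F.IsSpectralFamilyOfUnitary U) (x : K) : ∀ᵐ θ ∂(F.measure x), θ ∈ Ico (0 : ℝ) 1 := by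
  have h0 : F.measure x (Iio 0) = 0 := by
    have hU : Iio (0 : ℝ) = ⋃ n : ℕ, Iic (-(1 / ((n : ℝ) + 1))) := by
      ext a
      simp only [mem_Iio, mem_iUnion, mem_Iic]
      constructor
      · intro h
        obtain ⟨n, hn⟩ := exists_nat_one_div_lt (neg_pos.2 h)
        exact ⟨n, by linarith⟩
      · rintro ⟨n, hn⟩
        have : 0 < 1 / ((n : ℝ) + 1) := by positivity
        linarith
    rw [hU, measure_iUnion_null_iff]
    intro n
    have : 0 < 1 / ((n : ℝ) + 1) := by positivity
    rw [measure_Iic, hF.1 _ (by linarith)]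
    simp
  have h1 : F.measure x (Ici 1) = 0 := by
    have hle : ∀ θ < 1, (F.measure x).real (Ici 1) ≤ ‖x‖ ^ 2 - ‖F.proj θ x‖ ^ 2 := by
      intro θ hθ
      rw [← measureReal_univ, ← measureReal_Iic, ← measureReal_compl measurableSet_Iic]
      exact measureReal_mono fun a ha hb => absurd (ha.out.trans hb.out) (not_le.2 hθ)
    have hlim : Tendsto (fun θ => ‖x‖ ^ 2 - ‖F.proj θ x‖ ^ 2) (𝓝[<] 1) (𝓝 (‖x‖ ^ 2 - ‖x‖ ^ 2)) :=
      ((hF.2.1 x).norm.pow 2).const_sub _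
    rw [sub_self] at hlim
    have h := ge_of_tendsto hlim (by
      filter_upwards [self_mem_nhdsWithin] with θ hθ using hle θ hθ)
    have h2 := le_antisymm h measureReal_nonneg
    rwa [measureReal_eq_zero_iff] at h2
  rw [ae_iff]
  refine measure_mono_null (t := Iio 0 ∪ Ici 1) (fun a ha => ?_) (measure_union_null h0 h1)
  by_contra h
  simp only [mem_union, mem_Iio, mem_Ici, not_or, not_lt, not_le] at h
  exact ha h

/-- The coordinate function of the unit circle. -/
def sphereCoord : BoundedContinuousFunction (Metric.sphere (0 : ℂ) 1) ℂ :=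
  .mkOfCompact ⟨Subtype.val, continuous_subtype_val⟩

theorem isBoundedBorel_comp_sphereParam
    (g : BoundedContinuousFunction (Metric.sphere (0 : ℂ) 1) ℂ) :
    IsBoundedBorel fun θ => g (sphereParam θ) :=
  ⟨(g.continuous.comp continuous_sphereParam).measurable, ‖g‖, fun _ => g.norm_coe_le_norm _⟩

/-- For a polynomial `g` in `z` and `z̄` the integral is the same polynomial in `U` and its adjoint,
so it does not depend on the family. -/
theorem exists_isOperatorIntegral_comp_sphereParam {F F' : SpectralFamily K} {U : K →L[ℂ] K}
    (hF : F.IsOperatorIntegral circlePoint U) (hF' : F'.IsOperatorIntegral circlePoint U)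
    {g : BoundedContinuousFunction (Metric.sphere (0 : ℂ) 1) ℂ}
    (hg : g ∈ StarAlgebra.adjoin ℂ {sphereCoord}) :
    ∃ B, F.IsOperatorIntegral (fun θ => g (sphereParam θ)) B ∧
      F'.IsOperatorIntegral (fun θ => g (sphereParam θ)) B := by
  induction hg using StarAlgebra.adjoin_induction with
  | mem g hg =>
    obtain rfl := mem_singleton_iff.1 hg
    exact ⟨U, hF, hF'⟩
  | algebraMap c =>
    refine ⟨c • 1, ?_⟩
    have : (fun θ => algebraMap ℂ (BoundedContinuousFunction (Metric.sphere (0 : ℂ) 1) ℂ) c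
        (sphereParam θ)) = c • (1 : ℝ → ℂ) := by
      ext θ; simp [Algebra.algebraMap_eq_smul_one]
    rw [this]
    exact ⟨F.isOperatorIntegral_one.smul c, F'.isOperatorIntegral_one.smul c⟩
  | add g h _ _ hg hh =>
    obtain ⟨B, hB, hB'⟩ := hg
    obtain ⟨C, hC, hC'⟩ := hh
    exact ⟨B + C, hB.add hC (isBoundedBorel_comp_sphereParam g) (isBoundedBorel_comp_sphereParam h),
      hB'.add hC' (isBoundedBorel_comp_sphereParam g) (isBoundedBorel_comp_sphereParam h)⟩
  | mul g h _ _ hg hh =>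
    obtain ⟨B, hB, hB'⟩ := hg
    obtain ⟨C, hC, hC'⟩ := hh
    exact ⟨B * C, hB.mul hC (isBoundedBorel_comp_sphereParam g) (isBoundedBorel_comp_sphereParam h),
      hB'.mul hC' (isBoundedBorel_comp_sphereParam g) (isBoundedBorel_comp_sphereParam h)⟩
  | star g _ hg =>
    obtain ⟨B, hB, hB'⟩ := hg
    exact ⟨star B, hB.star, hB'.star⟩

/-- The polynomials in `z` and `z̄` form a `*`-algebra that separates points, so their integrals
determine a finite measure on the circle. -/
theorem measure_map_sphereParam_eq {F F' : SpectralFamily K} {U : K →L[ℂ] K}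
    (hF : F.IsOperatorIntegral circlePoint U) (hF' : F'.IsOperatorIntegral circlePoint U) (x : K) :
    (F.measure x).map sphereParam = (F'.measure x).map sphereParam := by
  refine ext_of_forall_mem_subalgebra_integral_eq_of_polish (𝕜 := ℂ)
    (A := StarAlgebra.adjoin ℂ {sphereCoord}) ?_ fun g hg => ?_
  · intro z w hzw
    refine ⟨sphereCoord, ⟨sphereCoord.toContinuousMap, ?_, rfl⟩, fun h => hzw (Subtype.ext h)⟩
    exact ⟨sphereCoord, StarAlgebra.self_mem_adjoin_singleton ℂ _, rfl⟩
  · obtain ⟨B, hB, hB'⟩ := exists_isOperatorIntegral_comp_sphereParam hF hF' hg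
    rw [integral_map continuous_sphereParam.aemeasurable g.continuous.aestronglyMeasurable,
      integral_map continuous_sphereParam.aemeasurable g.continuous.aestronglyMeasurable]
    exact (hB x).symm.trans (hB' x)

/-- Each measure is carried by `[0, 1)`, where `circleParam` inverts `sphereParam`; it is thus
recovered from its image on the circle. -/
theorem IsSpectralFamilyOfUnitary.unique {F F' : SpectralFamily K} {U : K →L[ℂ] K}
    (hF : F.IsSpectralFamilyOfUnitary U) (hF' : F'.IsSpectralFamilyOfUnitary U) : F = F' := by
  have key : ∀ {F : SpectralFamily K}, F.IsSpectralFamilyOfUnitary U → ∀ x,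
      F.measure x = ((F.measure x).map sphereParam).map circleParam := by
    intro F hF x
    rw [Measure.map_map measurable_circleParam continuous_sphereParam.measurable]
    conv_lhs => rw [← Measure.map_id (μ := F.measure x)]
    refine Measure.map_congr ?_
    filter_upwards [hF.ae_mem_Ico x] with θ hθ
    exact (circleParam_sphereParam hθ.1 hθ.2).symm
  refine ext_of_measure fun x => ?_
  rw [key hF, key hF', measure_map_sphereParam_eq hF.2.2 hF'.2.2]

end SpectralFamily

/-! ### Spectral measures of representations of `C(X)` -/

namespace SpectralMeasure

variable {K : Type*} [NormedAddCommGroup K] [InnerProductSpace ℂ K] [CompleteSpace K]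
variable {X : Type*} [MetricSpace X]

theorem exists_tendsto_indicator {C : Set X} (hC : IsClosed C) :
    ∃ g : ℕ → C(X, ℂ), (∀ n z, ‖g n z‖ ≤ 1) ∧
      ∀ z, Tendsto (fun n => g n z) atTop (𝓝 (C.indicator 1 z)) := by
  have hδ : ∀ n : ℕ, (0 : ℝ) < 1 / ((n : ℝ) + 1) := fun n => Nat.one_div_pos_of_nat
  refine ⟨fun n => ⟨fun z => ((thickenedIndicator (hδ n) C z : ℝ≥0) : ℂ), ?_⟩, fun n z => ?_,
    fun z => ?_⟩
  · have := (thickenedIndicator (hδ n) C).continuous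
    fun_prop
  · have := thickenedIndicator_le_one (hδ n) C z
    simpa using this
  · have h := (tendsto_pi_nhds.1 (thickenedIndicator_tendsto_indicator_closure hδ
      tendsto_one_div_add_atTop_nhds_zero_nat C)) z
    have hc : Continuous fun r : ℝ≥0 => ((r : ℝ≥0) : ℂ) := by fun_prop
    rw [hC.closure_eq] at h
    have e : C.indicator (1 : X → ℂ) z = ((C.indicator (fun _ => (1 : ℝ≥0)) z : ℝ≥0) : ℂ) := by
      by_cases hz : z ∈ C <;> simp [hz]
    rw [e]
    exact (hc.tendsto _).comp h

variable (φ : C(X, ℂ) →⋆ₐ[ℂ] (K →L[ℂ] K))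

theorem map_star_eq (f : C(X, ℂ)) : φ (star f) = ContinuousLinearMap.adjoint (φ f) := map_star φ f

variable [CompactSpace X]

/-- The quadratic form of a representation of `C(X)` at a vector, as a positive functional. -/
def functional (x : K) : CompactlySupportedContinuousMap X ℝ →ₚ[ℝ] ℝ :=
  PositiveLinearMap.mk₀
    { toFun := fun f => (⟪x, φ ⟨fun z => (f z : ℂ), by fun_prop⟩ x⟫_ℂ).re
      map_add' := fun f g => by
        rw [← Complex.add_re, ← inner_add_right, ← add_apply, ← map_add]
        congr 5; ext z; simp
      map_smul' := fun c f => by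
        rw [RingHom.id_apply, smul_eq_mul, ← Complex.re_ofReal_mul, ← inner_smul_right,
          ← smul_apply, ← map_smul]
        congr 5; ext z; simp }
    fun f hf => by
      -- Positivity: `f = (√f)* √f`, so the form at `x` is `‖φ (√f) x‖²`.
      have e : (⟨fun z => (f z : ℂ), by fun_prop⟩ : C(X, ℂ))
          = star ⟨fun z => ((√(f z) : ℝ) : ℂ), by fun_prop⟩
            * ⟨fun z => ((√(f z) : ℝ) : ℂ), by fun_prop⟩ := by
        ext z
        have : 0 ≤ f z := hf z
        simp [← Complex.ofReal_mul, Real.mul_self_sqrt this]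
      change 0 ≤ (⟪x, φ _ x⟫_ℂ).re
      rw [e, map_mul, map_star_eq, mul_apply_eq_comp, ContinuousLinearMap.adjoint_inner_right]
      exact inner_self_nonneg (𝕜 := ℂ)

variable [MeasurableSpace X] [BorelSpace X]

/-- The measure representing the quadratic form of a representation of `C(X)` at a vector. -/
def vectorMeasure (x : K) : Measure X := RealRMK.rieszMeasure (functional φ x)

instance (x : K) : IsFiniteMeasure (vectorMeasure φ x) :=
  ⟨by
    have := RealRMK.rieszMeasure_le_of_eq_one (functional φ x)
      (f := ⟨1, HasCompactSupport.of_compactSpace _⟩) (fun _ => zero_le_one) isCompact_univ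
      fun _ _ => rfl
    exact this.trans_lt ENNReal.ofReal_lt_top⟩

theorem integrable_continuousMap (f : C(X, ℂ)) (x : K) : Integrable f (vectorMeasure φ x) :=
  .of_bound f.continuous.aestronglyMeasurable ‖f‖ (.of_forall f.norm_coe_le_norm)

/-- The functional keeps only the real part; nothing is lost, since a real `f` goes to a
self-adjoint operator. -/
theorem integral_ofReal_vectorMeasure (f : C(X, ℝ)) (x : K) :
    ((∫ z, f z ∂(vectorMeasure φ x) : ℝ) : ℂ) = ⟪x, φ ⟨fun z => (f z : ℂ), by fun_prop⟩ x⟫_ℂ := by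
  have h := RealRMK.integral_rieszMeasure (functional φ x)
    ⟨f, HasCompactSupport.of_compactSpace _⟩
  have h2 : ∫ z, f z ∂(vectorMeasure φ x) = (⟪x, φ ⟨fun z => (f z : ℂ), by fun_prop⟩ x⟫_ℂ).re := h
  rw [h2]
  refine Complex.conj_eq_iff_re.1 ?_
  rw [inner_conj_symm, ← ContinuousLinearMap.adjoint_inner_right, ← map_star_eq]
  congr 4; ext z; simp

theorem integral_vectorMeasure (f : C(X, ℂ)) (x : K) :
    ∫ z, f z ∂(vectorMeasure φ x) = ⟪x, φ f x⟫_ℂ := by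
  have hre := integral_ofReal_vectorMeasure φ ⟨fun z => (f z).re, by fun_prop⟩ x
  have him := integral_ofReal_vectorMeasure φ ⟨fun z => (f z).im, by fun_prop⟩ x
  have e : f = ⟨fun z => ((f z).re : ℂ), by fun_prop⟩
      + Complex.I • ⟨fun z => ((f z).im : ℂ), by fun_prop⟩ := by
    ext z
    simp [mul_comm Complex.I, Complex.re_add_im]
  conv_rhs => rw [e, map_add, map_smul, add_apply, smul_apply, inner_add_right, inner_smul_right]
  have := integral_re_add_im (integrable_continuousMap φ f x)
  rw [← this, mul_comm]
  exact congrArg₂ (fun p q => p + Complex.I * q) hre him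

theorem vectorMeasure_real_univ (x : K) : (vectorMeasure φ x).real univ = ‖x‖ ^ 2 := by
  have h := integral_vectorMeasure φ 1 x
  rw [map_one, one_apply_eq_self, inner_self_eq_norm_sq_to_K] at h
  simp only [ContinuousMap.one_apply, integral_const, Complex.coe_algebraMap] at h
  rw [Complex.real_smul, mul_one] at h
  exact_mod_cast h

theorem tendsto_integral_of_tendsto {g : ℕ → C(X, ℂ)} {M : ℝ} (hg : ∀ n z, ‖g n z‖ ≤ M) {q : X → ℂ}
    (hq : ∀ z, Tendsto (fun n => g n z) atTop (𝓝 (q z))) (x : K) :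
    Tendsto (fun n => ⟪x, φ (g n) x⟫_ℂ) atTop (𝓝 (∫ z, q z ∂(vectorMeasure φ x))) := by
  simp only [← integral_vectorMeasure]
  exact tendsto_integral_of_dominated_convergence (fun _ => M)
    (fun n => (g n).continuous.aestronglyMeasurable) (integrable_const _)
    (fun n => .of_forall (hg n)) (.of_forall hq)

/-- The indicator of a closed set is a bounded limit of continuous functions, so dominated
convergence for every vector measure yields the weak limit. -/
theorem exists_weak_limit_indicator {C : Set X} (hC : IsClosed C) :
    ∃ (P : K →L[ℂ] K) (g : ℕ → C(X, ℂ)), (∀ n z, ‖g n z‖ ≤ 1) ∧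
      (∀ z, Tendsto (fun n => g n z) atTop (𝓝 (C.indicator 1 z))) ∧
      (∀ x, ⟪x, P x⟫_ℂ = (vectorMeasure φ x).real C) ∧
      ∀ x y, Tendsto (fun n => ⟪x, φ (g n) y⟫_ℂ) atTop (𝓝 ⟪x, P y⟫_ℂ) := by
  obtain ⟨g, hg, hlim⟩ := exists_tendsto_indicator hC
  have h := tendsto_integral_of_tendsto φ hg hlim
  obtain ⟨P, hP⟩ := exists_weak_limit zero_le_one (fun n x => by
    rw [← integral_vectorMeasure, ← vectorMeasure_real_univ φ]
    exact norm_integral_le_of_norm_le_const (.of_forall (hg n))) h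
  refine ⟨P, g, hg, hlim, fun x => ?_, tendsto_inner_of_tendsto_inner_self fun x => ?_⟩
  · rw [hP, integral_indicator hC.measurableSet]
    simp
  · rw [hP]; exact h x

/-- The spectral projection of a closed set. -/
def closedProj (C : Set X) : K →L[ℂ] K :=
  open scoped Classical in
  if hC : IsClosed C then (exists_weak_limit_indicator φ hC).choose else 0

variable {C D : Set X}

theorem exists_tendsto_closedProj (hC : IsClosed C) : ∃ g : ℕ → C(X, ℂ), (∀ n z, ‖g n z‖ ≤ 1) ∧
      (∀ z, Tendsto (fun n => g n z) atTop (𝓝 (C.indicator 1 z))) ∧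
      (∀ x, ⟪x, closedProj φ C x⟫_ℂ = (vectorMeasure φ x).real C) ∧
      ∀ x y, Tendsto (fun n => ⟪x, φ (g n) y⟫_ℂ) atTop (𝓝 ⟪x, closedProj φ C y⟫_ℂ) := by
  rw [closedProj, dif_pos hC]
  exact (exists_weak_limit_indicator φ hC).choose_spec

theorem inner_closedProj_self (hC : IsClosed C) (x : K) :
    ⟪x, closedProj φ C x⟫_ℂ = (vectorMeasure φ x).real C :=
  (exists_tendsto_closedProj φ hC).choose_spec.2.2.1 x

theorem commute_closedProj (hC : IsClosed C) {A : K →L[ℂ] K} (hA : ∀ f, Commute A (φ f)) :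
    Commute A (closedProj φ C) := by
  obtain ⟨g, -, -, -, h⟩ := exists_tendsto_closedProj φ hC
  ext y
  refine ext_inner_left ℂ fun x => ?_
  rw [mul_apply_eq_comp, mul_apply_eq_comp, ← ContinuousLinearMap.adjoint_inner_left]
  refine tendsto_nhds_unique (h _ _) ((h x (A y)).congr fun n => ?_)
  rw [ContinuousLinearMap.adjoint_inner_left, ← mul_apply_eq_comp, ← mul_apply_eq_comp, (hA _).eq]

theorem inner_apply_closedProj (hC : IsClosed C) (f : C(X, ℂ)) (x : K) :
    ⟪x, φ f (closedProj φ C x)⟫_ℂ = ∫ z in C, f z ∂(vectorMeasure φ x) := by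
  obtain ⟨g, hg, hlim, -, h⟩ := exists_tendsto_closedProj φ hC
  rw [← ContinuousLinearMap.adjoint_inner_left, ← integral_indicator hC.measurableSet]
  refine tendsto_nhds_unique (h _ _) ?_
  have h2 := tendsto_integral_of_tendsto φ (g := fun n => f * g n) (M := ‖f‖)
    (q := C.indicator f) (fun n z => ?_) (fun z => ?_) x
  · refine h2.congr fun n => ?_
    rw [ContinuousLinearMap.adjoint_inner_left, map_mul]; rfl
  · rw [ContinuousMap.mul_apply, norm_mul]
    exact (mul_le_of_le_one_right (norm_nonneg _) (hg n z)).trans (f.norm_coe_le_norm z)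
  · have e : C.indicator f z = f z * C.indicator 1 z := by
      by_cases hz : z ∈ C <;> simp [hz]
    rw [e]
    exact (hlim z).const_mul (f z)

/-- The two approximations are passed to the limit one at a time: `inner_apply_closedProj` has
already done so for `C`, leaving an integral over `C` for the one of `D`. -/
theorem closedProj_mul (hC : IsClosed C) (hD : IsClosed D) :
    closedProj φ D * closedProj φ C = closedProj φ (D ∩ C) := by
  obtain ⟨g, hg, hlim, -, h⟩ := exists_tendsto_closedProj φ hD
  refine ContinuousLinearMap.ext_inner_self fun x => ?_
  rw [inner_closedProj_self φ (hD.inter hC)]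
  refine tendsto_nhds_unique (h x (closedProj φ C x)) ?_
  simp only [inner_apply_closedProj φ hC]
  have h2 : Tendsto (fun n => ∫ z in C, g n z ∂(vectorMeasure φ x)) atTop
      (𝓝 (∫ z in C, D.indicator 1 z ∂(vectorMeasure φ x))) :=
    tendsto_integral_of_dominated_convergence (fun _ => 1)
      (fun n => (g n).continuous.aestronglyMeasurable) (integrable_const _)
      (fun n => .of_forall (hg n)) (.of_forall hlim)
  rw [integral_indicator hD.measurableSet, Measure.restrict_restrict hD.measurableSet] at h2
  simpa using h2

theorem isStarProjection_closedProj (hC : IsClosed C) : IsStarProjection (closedProj φ C) := by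
  constructor
  · rw [IsIdempotentElem, closedProj_mul φ hC hC, inter_self]
  · refine ContinuousLinearMap.ext_inner_self fun x => ?_
    rw [ContinuousLinearMap.star_eq_adjoint, ContinuousLinearMap.adjoint_inner_right,
      ← inner_conj_symm, inner_closedProj_self φ hC, Complex.conj_ofReal]

theorem norm_closedProj_sq (hC : IsClosed C) (x : K) :
    ‖closedProj φ C x‖ ^ 2 = (vectorMeasure φ x).real C := by
  have h := (isStarProjection_closedProj φ hC).inner_self_eq x
  rw [inner_closedProj_self φ hC] at h
  exact_mod_cast h.symm

end SpectralMeasure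

/-! ### Existence of the spectral family of a unitary operator without eigenvalue one -/

/-- On the unit circle `i(1 + z)/(1 - z)` is real, so the real part in `cayleyInv` discards nothing.
-/
theorem cayleyFun_cayleyInv {z : ℂ} (hz : ‖z‖ = 1) (h1 : z ≠ 1) :
    cayleyFun (SpectralFamily.cayleyInv z) = z := by
  have h1' : 1 - z ≠ 0 := sub_ne_zero.2 h1.symm
  set w := Complex.I * (1 + z) / (1 - z) with hw
  have hzz : (starRingEnd ℂ) z * z = 1 := by
    rw [mul_comm, Complex.mul_conj, Complex.normSq_eq_norm_sq, hz]; simp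
  have hc1 : 1 - (starRingEnd ℂ) z ≠ 0 := fun h => h1' (by
    have := congrArg (starRingEnd ℂ) h
    simpa using this)
  have hconj : (starRingEnd ℂ) w = w := by
    rw [hw]
    simp only [map_div₀, map_mul, Complex.conj_I, map_add, map_sub, map_one]
    rw [div_eq_div_iff hc1 h1']
    linear_combination (2 * Complex.I) * hzz
  have hre : ((SpectralFamily.cayleyInv z : ℝ) : ℂ) = w := Complex.conj_eq_iff_re.1 hconj
  have hr : 1 - w * Complex.I = 2 / (1 - z) := by
    rw [hw]
    field_simp
    linear_combination (-(1 + z)) * Complex.I_sq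
  rw [cayleyFun, resolventFun, hre, hr]
  field_simp
  ring

/-- With the denominator cleared, the condition is closed on the whole circle, including `z = 1`, so
`closedProj` applies to its solution set. -/
theorem cayleyInv_le_iff {z : ℂ} (hz : ‖z‖ = 1) (h1 : z ≠ 1) (a : ℝ) :
    SpectralFamily.cayleyInv z ≤ a ↔ -2 * z.im ≤ a * Complex.normSq (1 - z) := by
  have h1' : 0 < Complex.normSq (1 - z) := Complex.normSq_pos.2 (sub_ne_zero.2 h1.symm)
  have hn : z.re * z.re + z.im * z.im = 1 := by
    rw [← Complex.normSq_apply, Complex.normSq_eq_norm_sq, hz, one_pow]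
  have e : SpectralFamily.cayleyInv z = -2 * z.im / Complex.normSq (1 - z) := by
    rw [SpectralFamily.cayleyInv, Complex.div_re, ← add_div]
    congr 1
    simp only [Complex.mul_re, Complex.mul_im, Complex.I_re, Complex.I_im, Complex.add_re,
      Complex.add_im, Complex.sub_re, Complex.sub_im, Complex.one_re, Complex.one_im]
    ring
  rw [e, div_le_iff₀ h1']

-- The spectral measure of `U` on its spectrum does not charge `1`, so the inverse Cayley map
-- transports it to the line. The projections are weak limits of continuous functions of `U`, whence
-- the commutation clause.
open SpectralMeasure in
theorem SpectralFamily.exists_of_unitary {K : Type*} [NormedAddCommGroup K] [InnerProductSpace ℂ K]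
    [CompleteSpace K] {U : K →L[ℂ] K} (hU : star U * U = 1) (hU' : U * star U = 1)
    (h1 : ∀ x, U x = x → x = 0) :
    ∃ E : SpectralFamily K, E.IsOperatorIntegral cayleyFun U ∧
      ∀ D, Commute U D → Commute (star U) D → ∀ a, Commute D (E.proj a) := by
  have hn : IsStarNormal U := ⟨by rw [commute_iff_eq, hU, hU']⟩
  let φ : C(spectrum ℂ U, ℂ) →⋆ₐ[ℂ] (K →L[ℂ] K) := cfcHom hn
  let ι : C(spectrum ℂ U, ℂ) := ⟨Subtype.val, continuous_subtype_val⟩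
  have hι : φ ι = U := cfcHom_id hn
  have hnorm : ∀ z : spectrum ℂ U, ‖(z : ℂ)‖ = 1 := fun z => by
    have := spectrum.subset_circle_of_unitary (𝕜 := ℂ) (Unitary.mem_iff.2 ⟨hU, hU'⟩) z.2
    simpa using this
  let O : Set (spectrum ℂ U) := {z | (z : ℂ) = 1}
  have hO : IsClosed O := isClosed_eq continuous_subtype_val continuous_const
  -- The range of this projection lies in the kernel of `U - 1`, which is trivial by `h1`.
  have hPO : closedProj φ O = 0 := by
    have hz : φ (ι - 1) * closedProj φ O = 0 := ContinuousLinearMap.ext_inner_self fun x => by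
      rw [mul_apply_eq_comp, inner_apply_closedProj φ hO, zero_apply, inner_zero_right]
      refine setIntegral_eq_zero_of_forall_eq_zero fun z hz => ?_
      have : (z : ℂ) = 1 := hz
      simp [ι, this]
    rw [map_sub, hι, map_one] at hz
    ext x
    have := DFunLike.congr_fun hz x
    rw [mul_apply_eq_comp, sub_apply, one_apply_eq_self, zero_apply, sub_eq_zero] at this
    exact h1 _ this
  have hae : ∀ x, ∀ᵐ z : spectrum ℂ U ∂(vectorMeasure φ x), (z : ℂ) ≠ 1 := fun x => by
    have h := norm_closedProj_sq φ hO x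
    rw [hPO, zero_apply, norm_zero, zero_pow two_ne_zero] at h
    have h2 : vectorMeasure φ x O = 0 := (measureReal_eq_zero_iff (measure_ne_top _ _)).1 h.symm
    exact measure_mono_null (fun z hz => not_not.1 hz) h2
  let C : ℝ → Set (spectrum ℂ U) := fun a =>
    {z | -2 * (z : ℂ).im ≤ a * Complex.normSq (1 - (z : ℂ))}
  have hC : ∀ a, IsClosed (C a) := fun a => by
    have := Complex.continuous_normSq
    exact isClosed_le (by fun_prop) (by fun_prop)
  have hmeas : Measurable fun z : spectrum ℂ U => SpectralFamily.cayleyInv (z : ℂ) :=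
    SpectralFamily.measurable_cayleyInv.comp measurable_subtype_coe
  have hm : ∀ a x, ‖closedProj φ (C a) x‖ ^ 2
      = ((vectorMeasure φ x).map fun z : spectrum ℂ U =>
        SpectralFamily.cayleyInv z).real (Iic a) := by
    intro a x
    rw [norm_closedProj_sq φ (hC a), map_measureReal_apply hmeas measurableSet_Iic]
    refine measureReal_congr ?_
    filter_upwards [hae x] with z hz
    exact propext (cayleyInv_le_iff (hnorm z) hz a).symm
  let E : SpectralFamily K := SpectralFamily.ofMeasure (fun a => closedProj φ (C a))
    (fun a => isStarProjection_closedProj φ (hC a))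
    (fun a b hab => by
      rw [closedProj_mul φ (hC b) (hC a), inter_eq_left.2]
      exact fun z hz => le_trans (α := ℝ) hz
        (mul_le_mul_of_nonneg_right hab (Complex.normSq_nonneg _)))
    (fun x => (vectorMeasure φ x).map fun z : spectrum ℂ U => SpectralFamily.cayleyInv z) hm
    (fun x => by rw [map_measureReal_apply hmeas .univ, preimage_univ, vectorMeasure_real_univ])
  have hE : ∀ x, E.measure x
      = (vectorMeasure φ x).map fun z : spectrum ℂ U => SpectralFamily.cayleyInv z := fun x =>
    E.measure_eq x fun a => (hm a x).symm
  refine ⟨E, fun x => ?_, fun D hD hD' a => ?_⟩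
  · rw [hE, integral_map hmeas.aemeasurable
      isBoundedBorel_cayleyFun.measurable.aestronglyMeasurable]
    conv_lhs => rw [← hι, ← integral_vectorMeasure]
    refine integral_congr_ae ?_
    filter_upwards [hae x] with z hz
    exact (cayleyFun_cayleyInv (hnorm z) hz).symm
  · exact commute_closedProj φ (hC a) fun f => (hD.cfcHom hn hD' f).symm

/-! ### Strong limits in closures and generated algebras. -/

section StrongLimits

variable {K : Type*} [NormedAddCommGroup K] [InnerProductSpace ℂ K]

theorem mem_strongClosure_of_tendsto {ι : Type*} {l : Filter ι} [l.NeBot] {S : Set (K →L[ℂ] K)}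
    {B : ι → K →L[ℂ] K} {C : K →L[ℂ] K} (hB : ∀ᶠ i in l, B i ∈ S)
    (h : ∀ x, Tendsto (fun i => B i x) l (𝓝 (C x))) : C ∈ strongClosure S := by
  refine mem_strongClosure_of_forall fun n x ε hε => ?_
  have h2 : ∀ᶠ i in l, ∀ k, ‖B i (x k) - C (x k)‖ < ε := by
    refine eventually_all.2 fun k => ?_
    filter_upwards [Metric.tendsto_nhds.1 (h (x k)) ε hε] with i hi
    rwa [← dist_eq_norm]
  obtain ⟨i, hi, hi2⟩ := (hB.and h2).exists
  exact ⟨B i, hi, hi2⟩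

theorem mem_generatedAlgebra_of_tendsto [CompleteSpace K] {ι : Type*} {l : Filter ι} [l.NeBot]
    {S : Set (K →L[ℂ] K)} {B : ι → K →L[ℂ] K} {C : K →L[ℂ] K} (hB : ∀ᶠ i in l, B i ∈ S)
    (h : ∀ x, Tendsto (fun i => B i x) l (𝓝 (C x))) : C ∈ generatedAlgebra S := by
  have h2 := strongClosure_mono (subset_generatedAlgebra S) (mem_strongClosure_of_tendsto hB h)
  rwa [(isWeaklyClosed_generatedAlgebra S).strongClosure_eq] at h2

end StrongLimits

namespace SpectralFamily

variable {K : Type*} [NormedAddCommGroup K] [InnerProductSpace ℂ K] [CompleteSpace K]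
variable (E : SpectralFamily K)

/-! ### The algebra of a spectral family -/

/-- The functional calculus of a spectral family for bounded Borel functions. -/
def boundedCalculus : Submodule ℂ (K →L[ℂ] K) where
  carrier := {B | ∃ u, IsBoundedBorel u ∧ E.IsOperatorIntegral u B}
  add_mem' := by
    rintro B C ⟨u, hu, hB⟩ ⟨v, hv, hC⟩
    exact ⟨u + v, hu.add hv, hB.add hC hu hv⟩
  zero_mem' := ⟨0, IsBoundedBorel.const 0, fun x => by simp⟩
  smul_mem' := by
    rintro c B ⟨u, hu, hB⟩
    exact ⟨c • u, hu.smul c, hB.smul c⟩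

/-- Setting `u` to zero where `‖u‖ > c` changes it only on a set that is null for every vector
measure. -/
theorem coe_boundedCalculus : (E.boundedCalculus : Set (K →L[ℂ] K)) = E.lineCalculus := by
  refine Subset.antisymm ?_ ?_
  · rintro B ⟨u, hu, hB⟩
    obtain ⟨c, hc⟩ := hu.bounded
    exact ⟨u, hu.measurable, ⟨c, fun x => .of_forall hc⟩, hB⟩
  · rintro B ⟨u, hu, ⟨c, hc⟩, hB⟩
    refine ⟨{a | ‖u a‖ ≤ c}.indicator u,
      -- `c` may be negative when all the measures vanish, hence the bound `|c|`.
      ⟨hu.indicator (measurableSet_le hu.norm measurable_const), |c|, fun a => ?_⟩,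
      hB.congr fun x => ?_⟩
    · by_cases h : a ∈ {a | ‖u a‖ ≤ c}
      · rw [indicator_of_mem h]
        exact le_trans (α := ℝ) h (le_abs_self c)
      · rw [indicator_of_notMem h, norm_zero]
        exact abs_nonneg c
    · filter_upwards [hc x] with a ha
      exact (indicator_of_mem (s := {a | ‖u a‖ ≤ c}) ha u).symm

theorem strongClosure_lineCalculus :
    strongClosure E.lineCalculus = Set.centralizer (Set.centralizer (range E.proj)) := by
  have h : Set.centralizer (E.boundedCalculus : Set (K →L[ℂ] K))
      = Set.centralizer (range E.proj) := by
    refine Subset.antisymm (Set.centralizer_subset ?_) fun D hD => ?_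
    · rintro _ ⟨a, rfl⟩
      exact ⟨_, IsBoundedBorel.indicator_one measurableSet_Iic, E.isOperatorIntegral_proj a⟩
    · rintro B ⟨u, hu, hB⟩
      rw [← hB.calculus_eq]
      exact (E.commute_calculus (fun a => (hD _ ⟨a, rfl⟩).symm) hu).symm
  rw [← coe_boundedCalculus, ← h]
  refine strongClosure_eq_centralizer (S := E.boundedCalculus) ⟨1, IsBoundedBorel.one,
    E.isOperatorIntegral_one⟩ ?_ ?_ Subset.rfl Set.subset_centralizer_centralizer
  · rintro B ⟨u, hu, hB⟩ C ⟨v, hv, hC⟩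
    exact ⟨u * v, hu.mul hv, hB.mul hC hu hv⟩
  · rintro B ⟨u, hu, hB⟩
    exact ⟨star u, hu.star, hB.star⟩

/-- The identity enters the algebra as the strong limit of the projections at `+∞`. -/
theorem coe_generatedAlgebra_range_proj : (generatedAlgebra (range E.proj) : Set (K →L[ℂ] K))
    = Set.centralizer (Set.centralizer (range E.proj)) := by
  refine coe_generatedAlgebra ?_ (mem_generatedAlgebra_of_tendsto
    (.of_forall fun a => mem_range_self a) E.tendsto_atTop)
  rintro _ ⟨a, rfl⟩
  rw [(E.isStarProjection a).isSelfAdjoint.star_eq]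
  exact mem_range_self a

theorem coe_generatedAlgebra_image_proj (h : ∀ x, Tendsto (fun θ => E.proj θ x) (𝓝[<] 1) (𝓝 x)) :
    (generatedAlgebra (E.proj '' Ico 0 1) : Set (K →L[ℂ] K))
      = Set.centralizer (Set.centralizer (E.proj '' Ico 0 1)) := by
  refine coe_generatedAlgebra ?_ (mem_generatedAlgebra_of_tendsto (l := 𝓝[<] (1 : ℝ))
    (B := E.proj) ?_ h)
  · rintro _ ⟨a, ha, rfl⟩
    rw [(E.isStarProjection a).isSelfAdjoint.star_eq]
    exact mem_image_of_mem _ ha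
  · filter_upwards [Ico_mem_nhdsLT (zero_lt_one' ℝ)] with θ hθ using mem_image_of_mem _ hθ

/-- The angle takes the line onto `(0, 1)`, so the only further projection is the one at `θ = 0`,
which vanishes. -/
theorem centralizer_image_proj_toCircle :
    Set.centralizer (E.toCircle.proj '' Ico 0 1) = Set.centralizer (range E.proj) := by
  refine Subset.antisymm (Set.centralizer_subset ?_) fun D hD => ?_
  · rintro _ ⟨a, rfl⟩
    exact ⟨angle a, ⟨(angle_pos a).le, angle_lt_one a⟩, E.toCircle_proj_angle a⟩
  · rintro _ ⟨θ, ⟨h0, h1⟩, rfl⟩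
    rcases h0.eq_or_lt with rfl | h0
    · rw [E.toCircle_proj_of_nonpos le_rfl, zero_mul, mul_zero]
    · rw [← angle_tan h0 h1, E.toCircle_proj_angle]
      exact hD _ ⟨_, rfl⟩

end SpectralFamily

namespace StronglyContinuousUnitaryGroup

variable {K : Type*} [NormedAddCommGroup K] [InnerProductSpace ℂ K] [CompleteSpace K]
variable (W : StronglyContinuousUnitaryGroup K)

/-! ### The spectral family and the algebra of a unitary group -/

theorem eq_zero_of_cayley_apply_eq {x : K} (h : W.cayley x = x) : x = 0 := by
  refine (injective_iff_map_eq_zero _).1 W.resolvent_injective x ?_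
  rw [cayley, sub_apply, one_apply_eq_self, sub_eq_self, two_mul, add_apply, ← two_smul ℂ] at h
  exact (smul_eq_zero.1 h).resolve_left two_ne_zero

/-- Commuting with `U` means commuting with the whole group, hence with the reversed group, whose
Cayley transform is `U*`. -/
theorem commute_star_cayley {D : K →L[ℂ] K} (h : Commute D W.cayley) :
    Commute D (star W.cayley) := by
  rw [star_cayley]
  exact W.reverse.commute_cayley_iff.2 fun t => W.commute_cayley_iff.1 h (-t)

theorem existsUnique_isOperatorIntegral_cayleyFun :
    ∃! E : SpectralFamily K, E.IsOperatorIntegral cayleyFun W.cayley := by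
  obtain ⟨E, hE, -⟩ := SpectralFamily.exists_of_unitary W.star_cayley_mul_cayley
    W.cayley_mul_star_cayley fun x => W.eq_zero_of_cayley_apply_eq
  exact ⟨E, hE, fun E' hE' => SpectralFamily.toCircle_injective
    ((E'.isSpectralFamilyOfUnitary_toCircle hE').unique (E.isSpectralFamilyOfUnitary_toCircle hE))⟩

variable {W} {E : SpectralFamily K}

/-- By uniqueness `E` is the family constructed in `exists_of_unitary`, whose projections commute
with everything that commutes with `U` and `U*`. -/
theorem commute_proj_iff (hE : E.IsOperatorIntegral cayleyFun W.cayley) {D : K →L[ℂ] K} :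
    (∀ a, Commute D (E.proj a)) ↔ Commute D W.cayley := by
  constructor
  · intro h
    rw [← hE.calculus_eq]
    exact E.commute_calculus h isBoundedBorel_cayleyFun
  · intro h
    obtain ⟨E', hE', h'⟩ := SpectralFamily.exists_of_unitary W.star_cayley_mul_cayley
      W.cayley_mul_star_cayley fun x => W.eq_zero_of_cayley_apply_eq
    rw [W.existsUnique_isOperatorIntegral_cayleyFun.unique hE hE']
    exact h' D h.symm (W.commute_star_cayley h).symm

theorem centralizer_range_proj (hE : E.IsOperatorIntegral cayleyFun W.cayley) :
    Set.centralizer (range E.proj) = {D | Commute D W.cayley} := by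
  ext D
  rw [Set.mem_centralizer_iff, forall_mem_range]
  exact (forall_congr' fun a => eq_comm).trans (commute_proj_iff hE)

variable (W) in
theorem centralizer_range_op : Set.centralizer (range W.op) = {D | Commute D W.cayley} := by
  ext D
  rw [Set.mem_centralizer_iff, forall_mem_range]
  exact (forall_congr' fun a => eq_comm).trans W.commute_cayley_iff.symm

variable (W) in
theorem coe_generatedAlgebra_range_op : (generatedAlgebra (range W.op) : Set (K →L[ℂ] K))
    = Set.centralizer (Set.centralizer (range W.op)) := by
  refine coe_generatedAlgebra ?_ (subset_generatedAlgebra _ ⟨0, W.op_zero⟩)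
  rintro _ ⟨t, rfl⟩
  exact ⟨-t, (W.star_op t).symm⟩

end StronglyContinuousUnitaryGroup

/-! ### The algebra of the powers of the cogenerator. -/

namespace C0ContractionSemigroup

variable {H : Type*} [NormedAddCommGroup H] [InnerProductSpace ℂ H] [CompleteSpace H]
variable (T : C0ContractionSemigroup H)

theorem cogeneratorGroup_one : T.cogeneratorGroup 1 = T.unitaryCogenerator := pow_one _

theorem star_cogeneratorGroup (n : ℤ) : star (T.cogeneratorGroup n) = T.cogeneratorGroup (-n) := by
  have hpow : ∀ (B : T.unitarySubspace →L[ℂ] T.unitarySubspace) (n : ℕ),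
      star (B ^ n) = star B ^ n := fun B n => star_pow B n
  have hstar : ∀ B : T.unitarySubspace →L[ℂ] T.unitarySubspace, star (star B) = B :=
    ContinuousLinearMap.adjoint_adjoint
  cases n with
  | ofNat n =>
    cases n with
    | zero => exact hpow T.unitaryCogenerator 0
    | succ n => exact hpow T.unitaryCogenerator (n + 1)
  | negSucc n =>
    have := hpow (star T.unitaryCogenerator) (n + 1)
    rwa [hstar] at this

theorem centralizer_range_cogeneratorGroup :
    Set.centralizer (range T.cogeneratorGroup) = {D | Commute D T.toUnitaryGroup.cayley} := by
  rw [← unitaryCogenerator_eq_cayley]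
  ext D
  rw [Set.mem_centralizer_iff, forall_mem_range]
  constructor
  · intro h
    have := h 1
    rw [cogeneratorGroup_one] at this
    exact this.symm
  · intro (h : Commute D T.unitaryCogenerator) n
    have h2 : Commute D (star T.unitaryCogenerator) := by
      rw [unitaryCogenerator_eq_cayley] at h ⊢
      exact T.toUnitaryGroup.commute_star_cayley h
    cases n with
    | ofNat n => exact (h.pow_right n).symm
    | negSucc n => exact (h2.pow_right (n + 1)).symm

theorem coe_generatedAlgebra_range_cogeneratorGroup :
    (generatedAlgebra (range T.cogeneratorGroup) : Set _)
      = Set.centralizer (Set.centralizer (range T.cogeneratorGroup)) := by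
  refine coe_generatedAlgebra ?_ (subset_generatedAlgebra _ ⟨0, pow_zero _⟩)
  rintro _ ⟨n, rfl⟩
  exact ⟨-n, (T.star_cogeneratorGroup n).symm⟩

end C0ContractionSemigroup

/-! ### The main theorem. -/

theorem theorem3p2 {H : Type*} [NormedAddCommGroup H] [InnerProductSpace ℂ H] [CompleteSpace H]
    (T : C0ContractionSemigroup H) :
    (∃! E : SpectralFamily T.unitarySubspace,
      E.IsSpectralFamilyOfSelfAdjoint T.selfAdjointGenerator) ∧
    (∃! F : SpectralFamily T.unitarySubspace,
      F.IsSpectralFamilyOfUnitary T.unitaryCogenerator) ∧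
    ∀ E F : SpectralFamily T.unitarySubspace,
      E.IsSpectralFamilyOfSelfAdjoint T.selfAdjointGenerator →
      F.IsSpectralFamilyOfUnitary T.unitaryCogenerator →
      (∀ a : ℝ, E.proj a = F.proj (1 / 2 + Real.arctan a / Real.pi)) ∧
      (generatedAlgebra (Set.range T.unitaryGroup) : Set _) = strongClosure E.lineCalculus ∧
      strongClosure E.lineCalculus = generatedAlgebra (Set.range E.proj) ∧
      generatedAlgebra (Set.range E.proj) = generatedAlgebra (F.proj '' Set.Ico 0 1) ∧
      (generatedAlgebra (F.proj '' Set.Ico 0 1) : Set _) = strongClosure F.circleCalculus ∧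
      strongClosure F.circleCalculus = generatedAlgebra (Set.range T.cogeneratorGroup) ∧
      IsWStarSubalgebraWithUnit (generatedAlgebra (Set.range T.unitaryGroup))
        T.unitaryProjection ∧
      T.unitaryProjection = 1 := by
  have hiff : ∀ E : SpectralFamily T.unitarySubspace,
      E.IsSpectralFamilyOfSelfAdjoint T.selfAdjointGenerator ↔
        E.IsOperatorIntegral cayleyFun T.toUnitaryGroup.cayley := fun E =>
    E.isSpectralFamilyOfSelfAdjoint_iff T.toUnitaryGroup
  have hcirc : ∀ E : SpectralFamily T.unitarySubspace,
      E.IsOperatorIntegral cayleyFun T.toUnitaryGroup.cayley →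
        E.toCircle.IsSpectralFamilyOfUnitary T.unitaryCogenerator := fun E hE => by
    rw [T.unitaryCogenerator_eq_cayley]
    exact E.isSpectralFamilyOfUnitary_toCircle hE
  refine ⟨?_, ?_, fun E F hE hF => ?_⟩
  · simp only [hiff]
    exact T.toUnitaryGroup.existsUnique_isOperatorIntegral_cayleyFun
  · obtain ⟨E, hE, -⟩ := T.toUnitaryGroup.existsUnique_isOperatorIntegral_cayleyFun
    exact ⟨E.toCircle, hcirc E hE, fun F hF => hF.unique (hcirc E hE)⟩
  rw [hiff] at hE
  -- Uniqueness replaces `F` by `E.toCircle`; every algebra is then compared with the bicommutant of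
  -- the projections of `E`.
  obtain rfl := hF.unique (hcirc E hE)
  have hEc := StronglyContinuousUnitaryGroup.centralizer_range_proj hE
  have hop : (generatedAlgebra (Set.range T.unitaryGroup) : Set _)
      = Set.centralizer (Set.centralizer (Set.range E.proj)) := by
    rw [hEc, ← T.toUnitaryGroup.centralizer_range_op]
    exact T.toUnitaryGroup.coe_generatedAlgebra_range_op
  have hpow : (generatedAlgebra (Set.range T.cogeneratorGroup) : Set _)
      = Set.centralizer (Set.centralizer (Set.range E.proj)) := by
    rw [hEc, ← T.centralizer_range_cogeneratorGroup, T.coe_generatedAlgebra_range_cogeneratorGroup]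
  have hline := E.strongClosure_lineCalculus
  have hproj := E.coe_generatedAlgebra_range_proj
  have hF' : (generatedAlgebra (E.toCircle.proj '' Set.Ico 0 1) : Set _)
      = Set.centralizer (Set.centralizer (Set.range E.proj)) := by
    rw [E.toCircle.coe_generatedAlgebra_image_proj E.toCircle_tendsto,
      E.centralizer_image_proj_toCircle]
  refine ⟨fun a => (E.toCircle_proj_angle a).symm, hop.trans hline.symm, hline.trans hproj.symm,
    SetLike.coe_injective (hproj.trans hF'.symm), ?_, ?_, ⟨?_, ?_, ?_⟩,
    T.unitaryProjection_eq_one⟩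
  · rw [E.circleCalculus_toCircle, hF', hline]
  · rw [E.circleCalculus_toCircle, hpow, hline]
  · exact isWeaklyClosed_generatedAlgebra _
  · rw [T.unitaryProjection_eq_one]
    exact subset_generatedAlgebra _ ⟨0, T.toUnitaryGroup.op_zero⟩
  · intro B _
    rw [T.unitaryProjection_eq_one, one_mul, mul_one]
    exact ⟨rfl, rfl⟩
end
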